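/- Let $\mathbb F$ be a field and let $d, m, D \ge 0$ be integers such that the characteristic of $\mathbb F$ is zero or greater than $d$. Let $$Q(x,y_0,\dots,y_m)=\tilde Q(x)+\sum_{i=0}^{m}Q_i(x)\,y_i$$ with $\tilde Q,Q_0,\dots,Q_m\in\mathbb F[x]$ be a non-zero polynomial of $x$-degree at most $D$. Then the set $S$ of all polynomials $f\in\mathbb F[x]$ of degree at most $d$ with $$Q\bigl(x,f,f^{(1)},\dots,f^{(m)}\bigr)\equiv 0$$ is a (possibly empty) affine space of dimension at most $m$. Furthermore, there is a deterministic algorithm which, given $Q$ via its coefficient vector (the $m+2$ coefficient vectors of $\tilde Q,Q_0,\dots,Q_m$, each of length $D+1$) and the parameters $m,D,d$, outputs a basis of $S$, i.e. the coefficient vectors of affinely independent polynomials $v_1,\dots,v_r$ whose affine span is $S$ (with $r=0$ if $S=\emptyset$), and performs at most $\tilde O\bigl((D+d)\,\mathrm{poly}(m)\bigr)$ field operations. Precisely: there are a single algorithm and a single constant $c$, independent of $\mathbb F,m,D,d$ and $Q$, such that the number of field operations is at most $$c\,(D+d+1)\,(m+1)^{c}\,\lfloor\log_2(D+d+2)\rfloor^{c}.$$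 Here the algorithm has a computable control, not depending on $\mathbb F$, which accesses elements of $\mathbb F$ only by field operations: loading the constants $0$ and $1$, the arithmetic operations $+,-,\cdot,/$ (never dividing by $0$), and tests whether an element is $0$; each of these is counted as one operation. -/

import Mathlib

open Polynomial

/-! ### Linear differential polynomials -/

/-- The data of a polynomial `Q(x, y₀, …, yₘ) = Q̃(x) + ∑_{i ≤ m} Qᵢ(x) yᵢ` over `F`:
`free` is `Q̃` and `coeff i` is `Qᵢ`. -/
structure LinDiffPoly (F : Type*) [Field F] (m : ℕ) where
  free : F[X]
  coeff : Fin (m + 1) → F[X]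

namespace LinDiffPoly

variable {F : Type*} [Field F] {m : ℕ}

/-- `Q` as a polynomial in `y₀, …, yₘ` with coefficients in `F[x]`. -/
noncomputable def toMvPolynomial (Q : LinDiffPoly F m) : MvPolynomial (Fin (m + 1)) F[X] :=
  MvPolynomial.C Q.free + ∑ i, MvPolynomial.C (Q.coeff i) * MvPolynomial.X i

/-- The `x`-degree of `Q` is at most `D`. -/
def XDegreeLE (Q : LinDiffPoly F m) (D : ℕ) : Prop :=
  Q.free.natDegree ≤ D ∧ ∀ i, (Q.coeff i).natDegree ≤ D

/-- The univariate polynomial `Q(x, f, f⁽¹⁾, …, f⁽ᵐ⁾)`. -/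
noncomputable def subst (Q : LinDiffPoly F m) (f : F[X]) : F[X] :=
  MvPolynomial.eval (fun i : Fin (m + 1) => derivative^[(i : ℕ)] f) Q.toMvPolynomial

/-- The polynomials `f` of degree at most `d` with `Q(x, f, f⁽¹⁾, …, f⁽ᵐ⁾) ≡ 0`. -/
def solutions (Q : LinDiffPoly F m) (d : ℕ) : Set F[X] :=
  {f | f.natDegree ≤ d ∧ Q.subst f = 0}

end LinDiffPoly

/-- A basis of an affine space `A` (given by its set of points): an affinely independent family
whose affine span is `A`. The empty family is the basis of the empty space. -/
def IsAffineBasisOf {F V : Type*} [Field F] [AddCommGroup V] [Module F V] {r : ℕ}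
    (v : Fin r → V) (A : Set V) : Prop :=
  AffineIndependent F v ∧ (affineSpan F (Set.range v) : Set V) = A

/-- The coefficient vector of length `n + 1` of a polynomial (of degree at most `n`). -/
noncomputable def coeffVector {F : Type*} [Field F] (n : ℕ) (p : F[X]) : List F :=
  (List.range (n + 1)).map p.coeff

/-- The coefficient vector of `Q` when its `x`-degree is at most `D`: the coefficient vectors of
`Q̃, Q₀, …, Qₘ`, one after the other, each of length `D + 1`. -/
noncomputable def LinDiffPoly.coeffVector {F : Type*} [Field F] {m : ℕ} (D : ℕ)
    (Q : LinDiffPoly F m) : List F :=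
  _root_.coeffVector D Q.free ++ (List.ofFn Q.coeff).flatMap (_root_.coeffVector D)

/-! ### Deterministic algorithms over a field, with field operations counted

The machine has a memory holding field elements, which can only be appended to, and which starts
with the input. Its control is an ordinary (Turing-)computable device that does not know the field
and learns about the field elements only through zero tests. -/

/-- The arithmetic operations of a field. -/
inductive FieldOp
  | add
  | sub
  | mul
  | div

/-- The value of an arithmetic operation (division by `0` is excluded in `FieldAlgorithm.Runs`). -/
def FieldOp.eval {F : Type*} [Field F] : FieldOp → F → F → F
  | .add, x, y => x + y
  | .sub, x, y => x - y
  | .mul, x, y => x * y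
  | .div, x, y => x / y

/-- The instructions. Natural numbers `i`, `j` are positions in the memory. -/
inductive FieldInstr
  /-- append the constant `1` (for `true`) or `0` (for `false`) to the memory -/
  | const (b : Bool)
  /-- append the result of an arithmetic operation on the entries `i` and `j` -/
  | arith (op : FieldOp) (i j : ℕ)
  /-- test whether entry `i` is zero -/
  | isZero (i : ℕ)
  /-- halt, and output the vectors whose entries stand at the given positions -/
  | output (o : List (List ℕ))

/-- Numbering of the arithmetic operations. -/
def FieldOp.equivFin : FieldOp ≃ Fin 4 where
  toFun
    | .add => 0
    | .sub => 1
    | .mul => 2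
    | .div => 3
  invFun
    | 0 => .add
    | 1 => .sub
    | 2 => .mul
    | 3 => .div
  left_inv op := by cases op <;> rfl
  right_inv i := by fin_cases i <;> rfl

/-- Instructions as finite data. -/
def FieldInstr.equivSum : FieldInstr ≃ Bool ⊕ (Fin 4 × ℕ × ℕ) ⊕ ℕ ⊕ List (List ℕ) where
  toFun
    | .const b => .inl b
    | .arith op i j => .inr (.inl (op.equivFin, i, j))
    | .isZero i => .inr (.inr (.inl i))
    | .output o => .inr (.inr (.inr o))
  invFun
    | .inl b => .const b
    | .inr (.inl (k, i, j)) => .arith (FieldOp.equivFin.symm k) i j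
    | .inr (.inr (.inl i)) => .isZero i
    | .inr (.inr (.inr o)) => .output o
  left_inv c := by cases c <;> simp
  right_inv c := by rcases c with b | ⟨k, i, j⟩ | i | o <;> simp

instance : Primcodable FieldInstr := Primcodable.ofEquiv _ FieldInstr.equivSum

/-- A deterministic algorithm over an arbitrary field, for inputs with three integer parameters.
The control state is initialised from the parameters; it determines the next instruction; after
the instruction it is updated, depending on the outcome if the instruction was a zero test. All
of this is computable. The algorithm does not depend on the field. -/
structure FieldAlgorithm where
  State : Type
  [primcodable : Primcodable State]
  init : ℕ × ℕ × ℕ → State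
  instr : State → FieldInstr
  next : State → Bool → State
  computable_init : Computable init
  computable_instr : Computable instr
  computable_next : Computable₂ next

/-- `A.Runs s M n out`: started in control state `s` with memory `M`, the algorithm `A` performs
exactly `n` operations (loading of a constant, arithmetic operation, zero test) and then halts
with output `out`. A run that divides by zero or uses a position outside the memory has no
continuation. The bit handed to `next` is `true` after a zero test that found a zero and `false`
in all other cases. -/
inductive FieldAlgorithm.Runs {F : Type*} [Field F] (A : FieldAlgorithm) :
    A.State → List F → ℕ → List (List F) → Prop
  | output {s : A.State} {M : List F} {o : List (List ℕ)} {out : List (List F)}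
      (hs : A.instr s = .output o)
      (ho : List.Forall₂ (List.Forall₂ fun i x => M[i]? = some x) o out) :
      A.Runs s M 0 out
  | const {s : A.State} {M : List F} {b : Bool} {n : ℕ} {out : List (List F)}
      (hs : A.instr s = .const b)
      (h : A.Runs (A.next s false) (M ++ [if b then 1 else 0]) n out) :
      A.Runs s M (n + 1) out
  | arith {s : A.State} {M : List F} {op : FieldOp} {i j : ℕ} {x y : F} {n : ℕ}
      {out : List (List F)}
      (hs : A.instr s = .arith op i j) (hi : M[i]? = some x) (hj : M[j]? = some y)
      (hdiv : op = .div → y ≠ 0)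
      (h : A.Runs (A.next s false) (M ++ [op.eval x y]) n out) :
      A.Runs s M (n + 1) out
  | zero {s : A.State} {M : List F} {i : ℕ} {n : ℕ} {out : List (List F)}
      (hs : A.instr s = .isZero i) (hi : M[i]? = some 0)
      (h : A.Runs (A.next s true) M n out) :
      A.Runs s M (n + 1) out
  | nonzero {s : A.State} {M : List F} {i : ℕ} {x : F} {n : ℕ} {out : List (List F)}
      (hs : A.instr s = .isZero i) (hi : M[i]? = some x) (hx : x ≠ 0)
      (h : A.Runs (A.next s false) M n out) :
      A.Runs s M (n + 1) out

/-! Write `L f = ∑ Qᵢ f⁽ⁱ⁾` and let `s` be the least value of `a - i` over all nonzero coefficients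
of `x ^ a` in `Qᵢ` (in natural numbers, `σ = s + m`). Then `L` maps `x ^ j` to `χ(j) x ^ (j + s)`
plus higher terms, where `χ(k) = ∑ q_{i, i+s} k (k-1) ⋯ (k-i+1)` is the indicial polynomial. Falling
factorials are monic of distinct degrees, so `χ` is nonzero of degree at most `m`. As `d!` is
invertible, `0, …, d` are distinct in the field, and the set `Z` of zeros of `χ` among them has at
most `m` elements (`card_le_of_sum_descFactorial_eq_zero`). The equations are triangular with
diagonal `χ(k)`, so a homogeneous solution vanishing on `Z` is zero (`eq_zero_of_triangular`); this
bounds the dimension. If all `Qᵢ` vanish, then `Q̃ ≠ 0` and there is no solution.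

For the algorithm, the rows outside `Z` are solved by forward substitution with prescribed
coefficients on `Z`. This gives a point and at most `m` directions whose affine span contains all
solutions (`isParam_of_triangular`). The matrix is a sum of `m + 1` Toeplitz matrices times diagonal
ones, so divide and conquer with fast convolution makes each substitution quasilinear
(`computes_forwardSubst_block`). All rows are then evaluated on these vectors, and elimination in at
most `m` parameters finishes (`solves_of_isParam`). Convolutions use Fourier transforms over rings
with a root of `-1`, which needs `2 ≠ 0`; if `2 = 0` then `d ≤ 1` and the naive method is as good.
All this is carried out for all inputs over all fields at once, in a product of fields, and yields a
decision tree of bounded depth (`solves_system`).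

A computable control comes from the tree by search. Correctness of a finite program reduces to
finitely many polynomial systems having no solution in any field. By the weak Nullstellensatz over
`ℤ` (a proper ideal lies in a maximal one, whose quotient is a field), each such system has a
certificate writing `1` as a combination of its equations (`UnitCert.exists_valid`). Checking
certificates is primitive recursive. Hence the control may run through all certified programs until
one fits the operation bound, at the cost of no field operation, and then execute it; the tree shows
that the search ends (`exists_correct`), and the certificates show that the program found is right
in every field (`exists_runs`). -/

/-! ### Straight-line computations with elements of a product of fields -/

section StraightLine

variable {Ω : Type*} {F : Ω → Type*} [∀ ω, Field (F ω)]

/-- `z` is the result of one field operation on elements of `K`, which is legal on `P`. -/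
inductive IsFieldOp (P : Set Ω) (K : Set (∀ ω, F ω)) : (∀ ω, F ω) → Prop
  | const (b : Bool) : IsFieldOp P K (fun _ => if b then 1 else 0)
  | arith (op : FieldOp) {x y : ∀ ω, F ω} (hx : x ∈ K) (hy : y ∈ K)
      (hdiv : op = .div → ∀ ω ∈ P, y ω ≠ 0) : IsFieldOp P K (fun ω => op.eval (x ω) (y ω))

/-- All elements of `A` can be computed from elements of `K` with at most `n` field operations,
which are legal on `P`. -/
inductive Computes (P : Set Ω) : Set (∀ ω, F ω) → ℕ → Set (∀ ω, F ω) → Prop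
  | done {K A : Set (∀ ω, F ω)} {n : ℕ} (h : A ⊆ K) : Computes P K n A
  | step {K A : Set (∀ ω, F ω)} {n : ℕ} {z : ∀ ω, F ω} (hz : IsFieldOp P K z)
      (h : Computes P (insert z K) n A) : Computes P K (n + 1) A

/-- The first `N` entries of a sequence. -/
def firstEntries {E : Type*} (N : ℕ) (c : ℕ → E) : Set E := {x | ∃ i < N, c i = x}

theorem firstEntries_subset {E : Type*} {N : ℕ} {c : ℕ → E} {K : Set E} :
    firstEntries N c ⊆ K ↔ ∀ i < N, c i ∈ K := by
  constructor
  · intro h i hi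
    exact h ⟨i, hi, rfl⟩
  · rintro h x ⟨i, hi, rfl⟩
    exact h i hi

variable {P : Set Ω} {K K' A B : Set (∀ ω, F ω)} {n k : ℕ}

theorem IsFieldOp.mono {z : ∀ ω, F ω} (h : IsFieldOp P K z) (hK : K ⊆ K') : IsFieldOp P K' z := by
  cases h with
  | const b => exact .const b
  | arith op hx hy hdiv => exact .arith op (hK hx) (hK hy) hdiv

namespace Computes

theorem mono_known (h : Computes P K n A) (hK : K ⊆ K') : Computes P K' n A := by
  induction h generalizing K' with
  | done h => exact .done (h.trans hK)
  | step hz _ ih => exact .step (hz.mono hK) (ih (Set.insert_subset_insert hK))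

theorem mono_cost (h : Computes P K n A) (hn : n ≤ k) : Computes P K k A := by
  induction h generalizing k with
  | done h => exact .done h
  | step hz _ ih =>
    obtain ⟨k, rfl⟩ : ∃ k', k = k' + 1 := ⟨k - 1, by omega⟩
    exact .step hz (ih (by omega))

theorem anti (h : Computes P K n A) (hB : B ⊆ A) : Computes P K n B := by
  induction h with
  | done h => exact .done (hB.trans h)
  | step hz _ ih => exact .step hz (ih hB)

theorem union_known (h : Computes P K n A) : Computes P K n (A ∪ K) := by
  induction h with
  | done h => exact .done (by simpa using h)
  | step hz _ ih =>
    exact .step hz (ih.anti (Set.union_subset_union_right _ (Set.subset_insert _ _)))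

theorem trans (h : Computes P K n A) (h' : Computes P (K ∪ A) k B) :
    Computes P K (n + k) (A ∪ B) := by
  induction h with
  | done h =>
    rw [Set.union_eq_self_of_subset_right h] at h'
    exact (h'.union_known.anti (Set.union_subset (h.trans Set.subset_union_right)
      Set.subset_union_left)).mono_cost (Nat.le_add_left _ _)
  | @step K A n z hz _ ih =>
    have := ih (h'.mono_known (Set.union_subset_union_left _ (Set.subset_insert _ _)))
    rw [Nat.add_right_comm]
    exact .step hz this

theorem trans' (h : Computes P K n A) (h' : Computes P (K ∪ A) k B) :
    Computes P K (n + k) B := (h.trans h').anti Set.subset_union_right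

theorem union (h : Computes P K n A) (h' : Computes P K k B) : Computes P K (n + k) (A ∪ B) :=
  h.trans (h'.mono_known Set.subset_union_left)

theorem biUnion {ι : Type*} (s : Finset ι) (A : ι → Set (∀ ω, F ω)) (n : ι → ℕ)
    (h : ∀ i ∈ s, Computes P K (n i) (A i)) : Computes P K (∑ i ∈ s, n i) (⋃ i ∈ s, A i) := by
  classical
  induction s using Finset.induction_on with
  | empty => exact .done (by simp)
  | insert i s hi ih =>
    rw [Finset.sum_insert hi, Finset.set_biUnion_insert]
    exact (h i (by simp)).union (ih fun j hj => h j (by simp [hj]))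

theorem iUnion_lt (N : ℕ) (A : ℕ → Set (∀ ω, F ω)) (h : ∀ i < N, Computes P K n (A i)) :
    Computes P K (N * n) {x | ∃ i < N, x ∈ A i} := by
  have := biUnion (P := P) (K := K) (Finset.range N) A (fun _ => n)
    (fun i hi => h i (Finset.mem_range.1 hi))
  simp only [Finset.sum_const, Finset.card_range, smul_eq_mul] at this
  refine this.anti ?_
  rintro x ⟨i, hi, hx⟩
  simp only [Set.mem_iUnion, Finset.mem_range]
  exact ⟨i, hi, hx⟩

theorem entries (N : ℕ) (c : ℕ → ∀ ω, F ω) (h : ∀ i < N, Computes P K n {c i}) :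
    Computes P K (N * n) (firstEntries N c) :=
  (iUnion_lt N (fun i => {c i}) h).anti (by rintro x ⟨i, hi, rfl⟩; exact ⟨i, hi, rfl⟩)

theorem of_mem {x : ∀ ω, F ω} (hx : x ∈ K) : Computes P K n {x} := .done (by simpa using hx)

theorem arith (op : FieldOp) {x y : ∀ ω, F ω} (hx : x ∈ K) (hy : y ∈ K)
    (hdiv : op = .div → ∀ ω ∈ P, y ω ≠ 0) :
    Computes P K 1 {fun ω => op.eval (x ω) (y ω)} :=
  .step (.arith op hx hy hdiv) (.done (by simp))

theorem zero : Computes P K 1 {(0 : ∀ ω, F ω)} := .step (.const false) (.done (by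
  simp only [Set.singleton_subset_iff]; left; rfl))

theorem one : Computes P K 1 {(1 : ∀ ω, F ω)} := .step (.const true) (.done (by
  simp only [Set.singleton_subset_iff]; left; rfl))

theorem add {x y : ∀ ω, F ω} (hx : x ∈ K) (hy : y ∈ K) : Computes P K 1 {x + y} :=
  arith .add hx hy (by simp)

theorem sub {x y : ∀ ω, F ω} (hx : x ∈ K) (hy : y ∈ K) : Computes P K 1 {x - y} :=
  arith .sub hx hy (by simp)

theorem mul {x y : ∀ ω, F ω} (hx : x ∈ K) (hy : y ∈ K) : Computes P K 1 {x * y} :=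
  arith .mul hx hy (by simp)

theorem div {x y : ∀ ω, F ω} (hx : x ∈ K) (hy : y ∈ K) (h : ∀ ω ∈ P, y ω ≠ 0) :
    Computes P K 1 {x / y} :=
  arith .div hx hy (fun _ => h)

theorem neg {x : ∀ ω, F ω} (h0 : (0 : ∀ ω, F ω) ∈ K) (hx : x ∈ K) : Computes P K 1 {-x} := by
  simpa using sub (P := P) h0 hx

/-- `x` can be computed after `y`. -/
theorem bind {y z : ∀ ω, F ω} (h : Computes P K n {y}) (h' : Computes P (insert y K) k {z}) :
    Computes P K (n + k) {z} :=
  h.trans' (h'.mono_known (by simp))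

theorem bind₂ {x y z : ∀ ω, F ω} {n' : ℕ} (h : Computes P K n {x}) (h' : Computes P K n' {y})
    (h'' : Computes P (insert x (insert y K)) k {z}) :
    Computes P K (n + n' + k) {z} :=
  (h.union h').trans' (h''.mono_known (by
    simp only [Set.insert_subset_iff, Set.mem_union, Set.mem_singleton_iff, true_or, or_true,
      true_and, Set.subset_union_left]))

theorem sum {ι : Type*} (s : Finset ι) (f : ι → ∀ ω, F ω) (h0 : (0 : ∀ ω, F ω) ∈ K)
    (h : ∀ i ∈ s, Computes P K n {f i}) : Computes P K (s.card * (n + 1)) {∑ i ∈ s, f i} := by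
  classical
  induction s using Finset.induction_on with
  | empty => exact .done (by simpa using h0)
  | insert i s hi ih =>
    rw [Finset.sum_insert hi, Finset.card_insert_of_notMem hi]
    refine (bind₂ (h i (by simp)) (ih fun j hj => h j (by simp [hj]))
      (add (Set.mem_insert _ _) (Set.mem_insert_of_mem _ (Set.mem_insert _ _)))).mono_cost ?_
    ring_nf
    omega

end Computes

end StraightLine

/-! ### Fast multiplication -/

section Radix

variable {R : Type*} [CommRing R]

/-- The polynomial with the coefficients `u 0, …, u (n - 1)`. -/
noncomputable def polyOfSeq (u : ℕ → R) (n : ℕ) : R[X] := ∑ i ∈ Finset.range n, C (u i) * X ^ i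

theorem polyOfSeq_add_length (u : ℕ → R) (m n : ℕ) :
    polyOfSeq u (m + n) = polyOfSeq u m + X ^ m * polyOfSeq (fun i => u (m + i)) n := by
  simp only [polyOfSeq, Finset.sum_range_add, Finset.mul_sum]
  congr 1
  exact Finset.sum_congr rfl fun i _ => by ring

theorem polyOfSeq_add_mul (u v : ℕ → R) (c : R) (n : ℕ) :
    polyOfSeq (fun i => u i + c * v i) n = polyOfSeq u n + C c * polyOfSeq v n := by
  simp only [polyOfSeq, Finset.mul_sum, ← Finset.sum_add_distrib]
  exact Finset.sum_congr rfl fun i _ => by simp; ring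

theorem polyOfSeq_congr {u v : ℕ → R} {n : ℕ} (h : ∀ i < n, u i = v i) :
    polyOfSeq u n = polyOfSeq v n :=
  Finset.sum_congr rfl fun i hi => by rw [h i (Finset.mem_range.1 hi)]

theorem coeff_polyOfSeq (u : ℕ → R) (n i : ℕ) :
    (polyOfSeq u n).coeff i = if i < n then u i else 0 := by
  simp [polyOfSeq, Polynomial.coeff_C_mul, Polynomial.coeff_X_pow]

theorem degree_polyOfSeq_lt (u : ℕ → R) (n : ℕ) : (polyOfSeq u n).degree < n := by
  rw [Polynomial.degree_lt_iff_coeff_zero]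
  intro i hi
  simp [coeff_polyOfSeq, hi]

/-- A product modulo `X ^ (2 h) - c ^ 2` from the products modulo `X ^ h - c` and
`X ^ h + c`. -/
theorem dvd_mul_sub_of_dvd_of_dvd {h : ℕ} {c c' half : R} (hc : c * c' = 1)
    (hhalf : 2 * half = 1) {u v p q g : ℕ → R}
    (hp : X ^ h - C c ∣ polyOfSeq (fun i => u i + c * u (h + i)) h *
      polyOfSeq (fun i => v i + c * v (h + i)) h - polyOfSeq p h)
    (hq : X ^ h + C c ∣ polyOfSeq (fun i => u i - c * u (h + i)) h *
      polyOfSeq (fun i => v i - c * v (h + i)) h - polyOfSeq q h)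
    (hg : ∀ i < h, g i = half * (p i + q i))
    (hg' : ∀ i < h, g (h + i) = half * (c' * (p i - q i))) :
    X ^ (h + h) - C (c ^ 2) ∣ polyOfSeq u (h + h) * polyOfSeq v (h + h) - polyOfSeq g (h + h) := by
  have hC : (C c : R[X]) * C c' = 1 := by rw [← C_mul, hc, C_1]
  have hH : (2 : R[X]) * C half = 1 := by
    rw [← C_1, ← hhalf, C_mul]; rfl
  have e1 : polyOfSeq g h = C half * polyOfSeq p h + C half * polyOfSeq q h := by
    rw [← mul_add, ← one_mul (polyOfSeq q h), ← C_1, ← polyOfSeq_add_mul]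
    simp only [polyOfSeq, Finset.mul_sum]
    refine Finset.sum_congr rfl fun i hi => ?_
    rw [hg i (Finset.mem_range.1 hi)]; simp; ring
  have e2 : polyOfSeq (fun i => g (h + i)) h =
      C half * C c' * polyOfSeq p h - C half * C c' * polyOfSeq q h := by
    rw [← mul_sub, sub_eq_add_neg, neg_eq_neg_one_mul, ← C_1, ← C_neg, ← polyOfSeq_add_mul]
    simp only [polyOfSeq, Finset.mul_sum]
    refine Finset.sum_congr rfl fun i hi => ?_
    rw [hg' i (Finset.mem_range.1 hi)]; simp; ring
  have e3 : (fun i => u i - c * u (h + i)) = fun i => u i + (-c) * u (h + i) := by ext; ring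
  have e4 : (fun i => v i - c * v (h + i)) = fun i => v i + (-c) * v (h + i) := by ext; ring
  rw [polyOfSeq_add_mul, polyOfSeq_add_mul] at hp
  rw [e3, e4, polyOfSeq_add_mul, polyOfSeq_add_mul, C_neg] at hq
  rw [polyOfSeq_add_length, polyOfSeq_add_length v, polyOfSeq_add_length g, e1, e2]
  have hfac : (X : R[X]) ^ (h + h) - C (c ^ 2) = (X ^ h - C c) * (X ^ h + C c) := by
    rw [C_pow]; ring
  rw [hfac]
  generalize polyOfSeq p h = p at *
  generalize polyOfSeq q h = q at *
  generalize polyOfSeq u h = u₀ at *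
  generalize polyOfSeq v h = v₀ at *
  generalize polyOfSeq (fun i => u (h + i)) h = u₁ at *
  generalize polyOfSeq (fun i => v (h + i)) h = v₁ at *
  generalize (X : R[X]) ^ h = x at *
  -- Bézout relation: the two factors differ by `2 c`, whose inverse is `half * c'`.
  refine IsCoprime.mul_dvd ⟨-(C c' * C half), C c' * C half, ?_⟩ ?_ ?_
  · linear_combination 2 * C half * hC + hH
  · obtain ⟨w, hw⟩ := hp
    refine ⟨w + u₁ * (v₀ + x * v₁) + (u₀ + C c * u₁) * v₁
      - C half * C c' * (p - q), ?_⟩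
    linear_combination hw - C half * (p - q) * hC + (-p) * hH
  · obtain ⟨w, hw⟩ := hq
    refine ⟨w + u₁ * (v₀ + x * v₁) + (u₀ - C c * u₁) * v₁
      - C half * C c' * (p - q), ?_⟩
    linear_combination hw + C half * (p - q) * hC + (-q) * hH

end Radix

/-! ### Multiplication by powers of a root of `-1`. -/

section Negacyclic

variable {E R : Type*} [CommRing E] [CommRing R] [Algebra E R]

/-- The element of `R` with coordinates `c 0, …, c (N - 1)` with respect to the powers of `y`. -/
noncomputable def ofCoords (y : R) (N : ℕ) (c : ℕ → E) : R :=
  ∑ l ∈ Finset.range N, algebraMap E R (c l) * y ^ l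

theorem ofCoords_add (y : R) (N : ℕ) (c d : ℕ → E) :
    ofCoords y N (c + d) = ofCoords y N c + ofCoords y N d := by
  simp [ofCoords, add_mul, Finset.sum_add_distrib]

theorem ofCoords_sub (y : R) (N : ℕ) (c d : ℕ → E) :
    ofCoords y N (c - d) = ofCoords y N c - ofCoords y N d := by
  simp [ofCoords, sub_mul, Finset.sum_sub_distrib]

theorem ofCoords_mul_left (y : R) (N : ℕ) (a : E) (c : ℕ → E) :
    ofCoords y N (fun l => a * c l) = algebraMap E R a * ofCoords y N c := by
  simp [ofCoords, Finset.mul_sum, mul_assoc]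

/-- Since `y ^ N = -1`, multiplication by `y` is a cyclic shift of the coordinates with one sign
change, so it needs no multiplication in the field. Coordinates need not be unique in `R`, hence the
existential form. -/
theorem exists_ofCoords_mul_root {y : R} {N : ℕ} (hN : 0 < N) (hy : y ^ N = -1) (c : ℕ → E) :
    ∃ c' : ℕ → E, ofCoords y N c' = y * ofCoords y N c ∧
      ∀ l < N, ∃ l' < N, c' l = c l' ∨ c' l = -c l' := by
  obtain ⟨N, rfl⟩ : ∃ k, N = k + 1 := ⟨N - 1, by omega⟩
  refine ⟨fun l => if l = 0 then -c N else c (l - 1), ?_, ?_⟩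
  · rw [ofCoords, ofCoords, Finset.sum_range_succ', Finset.sum_range_succ, mul_add, Finset.mul_sum]
    congr 1
    · exact Finset.sum_congr rfl fun l _ => by simp [pow_succ]; ring
    · simp only [if_true, map_neg, pow_zero, mul_one]
      linear_combination (-algebraMap E R (c N)) * hy
  · intro l hl
    by_cases h : l = 0
    · exact ⟨N, by omega, Or.inr (by simp [h])⟩
    · exact ⟨l - 1, by omega, Or.inl (by simp [h])⟩

theorem exists_ofCoords_mul_root_pow {y : R} {N : ℕ} (hN : 0 < N) (hy : y ^ N = -1) (e : ℕ)
    (c : ℕ → E) :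
    ∃ c' : ℕ → E, ofCoords y N c' = y ^ e * ofCoords y N c ∧
      ∀ l < N, ∃ l' < N, c' l = c l' ∨ c' l = -c l' := by
  induction e with
  | zero => exact ⟨c, by simp, fun l hl => ⟨l, hl, Or.inl rfl⟩⟩
  | succ e ih =>
    obtain ⟨d, hd, hd'⟩ := ih
    obtain ⟨c', hc, hc'⟩ := exists_ofCoords_mul_root hN hy d
    refine ⟨c', by rw [hc, hd]; ring, fun l hl => ?_⟩
    obtain ⟨l', hl', h'⟩ := hc' l hl
    obtain ⟨l'', hl'', h''⟩ := hd' l' hl'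
    refine ⟨l'', hl'', ?_⟩
    rcases h' with h' | h' <;> rcases h'' with h'' | h'' <;> simp [h', h'']

end Negacyclic

/-! ### Fourier transform with powers of `y` as roots of unity. -/

section FastMul

variable {Ω : Type*} {F : Ω → Type*} [∀ ω, Field (F ω)] {P : Set Ω} {K : Set (∀ ω, F ω)}
variable {R : Type*} [CommRing R] [Algebra (∀ ω, F ω) R]

/-- Coordinates of products in `R` can be computed with `t` operations. -/
def MulCostLE (P : Set Ω) (y : R) (N t : ℕ) : Prop :=
  ∀ (K : Set (∀ ω, F ω)) (a b : ℕ → ∀ ω, F ω), 0 ∈ K → 1 ∈ K → 2 ∈ K →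
    firstEntries N a ⊆ K → firstEntries N b ⊆ K →
      ∃ c : ℕ → ∀ ω, F ω, ofCoords y N c = ofCoords y N a * ofCoords y N b ∧
        Computes P K t (firstEntries N c)

/-- The first `N` entries of each of the first `n` sequences. -/
def firstBlocks {E : Type*} (n N : ℕ) (c : ℕ → ℕ → E) : Set E :=
  {x | ∃ i < n, x ∈ firstEntries N (c i)}

theorem firstBlocks_subset {E : Type*} {n N : ℕ} {c : ℕ → ℕ → E} {K : Set E} :
    firstBlocks n N c ⊆ K ↔ ∀ i < n, firstEntries N (c i) ⊆ K :=
  ⟨fun h i hi _ hx => h ⟨i, hi, hx⟩, fun h _ ⟨i, hi, hx⟩ => h i hi hx⟩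

/-- The forward butterfly. Each coordinate of either output takes one possible sign change and one
addition or subtraction. -/
theorem exists_computes_butterfly {y : R} {N : ℕ} (hN : 0 < N) (hy : y ^ N = -1) (e : ℕ)
    {p q : ℕ → ∀ ω, F ω} (h0 : 0 ∈ K) (hp : firstEntries N p ⊆ K) (hq : firstEntries N q ⊆ K) :
    ∃ s d : ℕ → ∀ ω, F ω, ofCoords y N s = ofCoords y N p + y ^ e * ofCoords y N q ∧
      ofCoords y N d = ofCoords y N p - y ^ e * ofCoords y N q ∧
      Computes P K (4 * N) (firstEntries N s ∪ firstEntries N d) := by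
  obtain ⟨q', hq', hK⟩ := exists_ofCoords_mul_root_pow hN hy e q
  rw [firstEntries_subset] at hp hq
  have hcost : ∀ l < N, Computes P K 1 {q' l} := by
    intro l hl
    obtain ⟨l', hl', h | h⟩ := hK l hl
    · exact .of_mem (h ▸ hq l' hl')
    · rw [h]; exact .neg h0 (hq l' hl')
  refine ⟨p + q', p - q', by rw [ofCoords_add, hq'], by rw [ofCoords_sub, hq'], ?_⟩
  have h1 : Computes P K (N * 2) (firstEntries N (p + q')) := Computes.entries N _ fun l hl =>
    (hcost l hl).bind (.add (Set.mem_insert_of_mem _ (hp l hl)) (Set.mem_insert _ _))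
  have h2 : Computes P K (N * 2) (firstEntries N (p - q')) := Computes.entries N _ fun l hl =>
    (hcost l hl).bind (.sub (Set.mem_insert_of_mem _ (hp l hl)) (Set.mem_insert _ _))
  exact (h1.union h2).mono_cost (by omega)

/-- The inverse butterfly: two operations per coordinate of `s`, three per coordinate of `d`,
halving included. -/
theorem exists_computes_butterfly_symm {y : R} {N : ℕ} (hN : 0 < N) (hy : y ^ N = -1) (e : ℕ)
    (h2 : ∀ ω, (2 : F ω) ≠ 0) {p q : ℕ → ∀ ω, F ω} (h0 : 0 ∈ K) (hK2 : 2 ∈ K)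
    (hp : firstEntries N p ⊆ K) (hq : firstEntries N q ⊆ K) :
    ∃ s d : ℕ → ∀ ω, F ω,
      ofCoords y N s = algebraMap (∀ ω, F ω) R 2⁻¹ * (ofCoords y N p + ofCoords y N q) ∧
      ofCoords y N d =
        algebraMap (∀ ω, F ω) R 2⁻¹ * (y ^ e * (ofCoords y N p - ofCoords y N q)) ∧
      Computes P K (5 * N) (firstEntries N s ∪ firstEntries N d) := by
  obtain ⟨q', hq', hK⟩ := exists_ofCoords_mul_root_pow hN hy e (p - q)
  rw [firstEntries_subset] at hp hq
  refine ⟨fun l => 2⁻¹ * (p + q) l, fun l => 2⁻¹ * q' l, by rw [ofCoords_mul_left, ofCoords_add],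
    by rw [ofCoords_mul_left, hq', ofCoords_sub], ?_⟩
  have hdiv (x : ∀ ω, F ω) {K : Set (∀ ω, F ω)} (hx : x ∈ K) (hK2 : 2 ∈ K) :
      Computes P K 1 {2⁻¹ * x} := by
    rw [mul_comm, ← div_eq_mul_inv]
    exact .div hx hK2 fun ω _ => h2 ω
  have hs : Computes P K (N * 2) (firstEntries N fun l => 2⁻¹ * (p + q) l) :=
    Computes.entries N _ fun l hl => (Computes.add (hp l hl) (hq l hl)).bind
      (hdiv _ (Set.mem_insert _ _) (Set.mem_insert_of_mem _ hK2))
  have hd : Computes P K (N * (1 + 1 + 1)) (firstEntries N fun l => 2⁻¹ * q' l) := by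
    refine Computes.entries N _ fun l hl => ?_
    obtain ⟨l', hl', h⟩ := hK l hl
    refine ((Computes.sub (hp l' hl') (hq l' hl')).bind (z := q' l) ?_).bind
      (hdiv _ (Set.mem_insert _ _) (Set.mem_insert_of_mem _ hK2))
    rcases h with h | h
    · exact .of_mem (h ▸ Set.mem_insert _ _)
    · rw [h]; exact .neg (Set.mem_insert_of_mem _ h0) (Set.mem_insert _ _)
  exact (hs.union hd).mono_cost (by omega)

/-- Recursive transform: `X ^ (2 h) - y ^ (2 e)` splits into `X ^ h - y ^ e` and `X ^ h + y ^ e`.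
The divisibility `2 ^ j ∣ e` allows `j` successive square roots; `2 ^ j ∣ 2 * N` preserves it when a
sign is absorbed into the exponent. -/
theorem exists_computes_mul_mod {y : R} {N t : ℕ} (hN : 0 < N) (hy : y ^ N = -1)
    (h2 : ∀ ω, (2 : F ω) ≠ 0) (ht : MulCostLE (F := F) P y N t) (j : ℕ) :
    ∀ (e : ℕ) (K : Set (∀ ω, F ω)) (a b : ℕ → ℕ → ∀ ω, F ω), 2 ^ j ∣ e → 2 ^ j ∣ 2 * N →
      0 ∈ K → 1 ∈ K → 2 ∈ K → firstBlocks (2 ^ j) N a ⊆ K → firstBlocks (2 ^ j) N b ⊆ K →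
      ∃ c : ℕ → ℕ → ∀ ω, F ω,
        X ^ 2 ^ j - C (y ^ e) ∣ polyOfSeq (fun i => ofCoords y N (a i)) (2 ^ j) *
          polyOfSeq (fun i => ofCoords y N (b i)) (2 ^ j) -
          polyOfSeq (fun i => ofCoords y N (c i)) (2 ^ j) ∧
        Computes P K (2 ^ j * (t + 7 * j * N)) (firstBlocks (2 ^ j) N c) := by
  induction j with
  | zero =>
    intro e K a b _ _ h0 h1 hK2 ha hb
    rw [firstBlocks_subset] at ha hb
    obtain ⟨c, hc, hcost⟩ := ht K (a 0) (b 0) h0 h1 hK2 (ha 0 (by simp)) (hb 0 (by simp))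
    refine ⟨fun _ => c, by simp [polyOfSeq, hc], (hcost.mono_cost ?_).anti ?_⟩
    · rw [pow_zero, mul_zero, zero_mul, add_zero, one_mul]
    · rw [firstBlocks_subset]
      exact fun i _ => subset_rfl
  | succ j ih =>
    intro e K a b he hjN h0 h1 hK2 ha hb
    obtain ⟨e, rfl⟩ : ∃ e', e = e' * 2 := by
      obtain ⟨w, rfl⟩ := he
      exact ⟨2 ^ j * w, by ring⟩
    have he' : 2 ^ j ∣ e := by
      rw [pow_succ] at he
      exact Nat.dvd_of_mul_dvd_mul_right two_pos he
    have hjN' : 2 ^ j ∣ N := by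
      rw [pow_succ, mul_comm 2 N] at hjN
      exact Nat.dvd_of_mul_dvd_mul_right two_pos hjN
    set h := 2 ^ j with hh
    have hpow : 2 ^ (j + 1) = h + h := by rw [hh]; ring
    rw [hpow, firstBlocks_subset] at ha hb
    rw [hpow]
    -- As `y ^ (2 * N) = 1`, the inverse of `y ^ e` is again a power of `y` with natural exponent.
    have hyc : y ^ e * y ^ ((2 * N - 1) * e) = 1 := by
      rw [← pow_add]
      have : e + (2 * N - 1) * e = N * (2 * e) := by
        obtain ⟨N, rfl⟩ : ∃ k, N = k + 1 := ⟨N - 1, by omega⟩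
        have : 2 * (N + 1) - 1 = 2 * N + 1 := by omega
        rw [this]; ring
      rw [this, pow_mul, hy, pow_mul]; simp
    have hhalf : (2 : R) * algebraMap (∀ ω, F ω) R 2⁻¹ = 1 := by
      have : (2 : R) = algebraMap (∀ ω, F ω) R 2 := (map_ofNat (algebraMap (∀ ω, F ω) R) 2).symm
      rw [this, ← map_mul]
      have : (2 : ∀ ω, F ω) * 2⁻¹ = 1 := by
        ext ω
        exact mul_inv_cancel₀ (h2 ω)
      rw [this, map_one]
    have hA (i : ℕ) (hi : i < h) := exists_computes_butterfly (P := P) hN hy e h0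
      (ha i (by omega)) (ha (h + i) (by omega))
    have hB (i : ℕ) (hi : i < h) := exists_computes_butterfly (P := P) hN hy e h0
      (hb i (by omega)) (hb (h + i) (by omega))
    choose! ap am hap ham hacost using hA
    choose! bp bm hbp hbm hbcost using hB
    have hcost1 := (Computes.iUnion_lt h _ hacost).union (Computes.iUnion_lt h _ hbcost)
    set K' := K ∪ ({x | ∃ i < h, x ∈ firstEntries N (ap i) ∪ firstEntries N (am i)} ∪
      {x | ∃ i < h, x ∈ firstEntries N (bp i) ∪ firstEntries N (bm i)}) with hK'
    obtain ⟨p, hp, hpcost⟩ := ih e K' ap bp he' (hjN'.mul_left 2) (Or.inl h0) (Or.inl h1)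
      (Or.inl hK2)
      (firstBlocks_subset.2 fun i hi x hx => Or.inr (Or.inl ⟨i, hi, Or.inl hx⟩))
      (firstBlocks_subset.2 fun i hi x hx => Or.inr (Or.inr ⟨i, hi, Or.inl hx⟩))
    -- `-y ^ e = y ^ (e + N)` brings the factor `X ^ h + y ^ e` into the form required by the
    -- induction hypothesis.
    obtain ⟨q, hq, hqcost⟩ := ih (e + N) K' am bm (he'.add hjN') (hjN'.mul_left 2) (Or.inl h0)
      (Or.inl h1) (Or.inl hK2)
      (firstBlocks_subset.2 fun i hi x hx => Or.inr (Or.inl ⟨i, hi, Or.inr hx⟩))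
      (firstBlocks_subset.2 fun i hi x hx => Or.inr (Or.inr ⟨i, hi, Or.inr hx⟩))
    have hcost2 := hcost1.trans' (hpcost.union hqcost)
    have hG (i : ℕ) (hi : i < h) := exists_computes_butterfly_symm (P := P)
      (K := K ∪ (firstBlocks h N p ∪ firstBlocks h N q)) hN hy ((2 * N - 1) * e) h2
      (p := p i) (q := q i) (Or.inl h0) (Or.inl hK2)
      (fun x hx => Or.inr (Or.inl ⟨i, hi, hx⟩)) (fun x hx => Or.inr (Or.inr ⟨i, hi, hx⟩))
    choose! s d hs hd hgcost using hG
    refine ⟨fun i => if i < h then s i else d (i - h), ?_, ?_⟩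
    · rw [pow_mul]
      refine dvd_mul_sub_of_dvd_of_dvd (p := fun i => ofCoords y N (p i))
        (q := fun i => ofCoords y N (q i)) hyc hhalf ?_ ?_ ?_ ?_
      · rwa [polyOfSeq_congr hap, polyOfSeq_congr hbp] at hp
      · rw [polyOfSeq_congr ham, polyOfSeq_congr hbm, pow_add, hy] at hq
        simpa using hq
      · intro i hi
        simp only [hi, if_true]
        exact hs i hi
      · intro i hi
        have : ¬ h + i < h := by omega
        simp only [this, if_false, Nat.add_sub_cancel_left]
        exact hd i hi
    · refine ((hcost2.trans' (Computes.iUnion_lt h _ hgcost)).mono_cost ?_).anti ?_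
      -- The forward butterflies on both arguments cost `8 h N` and the inverse ones `5 h N`,
      -- together within `14 h N`.
      · have : (h + h) * (t + 7 * (j + 1) * N) =
          2 * (h * (t + 7 * j * N)) + 14 * (h * N) := by ring
        rw [this]
        have : h * (4 * N) = 4 * (h * N) := by ring
        have : h * (5 * N) = 5 * (h * N) := by ring
        omega
      · rw [firstBlocks_subset]
        intro i hi x hx
        by_cases hih : i < h
        · simp only [hih, if_true] at hx
          exact ⟨i, hih, Or.inl hx⟩
        · simp only [hih, if_false] at hx
          exact ⟨i - h, by omega, Or.inr hx⟩

end FastMul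

/-! ### Recursive multiplication in rings with a root of `-1`, and convolutions. -/

section FastMul

/-- Grouping exponents modulo `M` turns an element into a polynomial of length `M` in `y` whose
coefficients have coordinates with respect to powers of `y ^ M`. -/
theorem ofCoords_mul_length {E R : Type*} [CommRing E] [CommRing R] [Algebra E R] (y : R)
    (M N : ℕ) (c : ℕ → E) :
    ofCoords y (M * N) c = ∑ i ∈ Finset.range M,
      ofCoords (y ^ M) N (fun l => c (i + M * l)) * y ^ i := by
  induction N with
  | zero => simp [ofCoords]
  | succ N ih =>
    rw [ofCoords, Nat.mul_succ, Finset.sum_range_add, ← ofCoords, ih, ← Finset.sum_add_distrib]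
    refine Finset.sum_congr rfl fun i _ => ?_
    rw [ofCoords, ofCoords, Finset.sum_range_succ, add_mul]
    congr 1
    rw [add_comm (M * N) i, pow_add, pow_mul]
    ring

theorem degree_polyOfSeq_mul_lt {R : Type*} [CommRing R] (u v : ℕ → R) (m n : ℕ) :
    (polyOfSeq u m * polyOfSeq v n).degree < (m + n : ℕ) := by
  rw [Polynomial.degree_lt_iff_coeff_zero]
  intro k hk
  rw [coeff_mul]
  refine Finset.sum_eq_zero fun ij hij => ?_
  rw [Finset.HasAntidiagonal.mem_antidiagonal] at hij
  rw [coeff_polyOfSeq, coeff_polyOfSeq]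
  by_cases h : ij.1 < m
  · rw [if_neg (by omega : ¬ ij.2 < n), mul_zero]
  · rw [if_neg h, zero_mul]

variable {Ω : Type*} {F : Ω → Type*} [∀ ω, Field (F ω)] {P : Set Ω}
variable {R : Type*} [CommRing R] [Algebra (∀ ω, F ω) R]

theorem mulCostLE_two {y : R} (hy : y ^ 2 = -1) : MulCostLE (F := F) P y 2 6 := by
  intro K a b h0 h1 hK2 ha hb
  rw [firstEntries_subset] at ha hb
  refine ⟨fun l => if l = 0 then a 0 * b 0 - a 1 * b 1 else a 0 * b 1 + a 1 * b 0, ?_, ?_⟩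
  · simp only [ofCoords, Finset.sum_range_succ, Finset.sum_range_zero]
    simp
    linear_combination (-(algebraMap (∀ ω, F ω) R (a 1) * algebraMap (∀ ω, F ω) R (b 1))) * hy
  · refine Computes.entries (n := 3) 2 _ fun i hi => ?_
    by_cases h : i = 0
    · simp only [h, if_true]
      exact .bind₂ (.mul (ha 0 (by simp)) (hb 0 (by simp))) (.mul (ha 1 (by simp)) (hb 1 (by simp)))
        (.sub (by simp) (by simp))
    · simp only [h, if_false]
      exact .bind₂ (.mul (ha 0 (by simp)) (hb 1 (by simp))) (.mul (ha 1 (by simp)) (hb 0 (by simp)))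
        (.add (by simp) (by simp))

/-- With `M = 2 ^ b` and `N = 2 ^ a`, elements become polynomials of length `M` over coordinates for
`y ^ M`, a root of `-1` of order parameter `N`. The transform has length `2 M` and must satisfy `2 M
∣ 2 N`, which is `b ≤ a`. The `2 M` pointwise products are the smaller instances. -/
theorem MulCostLE.of_pow {y : R} {a b t : ℕ} (hy : y ^ 2 ^ (a + b) = -1)
    (h2 : ∀ ω, (2 : F ω) ≠ 0) (hba : b ≤ a)
    (ht : MulCostLE (F := F) P (y ^ 2 ^ b) (2 ^ a) t) :
    MulCostLE (F := F) P y (2 ^ (a + b))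
      (2 ^ (b + 1) * (t + 7 * (b + 1) * 2 ^ a) + 2 ^ b * (4 * 2 ^ a)) := by
  intro K u v h0 h1 hK2 hu hv
  rw [firstEntries_subset] at hu hv
  set M := 2 ^ b with hM
  set N := 2 ^ a with hN
  have hMN : 2 ^ (a + b) = M * N := by rw [hM, hN]; ring
  have hM0 : 0 < M := by positivity
  have hN0 : 0 < N := by positivity
  have hMM : 2 ^ (b + 1) = M + M := by rw [hM]; ring
  rw [hMN] at hy hu hv ⊢
  have hy' : (y ^ M) ^ N = -1 := by rw [← pow_mul, hy]
  have hlt {i l : ℕ} (hi : i < M) (hl : l < N) : i + M * l < M * N := by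
    calc i + M * l < M * (l + 1) := by rw [Nat.mul_succ]; omega
      _ ≤ M * N := Nat.mul_le_mul_left _ hl
  set U : ℕ → ℕ → ∀ ω, F ω := fun i l => if i < M then u (i + M * l) else 0 with hU
  set V : ℕ → ℕ → ∀ ω, F ω := fun i l => if i < M then v (i + M * l) else 0 with hV
  -- Exponent `0` means working modulo `X ^ (2 M) - 1`. The product of two polynomials of length `M`
  -- has degree below `2 M`, so nothing wraps around.
  obtain ⟨c, hc, hcost⟩ := exists_computes_mul_mod (P := P) hN0 hy' h2 ht (b + 1) 0 K U V
    (by simp) (by rw [hN, mul_comm, ← pow_succ]; exact pow_dvd_pow _ (by omega)) h0 h1 hK2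
    (firstBlocks_subset.2 fun i _ => firstEntries_subset.2 fun l hl => by
      by_cases hiM : i < M
      · simpa [hU, hiM] using hu _ (hlt hiM hl)
      · simpa [hU, hiM] using h0)
    (firstBlocks_subset.2 fun i _ => firstEntries_subset.2 fun l hl => by
      by_cases hiM : i < M
      · simpa [hV, hiM] using hv _ (hlt hiM hl)
      · simpa [hV, hiM] using h0)
  have hpoly (w : ℕ → ∀ ω, F ω) : polyOfSeq (fun i => ofCoords (y ^ M) N
      (fun l => if i < M then w (i + M * l) else 0)) (M + M) =
      polyOfSeq (fun i => ofCoords (y ^ M) N (fun l => w (i + M * l))) M := by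
    rw [polyOfSeq_add_length]
    have : polyOfSeq (fun i => ofCoords (y ^ M) N
        (fun l => if M + i < M then w (M + i + M * l) else 0)) M = 0 := by
      simp [polyOfSeq, ofCoords]
    rw [this, mul_zero, add_zero]
    exact polyOfSeq_congr fun i hi => by simp [hi]
  have heval (w : ℕ → ∀ ω, F ω) : ofCoords y (M * N) w =
      (polyOfSeq (fun i => ofCoords (y ^ M) N (fun l => w (i + M * l))) M).eval y := by
    simp [polyOfSeq, ofCoords_mul_length, Polynomial.eval_finsetSum]
  rw [hMM] at hc hcost
  rw [hpoly, hpoly, pow_zero] at hc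
  have hmul : polyOfSeq (fun i => ofCoords (y ^ M) N (fun l => u (i + M * l))) M *
      polyOfSeq (fun i => ofCoords (y ^ M) N (fun l => v (i + M * l))) M =
      polyOfSeq (fun i => ofCoords (y ^ M) N (c i)) (M + M) := by
    nontriviality R[X]
    have : Nontrivial R := Polynomial.nontrivial_iff.1 inferInstance
    by_contra hne
    refine (monic_X_pow_sub_C (1 : R) (by omega : M + M ≠ 0)).not_dvd_of_degree_lt
      (sub_ne_zero.2 hne) ?_ hc
    rw [degree_X_pow_sub_C (by omega)]
    refine (degree_sub_le _ _).trans_lt (max_lt ?_ (degree_polyOfSeq_lt _ _))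
    exact degree_polyOfSeq_mul_lt _ _ _ _
  -- Evaluation at `X = y` replaces `X ^ M` by `y ^ M`, so the upper half is multiplied by the root
  -- once and added to the lower half.
  have hB (i : ℕ) (hi : i < M) := exists_computes_butterfly (P := P)
    (K := K ∪ firstBlocks (M + M) N c) hN0 hy' 1 (p := c i) (q := c (M + i)) (Or.inl h0)
    (fun x hx => Or.inr ⟨i, by omega, hx⟩) (fun x hx => Or.inr ⟨M + i, by omega, hx⟩)
  choose! s d hs _ hscost using hB
  refine ⟨fun m => s (m % M) (m / M), ?_, ?_⟩
  · rw [heval u, heval v, ← eval_mul, hmul, heval, polyOfSeq_add_length]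
    simp only [polyOfSeq, Polynomial.eval_finsetSum, eval_add, eval_mul, eval_pow, eval_C,
      eval_X, Finset.mul_sum, ← Finset.sum_add_distrib]
    refine Finset.sum_congr rfl fun i hi => ?_
    have hi' := Finset.mem_range.1 hi
    have hsi : (fun l => s ((i + M * l) % M) ((i + M * l) / M)) = s i := by
      ext1 l
      rw [Nat.add_mul_mod_self_left, Nat.mod_eq_of_lt hi', Nat.add_mul_div_left _ _ hM0,
        Nat.div_eq_of_lt hi', zero_add]
    rw [hsi, hs i hi']
    ring
  · rw [hMM]
    refine (hcost.trans' (Computes.iUnion_lt M _ hscost)).anti ?_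
    rintro x ⟨m, hm, rfl⟩
    exact ⟨m % M, Nat.mod_lt _ hM0, Or.inl ⟨m / M, Nat.div_lt_of_lt_mul hm, rfl⟩⟩

theorem MulCostLE.mono {y : R} {N t t' : ℕ} (h : MulCostLE (F := F) P y N t) (ht : t ≤ t') :
    MulCostLE (F := F) P y N t' := by
  intro K a b h0 h1 h2 ha hb
  obtain ⟨c, hc, hcost⟩ := h K a b h0 h1 h2 ha hb
  exact ⟨c, hc, hcost.mono_cost ht⟩

/-- Halving `k` at each stage gives, per coordinate, `τ(k) = 2 τ(⌈k / 2⌉) + O(k)`. A bound of order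
`k ^ 2` leaves ample room for the linear term and for odd `k`. -/
theorem mulCostLE_pow (h2 : ∀ ω, (2 : F ω) ≠ 0) (k : ℕ) :
    ∀ y : R, 0 < k → y ^ 2 ^ k = -1 → MulCostLE (F := F) P y (2 ^ k) (100 * 2 ^ k * k ^ 2) := by
  induction k using Nat.strong_induction_on with
  | _ k ih =>
    intro y hk hy
    obtain rfl | hk1 : k = 1 ∨ 1 < k := by omega
    · exact (mulCostLE_two (by simpa using hy)).mono (by norm_num)
    obtain ⟨a, b, rfl, hba, hab, hb⟩ : ∃ a b, k = a + b ∧ b ≤ a ∧ a ≤ b + 1 ∧ 0 < b :=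
      ⟨k - k / 2, k / 2, by omega, by omega, by omega, by omega⟩
    have hy' : (y ^ 2 ^ b) ^ 2 ^ a = -1 := by rw [← pow_mul, ← pow_add, add_comm, hy]
    refine (MulCostLE.of_pow hy h2 hba (ih a (by omega) _ (by omega) hy')).mono ?_
    have e1 : 2 ^ (b + 1) * (100 * 2 ^ a * a ^ 2 + 7 * (b + 1) * 2 ^ a) + 2 ^ b * (4 * 2 ^ a) =
      2 ^ (a + b) * (200 * a ^ 2 + 14 * (b + 1) + 4) := by ring
    have e2 : 100 * 2 ^ (a + b) * (a + b) ^ 2 = 2 ^ (a + b) * (100 * (a + b) ^ 2) := by ring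
    rw [e1, e2]
    refine Nat.mul_le_mul_left _ ?_
    obtain rfl | rfl : a = b ∨ a = b + 1 := by omega
    · nlinarith
    · nlinarith

/-- The convolution of two sequences. -/
def convolution {E : Type*} [CommRing E] (a b : ℕ → E) (k : ℕ) : E :=
  ∑ j ∈ Finset.range (k + 1), a j * b (k - j)

theorem coeff_polyOfSeq_mul {E : Type*} [CommRing E] (a b : ℕ → E) {n k : ℕ} (hk : k < n) :
    (polyOfSeq a n * polyOfSeq b n).coeff k = convolution a b k := by
  rw [coeff_mul, Finset.Nat.sum_antidiagonal_eq_sum_range_succ_mk, convolution]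
  refine Finset.sum_congr rfl fun j hj => ?_
  have := Finset.mem_range.1 hj
  simp [coeff_polyOfSeq, (by omega : j < n), (by omega : k - j < n)]

/-- Padded with zeros to length `2 n`, the sequences are multiplied modulo `X ^ (2 n) + 1`, where
the product of degree below `2 n` survives unchanged. -/
theorem computes_convolution_of_two_ne_zero {K : Set (∀ ω, F ω)} (h2 : ∀ ω, (2 : F ω) ≠ 0)
    (l : ℕ) {a b : ℕ → ∀ ω, F ω} (h0 : 0 ∈ K) (h1 : 1 ∈ K) (hK2 : 2 ∈ K)
    (ha : firstEntries (2 ^ l) a ⊆ K) (hb : firstEntries (2 ^ l) b ⊆ K) :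
    Computes P K (200 * 2 ^ l * (l + 1) ^ 2) (firstEntries (2 ^ l) (convolution a b)) := by
  set n := 2 ^ l with hn
  have hnn : 2 ^ (l + 1) = n + n := by rw [hn]; ring
  have hn0 : 0 < n := by positivity
  rw [firstEntries_subset] at ha hb
  -- The degree comparison modulo a monic polynomial needs a nontrivial coefficient ring, which the
  -- empty product is not.
  rcases isEmpty_or_nonempty Ω with hΩ | hΩ
  · refine .done (firstEntries_subset.2 fun i _ => ?_)
    rwa [Subsingleton.elim (convolution a b i) 0]
  have : Nontrivial (∀ ω, F ω) :=
    ⟨0, 1, fun h => hΩ.elim fun ω => zero_ne_one (congrFun h ω)⟩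
  let f : (∀ ω, F ω)[X] := X ^ (n + n) - C (-1)
  have hf : f.Monic := monic_X_pow_sub_C _ (by omega)
  have hy : (AdjoinRoot.root f) ^ 2 ^ (l + 1) = -1 := by
    have := AdjoinRoot.mk_self (f := f)
    simp only [f, map_neg, map_one, sub_neg_eq_add] at this
    rw [hnn]
    exact eq_neg_of_add_eq_zero_left this
  have hcoords (w : ℕ → ∀ ω, F ω) (N : ℕ) :
      ofCoords (AdjoinRoot.root f) N w = AdjoinRoot.mk f (polyOfSeq w N) := by
    simp [ofCoords, polyOfSeq, AdjoinRoot.algebraMap_eq]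
  have hext (w : ℕ → ∀ ω, F ω) :
      polyOfSeq (fun i => if i < n then w i else 0) (n + n) = polyOfSeq w n := by
    rw [polyOfSeq_add_length, polyOfSeq_congr (v := w) (by intro i hi; simp [hi])]
    simp [polyOfSeq]
  obtain ⟨c, hc, hcost⟩ := mulCostLE_pow (P := P) h2 (l + 1) _ (by omega) hy K
    (fun i => if i < n then a i else 0) (fun i => if i < n then b i else 0) h0 h1 hK2
    (firstEntries_subset.2 fun i _ => by
      by_cases hi : i < n
      · simpa [hi] using ha i hi
      · simpa [hi] using h0)
    (firstEntries_subset.2 fun i _ => by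
      by_cases hi : i < n
      · simpa [hi] using hb i hi
      · simpa [hi] using h0)
  rw [hcoords, hcoords, hcoords, ← map_mul, hnn, hext, hext, AdjoinRoot.mk_eq_mk] at hc
  have heq : polyOfSeq c (n + n) = polyOfSeq a n * polyOfSeq b n := by
    by_contra hne
    refine hf.not_dvd_of_degree_lt (sub_ne_zero.2 hne) ?_ hc
    rw [degree_X_pow_sub_C (by omega)]
    refine (degree_sub_le _ _).trans_lt (max_lt (degree_polyOfSeq_lt _ _) ?_)
    exact degree_polyOfSeq_mul_lt _ _ _ _
  refine (hcost.mono_cost (by rw [hnn]; exact le_of_eq (by ring))).anti ?_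
  rw [firstEntries_subset]
  intro k hk
  refine ⟨k, by omega, ?_⟩
  rw [← coeff_polyOfSeq_mul a b hk, ← heq, coeff_polyOfSeq, if_pos (by omega)]

/-- Convolution with a sequence of length at most `d + 1`, when `2` is invertible or `d ≤ 1`. -/
theorem computes_convolution {K : Set (∀ ω, F ω)} {d : ℕ} (h2 : 1 < d → ∀ ω, (2 : F ω) ≠ 0)
    (l : ℕ) {a b : ℕ → ∀ ω, F ω} (h0 : 0 ∈ K) (h1 : 1 ∈ K) (hK2 : 2 ∈ K)
    (ha : firstEntries (2 ^ l) a ⊆ K) (hb : firstEntries (2 ^ l) b ⊆ K)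
    (hd : ∀ j, d < j → a j = 0) :
    Computes P K (200 * 2 ^ l * (l + 1) ^ 2) (firstEntries (2 ^ l) (convolution a b)) := by
  by_cases hd1 : 1 < d
  · exact computes_convolution_of_two_ne_zero (h2 hd1) l h0 h1 hK2 ha hb
  rw [firstEntries_subset] at ha hb
  -- For `d ≤ 1` only `a 0` and `a 1` can be nonzero: two products and a sum per entry, valid in
  -- every characteristic.
  refine (Computes.entries (n := 3) _ _ fun k hk => ?_).mono_cost
    (k := 200 * 2 ^ l * (l + 1) ^ 2) ?_
  · cases k with
    | zero =>
      simp only [convolution, Finset.sum_range_succ, Finset.sum_range_zero, zero_add]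
      exact (Computes.mul (ha 0 hk) (hb 0 hk)).mono_cost (by norm_num)
    | succ k =>
      have : convolution a b (k + 1) = a 0 * b (k + 1) + a 1 * b k := by
        rw [convolution, Finset.sum_range_succ', Finset.sum_range_succ', Finset.sum_eq_zero]
        · simp [add_comm]
        · intro j _
          rw [hd _ (by omega), zero_mul]
      rw [this]
      exact .bind₂ (.mul (ha 0 (by omega)) (hb _ hk)) (.mul (ha 1 (by omega)) (hb k (by omega)))
        (.add (by simp) (by simp))
  · nlinarith [Nat.one_le_two_pow (n := l), Nat.zero_le (2 ^ l * l), Nat.zero_le (2 ^ l * l ^ 2)]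

end FastMul

/-! ### Affine systems and bases of their solution spaces in echelon form -/

section AffineSystem

variable {F : Type*} [Field F]

/-- `f 0, …, f d` solve the system `c e + ∑ j, B e j * f j = 0`, `e < N`. -/
def SolvesSystem (d N : ℕ) (c : ℕ → F) (B : ℕ → ℕ → F) (f : ℕ → F) : Prop :=
  ∀ e < N, c e + ∑ j ∈ Finset.range (d + 1), B e j * f j = 0

/-- The vectors `o` are an affine basis of the solution space of a system, in echelon form
with pivots `piv`. -/
def IsEchelonBasis (d N : ℕ) (c : ℕ → F) (B : ℕ → ℕ → F) (o : List (List F)) (piv : List ℕ) :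
    Prop :=
  (o = [] ∧ ∀ f, ¬ SolvesSystem d N c B f) ∨
  (o.length = piv.length + 1 ∧ (∀ v ∈ o, v.length = d + 1) ∧ (∀ a ∈ piv, a ≤ d) ∧
    (∀ v ∈ o, SolvesSystem d N c B (fun j => v.getD j 0)) ∧
    (∀ k < o.length, ∀ l < piv.length,
      (o.getD k []).getD (piv.getD l 0) 0 = if k = l + 1 then 1 else 0) ∧
    ∀ f, SolvesSystem d N c B f → ∀ j ≤ d, f j = (o.getD 0 []).getD j 0 +
      ∑ l ∈ Finset.range piv.length, f (piv.getD l 0) *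
        ((o.getD (l + 1) []).getD j 0 - (o.getD 0 []).getD j 0))

end AffineSystem

/-! ### Decision trees -/

section DecisionTree

variable {Ω : Type*} {F : Ω → Type*} [∀ ω, Field (F ω)]

/-- There is a decision tree of depth at most `n` which, for all `ω ∈ P` and starting from the
elements of `K`, outputs vectors (and computes control data) satisfying `Post`. -/
inductive Solves (Post : ∀ ω, List (List (F ω)) → List ℕ → Prop) :
    Set Ω → Set (∀ ω, F ω) → ℕ → Prop
  | output {P : Set Ω} {K : Set (∀ ω, F ω)} {n : ℕ} (o : List (List (∀ ω, F ω))) (piv : List ℕ)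
      (hK : ∀ v ∈ o, ∀ x ∈ v, x ∈ K)
      (hpost : ∀ ω ∈ P, Post ω (o.map (List.map fun x => x ω)) piv) : Solves Post P K n
  | op {P : Set Ω} {K : Set (∀ ω, F ω)} {n : ℕ} {z : ∀ ω, F ω} (hz : IsFieldOp P K z)
      (h : Solves Post P (insert z K) n) : Solves Post P K (n + 1)
  | test {P : Set Ω} {K : Set (∀ ω, F ω)} {n : ℕ} {x : ∀ ω, F ω} (hx : x ∈ K)
      (h₀ : Solves Post (P ∩ {ω | x ω = 0}) K n) (h₁ : Solves Post (P ∩ {ω | x ω ≠ 0}) K n) :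
      Solves Post P K (n + 1)

namespace Solves

variable {Post : ∀ ω, List (List (F ω)) → List ℕ → Prop} {P : Set Ω} {K : Set (∀ ω, F ω)}
  {n k : ℕ}

theorem mono_cost (h : Solves Post P K n) (hn : n ≤ k) : Solves Post P K k := by
  induction h generalizing k with
  | output o piv hK hpost => exact .output o piv hK hpost
  | op hz _ ih =>
    obtain ⟨k, rfl⟩ : ∃ k', k = k' + 1 := ⟨k - 1, by omega⟩
    exact .op hz (ih (by omega))
  | test hx _ _ ih₀ ih₁ =>
    obtain ⟨k, rfl⟩ : ∃ k', k = k' + 1 := ⟨k - 1, by omega⟩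
    exact .test hx (ih₀ (by omega)) (ih₁ (by omega))

theorem mono_known {K' : Set (∀ ω, F ω)} (h : Solves Post P K n) (hK : K ⊆ K') :
    Solves Post P K' n := by
  induction h generalizing K' with
  | output o piv h hpost => exact .output o piv (fun v hv x hx => hK (h v hv x hx)) hpost
  | op hz _ ih => exact .op (hz.mono hK) (ih (Set.insert_subset_insert hK))
  | test hx _ _ ih₀ ih₁ => exact .test (hK hx) (ih₀ hK) (ih₁ hK)

theorem of_computes {A : Set (∀ ω, F ω)} (h : Computes P K n A) (h' : Solves Post P (K ∪ A) k) :
    Solves Post P K (n + k) := by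
  induction h with
  | done h =>
    rw [Set.union_eq_self_of_subset_right h] at h'
    exact h'.mono_cost (Nat.le_add_left _ _)
  | step hz h ih =>
    rw [Nat.add_right_comm]
    exact .op hz (ih (h'.mono_known (Set.union_subset_union_left _ (Set.subset_insert _ _))))

theorem of_empty (h : P = ∅) : Solves Post P K n :=
  .output [] [] (by simp) (by simp [h])

/-- The tree branches into all zero patterns `Z` of the tested elements, but only its depth is
counted, so the cost is one operation per element. -/
theorem testAll {ι : Type*} (s : Finset ι) (x : ι → ∀ ω, F ω) (hx : ∀ i ∈ s, x i ∈ K)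
    (h : ∀ Z : Set ι, Solves Post (P ∩ {ω | ∀ i ∈ s, x i ω = 0 ↔ i ∈ Z}) K n) :
    Solves Post P K (s.card + n) := by
  classical
  induction s using Finset.induction_on generalizing P with
  | empty => simpa using h ∅
  | insert i s hi ih =>
    rw [Finset.card_insert_of_notMem hi, Nat.add_right_comm]
    have hs (Q : Set Ω) (p : Prop) (hQ : Q = {ω | x i ω = 0 ↔ p}) :
        Solves Post (P ∩ Q) K (s.card + n) := by
      refine ih (fun j hj => hx j (by simp [hj])) fun Z => ?_
      have := h {j | if j = i then p else j ∈ Z}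
      convert this using 1
      rw [Set.inter_assoc]
      congr 1
      ext ω
      rw [hQ]
      simp only [Set.mem_inter_iff, Set.mem_ofPred_eq, Finset.mem_insert, forall_eq_or_imp, if_true]
      refine and_congr_right fun _ => forall₂_congr fun j hj => ?_
      rw [if_neg (by rintro rfl; exact hi hj)]
    exact .test (hx i (by simp)) (hs _ True (by ext; simp)) (hs _ False (by ext; simp))

end Solves

end DecisionTree

/-! ### Elimination in a parametrized family of candidates. -/

section Elimination

theorem affine_row_eq {F : Type*} [Field F] {d : ℕ} {c : F} {B f v₀ : ℕ → F} {w : ℕ → ℕ → F}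
    {A : Finset ℕ} {t : ℕ → F}
    (h : ∀ j ≤ d, f j = v₀ j + ∑ z ∈ A, t z * w z j) :
    c + ∑ j ∈ Finset.range (d + 1), B j * f j =
      (c + ∑ j ∈ Finset.range (d + 1), B j * v₀ j) +
        ∑ z ∈ A, t z * ∑ j ∈ Finset.range (d + 1), B j * w z j := by
  have : ∀ j ∈ Finset.range (d + 1), B j * f j =
      B j * v₀ j + ∑ z ∈ A, t z * (B j * w z j) := by
    intro j hj
    rw [h j (Nat.lt_succ_iff.1 (Finset.mem_range.1 hj)), mul_add, Finset.mul_sum]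
    congr 1
    exact Finset.sum_congr rfl fun z _ => by ring
  rw [Finset.sum_congr rfl this, Finset.sum_add_distrib, Finset.sum_comm]
  simp only [Finset.mul_sum]
  ring

theorem sum_eq_sum_range_toList {M : Type*} [AddCommMonoid M] (A : Finset ℕ) (g : ℕ → M) :
    ∑ z ∈ A, g z = ∑ l ∈ Finset.range A.toList.length, g (A.toList.getD l 0) := by
  rw [← Finset.sum_map_toList]
  induction A.toList with
  | nil => simp
  | cons a l ih => rw [List.length_cons, Finset.sum_range_succ']; simp [ih, add_comm]

/-- Solutions in terms of a point `v₀` and directions `w z`, `z ∈ A`, where the coordinates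
`z ∈ A` are the parameters. -/
structure IsParam {F : Type*} [Field F] (d N : ℕ) (c : ℕ → F) (B : ℕ → ℕ → F) (A : Finset ℕ)
    (v₀ : ℕ → F) (w : ℕ → ℕ → F) : Prop where
  le : ∀ z ∈ A, z ≤ d
  base : ∀ z ∈ A, v₀ z = 0
  dir : ∀ z ∈ A, ∀ z' ∈ A, w z z' = if z = z' then 1 else 0
  eq : ∀ f, SolvesSystem d N c B f → ∀ j ≤ d, f j = v₀ j + ∑ z ∈ A, f z * w z j

/-- If the row `e` is nonzero on the direction `w y`, it expresses the parameter `f y` through the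
other parameters. Substitution gives the new point and directions; since `w z` vanishes at the other
parameter positions when `z = y`, the unit pattern there persists. -/
theorem IsParam.eliminate {F : Type*} [Field F] {d N : ℕ} {c : ℕ → F} {B : ℕ → ℕ → F}
    {A : Finset ℕ} {v₀ : ℕ → F} {w : ℕ → ℕ → F} (h : IsParam d N c B A v₀ w) {y e : ℕ}
    (hy : y ∈ A) (he : e < N) (hne : ∑ j ∈ Finset.range (d + 1), B e j * w y j ≠ 0) :
    IsParam d N c B (A.erase y)
      (fun j => v₀ j - (c e + ∑ j ∈ Finset.range (d + 1), B e j * v₀ j) /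
        (∑ j ∈ Finset.range (d + 1), B e j * w y j) * w y j)
      (fun z j => w z j - (∑ j ∈ Finset.range (d + 1), B e j * w z j) /
        (∑ j ∈ Finset.range (d + 1), B e j * w y j) * w y j) where
  le z hz := h.le z (Finset.mem_of_mem_erase hz)
  base z hz := by
    obtain ⟨hz', hz⟩ := Finset.mem_erase.1 hz
    simp [h.base z hz, h.dir y hy z hz, hz'.symm]
  dir z hz z' hz' := by
    obtain ⟨hz1, hz⟩ := Finset.mem_erase.1 hz
    obtain ⟨hz2, hz'⟩ := Finset.mem_erase.1 hz'
    simp [h.dir z hz z' hz', h.dir y hy z' hz', hz2.symm]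
  eq f hf j hj := by
    have h1 := hf e he
    rw [affine_row_eq (h.eq f hf)] at h1
    rw [h.eq f hf j hj]
    rw [← Finset.add_sum_erase A _ hy] at h1 ⊢
    simp only [mul_sub, Finset.sum_sub_distrib]
    set s := ∑ j ∈ Finset.range (d + 1), B e j * w y j
    set r := c e + ∑ j ∈ Finset.range (d + 1), B e j * v₀ j
    have h2 : ∑ z ∈ A.erase y, f z * ((∑ j ∈ Finset.range (d + 1), B e j * w z j) / s * w y j) =
        (∑ z ∈ A.erase y, f z * ∑ j ∈ Finset.range (d + 1), B e j * w z j) * (w y j / s) := by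
      rw [Finset.sum_mul]
      exact Finset.sum_congr rfl fun z _ => by ring
    rw [h2]
    field_simp
    linear_combination (w y j) * h1

/-- `IsParam` only says that all solutions lie in the family. Once every row vanishes on the
directions and on the base point, the members of the family are solutions too. -/
theorem IsParam.isEchelonBasis {F : Type*} [Field F] {d N : ℕ} {c : ℕ → F} {B : ℕ → ℕ → F}
    {A : Finset ℕ} {v₀ : ℕ → F} {w : ℕ → ℕ → F} (h : IsParam d N c B A v₀ w)
    (h₀ : ∀ e < N, c e + ∑ j ∈ Finset.range (d + 1), B e j * v₀ j = 0)
    (h₁ : ∀ z ∈ A, ∀ e < N, ∑ j ∈ Finset.range (d + 1), B e j * w z j = 0) :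
    IsEchelonBasis d N c B ((List.range (d + 1)).map v₀ ::
      A.toList.map fun z => (List.range (d + 1)).map fun j => v₀ j + w z j) A.toList := by
  have hget (g : ℕ → F) {j : ℕ} (hj : j ≤ d) : ((List.range (d + 1)).map g).getD j 0 = g j := by
    simp [List.getD, List.getElem?_range (Nat.lt_succ_of_le hj)]
  have hsol (g : ℕ → F) (hg : ∀ e < N, c e + ∑ j ∈ Finset.range (d + 1), B e j * g j = 0) :
      SolvesSystem d N c B (fun j => ((List.range (d + 1)).map g).getD j 0) := by
    intro e he
    refine Eq.trans ?_ (hg e he)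
    congr 1
    refine Finset.sum_congr rfl fun j hj => ?_
    beta_reduce
    rw [hget g (Nat.lt_succ_iff.1 (Finset.mem_range.1 hj))]
  have hmem {l : ℕ} (hl : l < A.toList.length) : A.toList.getD l 0 ∈ A := by
    rw [← Finset.mem_toList]
    simp [List.getD, List.getElem?_eq_getElem hl]
  have hsucc {l : ℕ} (hl : l < A.toList.length) : ((List.range (d + 1)).map v₀ ::
      A.toList.map fun z => (List.range (d + 1)).map fun j => v₀ j + w z j).getD (l + 1) [] =
      (List.range (d + 1)).map fun j => v₀ j + w (A.toList.getD l 0) j := by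
    simp [List.getD, List.getElem?_eq_getElem hl]
  refine Or.inr ⟨by simp, ?_, fun a ha => h.le a (Finset.mem_toList.1 ha), ?_, ?_, ?_⟩
  · intro v hv
    rcases List.mem_cons.1 hv with rfl | hv
    · simp
    · obtain ⟨z, -, rfl⟩ := List.mem_map.1 hv
      simp
  · intro v hv
    rcases List.mem_cons.1 hv with rfl | hv
    · exact hsol v₀ h₀
    · obtain ⟨z, hz, rfl⟩ := List.mem_map.1 hv
      refine hsol _ fun e he => ?_
      simp only [mul_add, Finset.sum_add_distrib, h₁ z (Finset.mem_toList.1 hz) e he,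
        add_zero, h₀ e he]
  · intro k hk l hl
    have hz := hmem hl
    cases k with
    | zero =>
      simp only [List.getD_cons_zero]
      rw [hget _ (h.le _ hz), h.base _ hz, if_neg (by omega)]
    | succ k =>
      have hk' : k < A.toList.length := by simpa using hk
      rw [hsucc hk', hget _ (h.le _ hz), h.base _ hz, zero_add, h.dir _ (hmem hk') _ hz]
      simp only [Nat.add_right_cancel_iff]
      refine if_congr ?_ rfl rfl
      rw [List.getD_eq_getElem _ _ hk', List.getD_eq_getElem _ _ hl]
      exact A.nodup_toList.getElem_inj_iff
  · intro f hf j hj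
    rw [List.getD_cons_zero, hget _ hj, h.eq f hf j hj, sum_eq_sum_range_toList]
    congr 1
    refine Finset.sum_congr rfl fun l hl => ?_
    rw [hsucc (Finset.mem_range.1 hl), hget _ hj]
    ring

variable {Ω : Type*} {F : Ω → Type*} [∀ ω, Field (F ω)]

/-- Induction on the number of parameters. The row values `g₀`, `g` of the base point and directions
are carried along and updated by the same linear operations as the vectors, so the matrix is never
applied again. Testing costs `N` per vector and updating at most `6 * N` per vector, which sums to a
quadratic expression in `n + 1`. -/
theorem solves_of_isParam {d N : ℕ} {c : ℕ → ∀ ω, F ω} {B : ℕ → ℕ → ∀ ω, F ω} (hdN : d < N)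
    (n : ℕ) : ∀ (A : Finset ℕ) (P : Set Ω) (K : Set (∀ ω, F ω)) (v₀ g₀ : ℕ → ∀ ω, F ω)
      (w g : ℕ → ℕ → ∀ ω, F ω), A.card = n →
      (∀ ω ∈ P, IsParam d N (fun e => c e ω) (fun e j => B e j ω) A (fun j => v₀ j ω)
        (fun z j => w z j ω)) →
      (∀ ω ∈ P, ∀ e < N, g₀ e ω = c e ω + ∑ j ∈ Finset.range (d + 1), B e j ω * v₀ j ω) →
      (∀ ω ∈ P, ∀ z ∈ A, ∀ e < N, g z e ω = ∑ j ∈ Finset.range (d + 1), B e j ω * w z j ω) →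
      (∀ j ≤ d, v₀ j ∈ K) → (∀ e < N, g₀ e ∈ K) → (∀ z ∈ A, ∀ j ≤ d, w z j ∈ K) →
      (∀ z ∈ A, ∀ e < N, g z e ∈ K) →
      Solves (fun ω => IsEchelonBasis d N (fun e => c e ω) (fun e j => B e j ω)) P K
        (6 * N * (n + 1) ^ 2) := by
  classical
  induction n using Nat.strong_induction_on with
  | _ n ih =>
  intro A P K v₀ g₀ w g hA hparam hg₀ hg hv₀K hg₀K hwK hgK
  set Q : Finset (ℕ × ℕ) := A ×ˢ Finset.range N with hQ
  have hQcard : Q.card = n * N := by simp [hQ, hA]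
  have hmemQ {z e : ℕ} (hz : z ∈ A) (he : e < N) : (z, e) ∈ Q := by simp [hQ, hz, he]
  refine (Solves.testAll (n := 6 * N * (n + 1) ^ 2 - n * N) Q (fun p => g p.1 p.2) ?_
    fun Z => ?_).mono_cost ?_
  · rintro ⟨z, e⟩ hp
    simp only [hQ, Finset.mem_product, Finset.mem_range] at hp
    exact hgK z hp.1 e hp.2
  swap
  · rw [hQcard]
    have : n * N ≤ 6 * N * (n + 1) ^ 2 := by nlinarith [Nat.zero_le (N * n ^ 2)]
    omega
  by_cases hZ : ∃ y ∈ A, ∃ e < N, (y, e) ∉ Z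
  · obtain ⟨y, hy, e, he, hZ⟩ := hZ
    have hn : 0 < n := hA ▸ Finset.card_pos.2 ⟨y, hy⟩
    set P' := P ∩ {ω | ∀ p ∈ Q, g p.1 p.2 ω = 0 ↔ p ∈ Z} with hP'
    have hne : ∀ ω ∈ P', g y e ω ≠ 0 := fun ω hω h => hZ ((hω.2 (y, e) (hmemQ hy he)).1 h)
    have hstep (M : ℕ) (u v : ℕ → ∀ ω, F ω) {p : ∀ ω, F ω} (hu : ∀ j < M, u j ∈ K)
        (hv : ∀ j < M, v j ∈ K) (hp : p ∈ K) :
        Computes P' K (1 + M * 2) (firstEntries M fun j => u j - p / g y e * v j) :=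
      (Computes.div hp (hgK y hy e he) hne).trans' (.entries _ _ fun j hj =>
        (Computes.mul (Or.inr rfl) (Or.inl (hv j hj))).bind
          (.sub (Or.inr (Or.inl (hu j hj))) (Or.inl rfl)))
    have hall (u v u' v' : ℕ → ∀ ω, F ω) {p : ∀ ω, F ω} (hu : ∀ j ≤ d, u j ∈ K)
        (hv : ∀ j ≤ d, v j ∈ K) (hu' : ∀ j < N, u' j ∈ K) (hv' : ∀ j < N, v' j ∈ K)
        (hp : p ∈ K) : Computes P' K (6 * N)
          ((firstEntries (d + 1) fun j => u j - p / g y e * v j) ∪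
            firstEntries N fun j => u' j - p / g y e * v' j) :=
      ((hstep (d + 1) u v (fun j hj => hu j (by omega)) (fun j hj => hv j (by omega)) hp).union
        (hstep N u' v' hu' hv' hp)).mono_cost (by omega)
    have hcomp := (hall v₀ (w y) g₀ (g y) hv₀K (hwK y hy) hg₀K (hgK y hy) (hg₀K e he)).union
      (Computes.biUnion (A.erase y) _ (fun _ => 6 * N) fun z hz =>
        hall (w z) (w y) (g z) (g y) (hwK z (Finset.mem_of_mem_erase hz)) (hwK y hy)
          (hgK z (Finset.mem_of_mem_erase hz)) (hgK y hy)
          (hgK z (Finset.mem_of_mem_erase hz) e he))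
    rw [Finset.sum_const, Finset.card_erase_of_mem hy, hA, smul_eq_mul] at hcomp
    have hg₀' : ∀ ω ∈ P', ∀ e < N, g₀ e ω =
        c e ω + ∑ j ∈ Finset.range (d + 1), B e j ω * v₀ j ω := fun ω hω => hg₀ ω hω.1
    have hg' : ∀ ω ∈ P', ∀ z ∈ A, ∀ e < N, g z e ω =
        ∑ j ∈ Finset.range (d + 1), B e j ω * w z j ω := fun ω hω => hg ω hω.1
    refine (Solves.of_computes hcomp (ih (n - 1) (by omega) (A.erase y) P' _
      (fun j => v₀ j - g₀ e / g y e * w y j) (fun i => g₀ i - g₀ e / g y e * g y i)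
      (fun z j => w z j - g z e / g y e * w y j) (fun z i => g z i - g z e / g y e * g y i)
      (by rw [Finset.card_erase_of_mem hy, hA]) ?_ ?_ ?_ ?_ ?_ ?_ ?_)).mono_cost ?_
    · intro ω hω
      have hne' := hne ω hω
      rw [hg' ω hω y hy e he] at hne'
      have := (hparam ω hω.1).eliminate hy he hne'
      simp only [← hg' ω hω y hy e he, ← hg₀' ω hω e he] at this
      refine ⟨this.le, this.base, fun z hz => ?_, fun f hf j hj => ?_⟩
      · have h1 := this.dir z hz
        rw [← hg' ω hω z (Finset.mem_of_mem_erase hz) e he] at h1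
        exact h1
      · rw [this.eq f hf j hj]
        congr 1
        refine Finset.sum_congr rfl fun z hz => ?_
        rw [← hg' ω hω z (Finset.mem_of_mem_erase hz) e he]
        rfl
    · intro ω hω i hi
      simp only [Pi.sub_apply, Pi.mul_apply, Pi.div_apply, mul_sub, Finset.sum_sub_distrib]
      rw [hg₀' ω hω i hi, hg' ω hω y hy i hi, Finset.mul_sum, add_sub_assoc]
      congr 2
      exact Finset.sum_congr rfl fun j _ => by ring
    · intro ω hω z hz i hi
      simp only [Pi.sub_apply, Pi.mul_apply, Pi.div_apply, mul_sub, Finset.sum_sub_distrib]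
      rw [hg' ω hω z (Finset.mem_of_mem_erase hz) i hi, hg' ω hω y hy i hi, Finset.mul_sum]
      congr 1
      exact Finset.sum_congr rfl fun j _ => by ring
    · exact fun j hj => Or.inr (Or.inl (Or.inl ⟨j, by omega, rfl⟩))
    · exact fun j hj => Or.inr (Or.inl (Or.inr ⟨j, hj, rfl⟩))
    · exact fun z hz j hj => Or.inr (Or.inr (Set.mem_biUnion (x := z) hz
        (Or.inl ⟨j, by omega, rfl⟩)))
    · exact fun z hz j hj => Or.inr (Or.inr (Set.mem_biUnion (x := z) hz (Or.inr ⟨j, hj, rfl⟩)))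
    · obtain ⟨k, rfl⟩ : ∃ k, n = k + 1 := ⟨n - 1, by omega⟩
      rw [Nat.add_sub_cancel]
      refine Nat.le_sub_of_add_le ?_
      nlinarith [Nat.zero_le (k * N)]
  · push Not at hZ
    -- All rows vanish on all directions, so each row is constant on the family and its value at the
    -- base point decides solvability.
    refine ((Solves.testAll (n := 6 * N * (n + 1) ^ 2 - n * N - N) (Finset.range N) g₀
      (fun e he => hg₀K e (Finset.mem_range.1 he)) fun Z' => ?_).mono_cost ?_)
    swap
    · rw [Finset.card_range]
      have : n * N + N ≤ 6 * N * (n + 1) ^ 2 := by nlinarith [Nat.zero_le (N * n ^ 2)]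
      omega
    set P' := P ∩ {ω | ∀ p ∈ Q, g p.1 p.2 ω = 0 ↔ p ∈ Z} ∩
      {ω | ∀ e ∈ Finset.range N, g₀ e ω = 0 ↔ e ∈ Z'} with hP'
    have hzero : ∀ ω ∈ P', ∀ z ∈ A, ∀ e < N,
        ∑ j ∈ Finset.range (d + 1), B e j ω * w z j ω = 0 := by
      intro ω hω z hz e he
      rw [← hg ω hω.1.1 z hz e he]
      exact (hω.1.2 (z, e) (hmemQ hz he)).2 (hZ z hz e he)
    by_cases hZ' : ∀ e < N, e ∈ Z'
    · have hcomp : Computes P' K (n * (d + 1))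
          (⋃ z ∈ A, firstEntries (d + 1) fun j => v₀ j + w z j) := by
        have := Computes.biUnion (P := P') (K := K) A
          (fun z => firstEntries (d + 1) fun j => v₀ j + w z j) (fun _ => (d + 1) * 1)
          fun z hz => .entries _ _ fun j hj => .add (hv₀K j (by omega)) (hwK z hz j (by omega))
        simpa [hA] using this
      refine (Solves.of_computes hcomp (.output (n := 0) ((List.range (d + 1)).map v₀ ::
        A.toList.map fun z => (List.range (d + 1)).map fun j => v₀ j + w z j) A.toList
        ?_ ?_)).mono_cost ?_
      · intro v hv x hx
        rcases List.mem_cons.1 hv with rfl | hv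
        · obtain ⟨j, hj, rfl⟩ := List.mem_map.1 hx
          exact Or.inl (hv₀K j (by rw [List.mem_range] at hj; omega))
        · obtain ⟨z, hz, rfl⟩ := List.mem_map.1 hv
          obtain ⟨j, hj, rfl⟩ := List.mem_map.1 hx
          exact Or.inr (Set.mem_biUnion (x := z) (Finset.mem_toList.1 hz)
            ⟨j, List.mem_range.1 hj, rfl⟩)
      · intro ω hω
        have := (hparam ω hω.1.1).isEchelonBasis (fun e he => by
          rw [← hg₀ ω hω.1.1 e he]
          exact (hω.2 e (Finset.mem_range.2 he)).2 (hZ' e he)) (hzero ω hω)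
        simpa [List.map_map, Function.comp_def] using this
      · have : n * (d + 1) ≤ n * N := Nat.mul_le_mul_left _ hdN
        refine Nat.le_sub_of_add_le (Nat.le_sub_of_add_le ?_)
        nlinarith [Nat.zero_le (N * n ^ 2)]
    · push Not at hZ'
      obtain ⟨e, he, heZ⟩ := hZ'
      -- A row with a nonzero constant value excludes all solutions.
      refine .output [] [] (by simp) fun ω hω => Or.inl ⟨rfl, fun f hf => heZ ?_⟩
      refine (hω.2 e (Finset.mem_range.2 he)).1 ?_
      have h1 := hf e he
      rw [affine_row_eq ((hparam ω hω.1.1).eq f hf)] at h1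
      rw [Finset.sum_eq_zero (s := A) fun z hz => by rw [hzero ω hω z hz e he, mul_zero],
        add_zero] at h1
      rw [hg₀ ω hω.1.1 e he, h1]

end Elimination

/-! ### The triangular structure of a linear differential operator -/

section Triangular

variable {R : Type*} [CommRing R]

/-- The coefficient of `x ^ (t + i + s)` in `Qᵢ`, where `s = σ - m`. -/
def shiftedCoeff (m σ : ℕ) (q : ℕ → ℕ → R) (i t : ℕ) : R :=
  if m ≤ t + i + σ then q i (t + i + σ - m) else 0

/-- The coefficient of `x ^ (k + s)` in the image of `x ^ j`, where `s = σ - m` and `j ≤ k`. -/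
def triCoeff (m σ : ℕ) (q : ℕ → ℕ → R) (k j : ℕ) : R :=
  ∑ i ∈ Finset.range (m + 1), shiftedCoeff m σ q i (k - j) * (j.descFactorial i : R)

/-- The coefficient of `x ^ e` in the image of `x ^ j` under `∑ i, Qᵢ ∂ⁱ`. -/
def rowCoeff (m : ℕ) (q : ℕ → ℕ → R) (e j : ℕ) : R :=
  ∑ i ∈ Finset.range (m + 1),
    if j ≤ e + i then q i (e + i - j) * (j.descFactorial i : R) else 0

variable {m σ : ℕ} {q : ℕ → ℕ → R}

theorem rowCoeff_eq_triCoeff {k j : ℕ} (hk : m ≤ k + σ) (hj : j ≤ k) :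
    rowCoeff m q (k + σ - m) j = triCoeff m σ q k j := by
  refine Finset.sum_congr rfl fun i _ => ?_
  rw [shiftedCoeff]
  by_cases h : j ≤ k + σ - m + i
  · rw [if_pos h, if_pos (by omega)]
    congr 2
    omega
  · rw [if_neg h, if_neg (by omega), zero_mul]

/-- By the choice of `σ` as a lower bound for the shift, the image of `x ^ j` has no term below `x ^
(j + σ - m)`; this is the triangularity. -/
theorem rowCoeff_eq_zero (hσ : ∀ i ≤ m, ∀ a, a + m < σ + i → q i a = 0) {k j : ℕ}
    (hk : m ≤ k + σ) (hj : k < j) : rowCoeff m q (k + σ - m) j = 0 := by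
  refine Finset.sum_eq_zero fun i hi => ?_
  split_ifs with h
  · rw [hσ i (Nat.lt_succ_iff.1 (Finset.mem_range.1 hi)) _ (by omega), zero_mul]
  · rfl

theorem sum_rowCoeff (hσ : ∀ i ≤ m, ∀ a, a + m < σ + i → q i a = 0) {d k : ℕ}
    (hk : m ≤ k + σ) (hkd : k ≤ d) (f : ℕ → R) :
    ∑ j ∈ Finset.range (d + 1), rowCoeff m q (k + σ - m) j * f j =
      ∑ j ∈ Finset.range (k + 1), triCoeff m σ q k j * f j := by
  symm
  refine Finset.sum_subset_zero_on_sdiff (Finset.range_mono (by omega)) ?_ ?_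
  · intro j hj
    simp only [Finset.mem_sdiff, Finset.mem_range] at hj
    rw [rowCoeff_eq_zero hσ hk (by omega), zero_mul]
  · intro j hj
    rw [Finset.mem_range] at hj
    rw [rowCoeff_eq_triCoeff hk (by omega)]

/-- For these `k` the exponent `k + σ - m` would be negative and no row exists. The diagonal entry
vanishes as well, so such `k` are always among the free indices. -/
theorem triCoeff_self_eq_zero {k : ℕ} (hk : k + σ < m) : triCoeff m σ q k k = 0 := by
  refine Finset.sum_eq_zero fun i _ => ?_
  rw [shiftedCoeff]
  by_cases h : k < i
  · rw [Nat.descFactorial_of_lt h, Nat.cast_zero, mul_zero]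
  · rw [if_neg (by omega), zero_mul]

end Triangular

/-! ### Zeros of the indicial polynomial. -/

section Indicial

variable {F : Type*} [Field F]

/-- A positive difference of two elements of `{0, …, d}` divides `d!`, hence is nonzero in `F`. -/
theorem natCast_injOn_of_factorial_ne_zero {d : ℕ} (hd : (d.factorial : F) ≠ 0) :
    Set.InjOn (Nat.cast : ℕ → F) (Set.Iic d) := by
  have key : ∀ j k : ℕ, k ≤ d → j < k → (j : F) ≠ k := by
    intro j k hk hjk h
    obtain ⟨c, hc⟩ := Nat.dvd_factorial (by omega : 0 < k - j) (by omega : k - j ≤ d)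
    apply hd
    rw [hc, Nat.cast_mul, Nat.cast_sub hjk.le, h, sub_self, zero_mul]
  intro j hj k hk h
  by_contra hne
  rcases Nat.lt_or_gt_of_ne hne with h' | h'
  · exact key j k hk h' h
  · exact key k j hj h' h.symm

/-- The sum is the value at `k` of `∑ s i * descPochhammer F i`, a nonzero polynomial of degree at
most `m`, and distinct `k ≤ d` give distinct roots. -/
theorem card_le_of_sum_descFactorial_eq_zero {d m : ℕ} (hd : (d.factorial : F) ≠ 0)
    {s : ℕ → F} (hs : ∃ i ≤ m, s i ≠ 0) {Z : Finset ℕ} (hZ : ∀ k ∈ Z, k ≤ d ∧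
      ∑ i ∈ Finset.range (m + 1), s i * (k.descFactorial i : F) = 0) : Z.card ≤ m := by
  classical
  set p : F[X] := ∑ i ∈ Finset.range (m + 1), C (s i) * descPochhammer F i with hp
  have heval (k : ℕ) : p.eval (k : F) =
      ∑ i ∈ Finset.range (m + 1), s i * (k.descFactorial i : F) := by
    simp [hp, Polynomial.eval_finsetSum, descPochhammer_eval_eq_descFactorial]
  have hdeg : p.natDegree ≤ m := by
    refine Polynomial.natDegree_sum_le_of_forall_le _ _ fun i hi => ?_
    refine (Polynomial.natDegree_C_mul_le _ _).trans ?_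
    rw [descPochhammer_natDegree]
    exact Nat.lt_succ_iff.1 (Finset.mem_range.1 hi)
  have hne : p ≠ 0 := by
    -- For the largest `i₀` with `s i₀ ≠ 0`, only the monic polynomial of degree `i₀` contributes to
    -- the coefficient of `X ^ i₀`.
    obtain ⟨i₀, hi₀, hmax⟩ := ((Finset.range (m + 1)).filter fun i => s i ≠ 0).exists_max_image id
      (by obtain ⟨i, hi, hi'⟩ := hs; exact ⟨i, by simp [hi']; omega⟩)
    simp only [Finset.mem_filter, Finset.mem_range, id] at hi₀ hmax
    intro h0
    have : p.coeff i₀ = s i₀ := by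
      rw [hp, Polynomial.finsetSum_coeff, Finset.sum_eq_single i₀]
      · have := monic_descPochhammer F i₀
        rw [Monic, leadingCoeff, descPochhammer_natDegree] at this
        rw [coeff_C_mul, this, mul_one]
      · intro i hi hii
        rw [coeff_C_mul]
        by_cases hlt : i < i₀
        · rw [coeff_eq_zero_of_natDegree_lt (by rwa [descPochhammer_natDegree]), mul_zero]
        · have : s i = 0 := by
            by_contra hsi
            have := hmax i ⟨Finset.mem_range.1 hi, hsi⟩
            omega
          rw [this, zero_mul]
      · intro h
        exact absurd (Finset.mem_range.2 hi₀.1) h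
    rw [h0, coeff_zero] at this
    exact hi₀.2 this.symm
  refine le_trans ?_ hdeg
  refine le_trans ?_ p.card_roots'
  refine le_trans ?_ (Multiset.toFinset_card_le _)
  refine Finset.card_le_card_of_injOn (Nat.cast : ℕ → F) ?_ ?_
  · intro k hk
    have := (hZ k hk).2
    simp only [Finset.mem_coe, Multiset.mem_toFinset, mem_roots hne, IsRoot, heval]
    exact this
  · refine (natCast_injOn_of_factorial_ne_zero hd).mono fun k hk => ?_
    exact (hZ k hk).1

/-- Strong induction: the row `k` contains only `T k k * u k` once the earlier entries are known to
vanish. -/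
theorem eq_zero_of_triangular {T : ℕ → ℕ → F} {u : ℕ → F} {d : ℕ} {Z : Set ℕ}
    (hZ : ∀ k ≤ d, k ∉ Z → T k k ≠ 0) (hu : ∀ k ∈ Z, u k = 0)
    (h : ∀ k ≤ d, k ∉ Z → ∑ j ∈ Finset.range (k + 1), T k j * u j = 0) :
    ∀ k ≤ d, u k = 0 := by
  intro k
  induction k using Nat.strong_induction_on with
  | _ k ih =>
    intro hk
    by_cases hkZ : k ∈ Z
    · exact hu k hkZ
    have := h k hk hkZ
    rw [Finset.sum_range_succ, Finset.sum_eq_zero, zero_add] at this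
    · exact (mul_eq_zero.1 this).resolve_left (hZ k hk hkZ)
    · intro j hj
      rw [Finset.mem_range] at hj
      rw [ih j hj (by omega), mul_zero]

variable {m σ d D : ℕ} {q : ℕ → ℕ → F} {p : ℕ → F}

/-- The solutions of the equations without the rows `Z` parametrize the solutions of the
system. -/
theorem isParam_of_triangular (hσ : ∀ i ≤ m, ∀ a, a + m < σ + i → q i a = 0) (hσD : σ ≤ D + m)
    {Z : Finset ℕ} (hZ : ∀ k, k ∈ Z ↔ k ≤ d ∧ triCoeff m σ q k k = 0) {f₀ : ℕ → F}
    {f : ℕ → ℕ → F} (hf₀Z : ∀ k ∈ Z, f₀ k = 0)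
    (hfZ : ∀ z ∈ Z, ∀ k ∈ Z, f z k = if z = k then 1 else 0)
    (hf₀ : ∀ k ≤ d, k ∉ Z → (if m ≤ k + σ then p (k + σ - m) else 0) +
      ∑ j ∈ Finset.range (k + 1), triCoeff m σ q k j * f₀ j = 0)
    (hf : ∀ z ∈ Z, ∀ k ≤ d, k ∉ Z →
      ∑ j ∈ Finset.range (k + 1), triCoeff m σ q k j * f z j = 0) :
    IsParam d (D + d + 1) p (rowCoeff m q) Z f₀ f where
  le z hz := ((hZ z).1 hz).1
  base := hf₀Z
  dir := hfZ
  eq h hh j hj := by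
    -- The difference between a solution and the member of the family with the same entries on `Z`
    -- vanishes on `Z` and satisfies the homogeneous rows outside `Z`.
    have key := eq_zero_of_triangular (T := triCoeff m σ q) (d := d) (Z := Z)
      (u := fun j => h j - (f₀ j + ∑ z ∈ Z, h z * f z j))
      (fun k hk hkZ h0 => hkZ ((hZ k).2 ⟨hk, h0⟩)) ?_ ?_ j hj
    · exact sub_eq_zero.1 key
    · intro k hk
      rw [Finset.mem_coe] at hk
      rw [hf₀Z k hk, zero_add, Finset.sum_eq_single k]
      · rw [hfZ k hk k hk, if_pos rfl, mul_one, sub_self]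
      · intro z hz hzk
        rw [hfZ z hz k hk, if_neg hzk, mul_zero]
      · exact fun h => absurd hk h
    · intro k hk hkZ
      rw [Finset.mem_coe] at hkZ
      have hkσ : m ≤ k + σ := by
        by_contra hlt
        exact hkZ ((hZ k).2 ⟨hk, triCoeff_self_eq_zero (by omega)⟩)
      -- The row number is below `D + d + 1` because `σ ≤ D + m`.
      have h1 := hh (k + σ - m) (by omega)
      rw [sum_rowCoeff hσ hkσ hk] at h1
      have h2 := hf₀ k hk hkZ
      rw [if_pos hkσ] at h2
      have h3 : ∑ j ∈ Finset.range (k + 1), triCoeff m σ q k j * ∑ z ∈ Z, h z * f z j = 0 := by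
        simp only [Finset.mul_sum]
        rw [Finset.sum_comm]
        refine Finset.sum_eq_zero fun z hz => ?_
        have := hf z hz k hk hkZ
        calc _ = h z * ∑ j ∈ Finset.range (k + 1), triCoeff m σ q k j * f z j := by
              rw [Finset.mul_sum]
              exact Finset.sum_congr rfl fun j _ => by ring
          _ = 0 := by rw [this, mul_zero]
      simp only [mul_sub, mul_add, Finset.sum_sub_distrib, Finset.sum_add_distrib, h3]
      linear_combination h1 - h2

end Indicial

/-! ### Solving triangular systems by divide and conquer -/

section ForwardSubst

/-- Forward substitution for the triangular system `b k + ∑ j ≤ k, T k j * f j = 0`, where the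
entries with index in `Z` are prescribed. -/
noncomputable def forwardSubst {E : Type*} [CommRing E] [Div E] (T : ℕ → ℕ → E) (b g : ℕ → E)
    (Z : Set ℕ) (k : ℕ) : E :=
  open Classical in
  if k ∈ Z then g k else -(b k + ∑ j : Fin k, T k j * forwardSubst T b g Z j) / T k k
termination_by k
decreasing_by exact j.2

theorem forwardSubst_of_mem {E : Type*} [CommRing E] [Div E] {T : ℕ → ℕ → E} {b g : ℕ → E}
    {Z : Set ℕ} {k : ℕ} (hk : k ∈ Z) : forwardSubst T b g Z k = g k := by
  rw [forwardSubst, if_pos hk]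

theorem forwardSubst_of_notMem {E : Type*} [CommRing E] [Div E] {T : ℕ → ℕ → E} {b g : ℕ → E}
    {Z : Set ℕ} {k : ℕ} (hk : k ∉ Z) : forwardSubst T b g Z k =
      -(b k + ∑ j ∈ Finset.range k, T k j * forwardSubst T b g Z j) / T k k := by
  rw [forwardSubst, if_neg hk, Finset.sum_range fun j => T k j * forwardSubst T b g Z j]

/-- `triCoeff m σ q k j` is a sum over `i` of a function of `k - j` times a function of `j`. The
part of row `k` coming from a block of columns is therefore a sum of `m + 1` convolutions, with the
falling factorials absorbed into the vector. -/
theorem sum_triCoeff_block {R : Type*} [CommRing R] {m σ : ℕ} {q : ℕ → ℕ → R} (f : ℕ → R)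
    {a h k : ℕ} (hk : a + h ≤ k) :
    ∑ j ∈ Finset.range (a + h), triCoeff m σ q k j * f j =
      ∑ j ∈ Finset.range a, triCoeff m σ q k j * f j +
        ∑ i ∈ Finset.range (m + 1), convolution
          (fun t => if t < h then ((a + t).descFactorial i : R) * f (a + t) else 0)
          (shiftedCoeff m σ q i) (k - a) := by
  rw [Finset.sum_range_add]
  congr 1
  simp only [triCoeff, Finset.sum_mul]
  rw [Finset.sum_comm]
  refine Finset.sum_congr rfl fun i _ => ?_
  rw [convolution]
  refine Finset.sum_subset_zero_on_sdiff (Finset.range_mono (by omega)) ?_ ?_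
  · intro t ht
    simp only [Finset.mem_sdiff, Finset.mem_range] at ht
    rw [if_neg ht.2, zero_mul]
  · intro t ht
    rw [if_pos (Finset.mem_range.1 ht), Nat.sub_sub]
    ring

variable {Ω : Type*} {F : Ω → Type*} [∀ ω, Field (F ω)] {P : Set Ω}

/-- The entries of a sequence with index in `[a, a + n)`. -/
def blockEntries {E : Type*} (a n : ℕ) (f : ℕ → E) : Set E := firstEntries n fun t => f (a + t)

theorem blockEntries_subset {E : Type*} {a n : ℕ} {f : ℕ → E} {K : Set E} :
    blockEntries a n f ⊆ K ↔ ∀ t < n, f (a + t) ∈ K := firstEntries_subset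

/-- Divide and conquer on a block of length `2 ^ l`, given the right-hand sides corrected by all
columns before the block: solve the left half, subtract its influence on the right half by
convolutions, solve the right half. The convolutions cost `O((m + 1) 2 ^ l l ^ 2)` and there are `l`
levels, whence the cube. The parameter `L` only fixes how many Toeplitz coefficients are stored. -/
theorem computes_forwardSubst_block {m σ d L : ℕ} {q : ℕ → ℕ → ∀ ω, F ω} {b g : ℕ → ∀ ω, F ω}
    {Z : Set ℕ} (h2 : 1 < d → ∀ ω, (2 : F ω) ≠ 0)
    (hZ : ∀ k, k ∉ Z → ∀ ω ∈ P, triCoeff m σ q k k ω ≠ 0)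
    (hd : ∀ k, d < k → forwardSubst (triCoeff m σ q) b g Z k = 0) (l : ℕ) :
    ∀ (a : ℕ) (K : Set (∀ ω, F ω)), l ≤ L → 0 ∈ K → 1 ∈ K → 2 ∈ K → (∀ k ∈ Z, g k ∈ K) →
      (∀ k, k ∉ Z → triCoeff m σ q k k ∈ K) →
      (∀ i ≤ m, ∀ j ≤ d, (j.descFactorial i : ∀ ω, F ω) ∈ K) →
      (∀ i ≤ m, firstEntries (2 ^ L) (shiftedCoeff m σ q i) ⊆ K) →
      (∀ t < 2 ^ l, b (a + t) + ∑ j ∈ Finset.range a, triCoeff m σ q (a + t) j *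
        forwardSubst (triCoeff m σ q) b g Z j ∈ K) →
      Computes P K ((m + 1) * 2 ^ l * (300 * (l + 1) ^ 3))
        (blockEntries a (2 ^ l) (forwardSubst (triCoeff m σ q) b g Z)) := by
  set f := forwardSubst (triCoeff m σ q) b g Z with hf
  induction l with
  | zero =>
    intro a K _ h0 h1 hK2 hg hχ _ _ hr
    have key : Computes P K 2 {f a} := by
      by_cases ha : a ∈ Z
      · exact .of_mem (by rw [hf, forwardSubst_of_mem ha]; exact hg a ha)
      · rw [hf, forwardSubst_of_notMem ha]
        refine ((Computes.neg h0 (hr 0 (by simp))).bind (k := 1) ?_).mono_cost le_rfl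
        exact .div (Or.inl rfl) (Or.inr (hχ a ha)) (hZ a ha)
    refine (key.mono_cost (by omega)).anti ?_
    rw [blockEntries_subset]
    intro t ht
    obtain rfl : t = 0 := by simpa using ht
    rfl
  | succ l ih =>
    intro a K hlL h0 h1 hK2 hg hχ hdesc hq hr
    set h := 2 ^ l with hh
    have hpow : 2 ^ (l + 1) = h + h := by rw [hh]; ring
    rw [hpow] at hr
    have hleft := ih a K (by omega) h0 h1 hK2 hg hχ hdesc hq fun t ht => hr t (by omega)
    set A : ℕ → ℕ → ∀ ω, F ω := fun i t =>
      if t < h then ((a + t).descFactorial i : ∀ ω, F ω) * f (a + t) else 0 with hA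
    have hconv : ∀ i ≤ m, Computes P (K ∪ blockEntries a h f)
        (2 ^ (l + 1) * 1 + 200 * 2 ^ (l + 1) * (l + 1 + 1) ^ 2)
        (firstEntries (2 ^ (l + 1)) (convolution (A i) (shiftedCoeff m σ q i))) := by
      intro i hi
      have hAi : Computes P (K ∪ blockEntries a h f) (2 ^ (l + 1) * 1)
          (firstEntries (2 ^ (l + 1)) (A i)) := by
        refine .entries _ _ fun t _ => ?_
        by_cases hth : t < h ∧ a + t ≤ d
        · simp only [hA, if_pos hth.1]
          exact .mul (Or.inl (hdesc i hi _ hth.2)) (Or.inr ⟨t, hth.1, rfl⟩)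
        -- Entries beyond `d` are zero. This is needed because falling factorials are stored only up
        -- to `d`, and because convolution without an inverse of `2` requires a first factor
        -- supported on `0, …, d`.
        · have : A i t = 0 := by
            simp only [hA]
            split_ifs with hlt
            · rw [hd (a + t) (by omega), mul_zero]
            · rfl
          rw [this]
          exact .of_mem (Or.inl h0)
      refine hAi.trans' (computes_convolution h2 (l + 1) (Or.inl (Or.inl h0)) (Or.inl (Or.inl h1))
        (Or.inl (Or.inl hK2)) Set.subset_union_right ?_ ?_)
      · rw [firstEntries_subset]
        intro t ht
        exact Or.inl (Or.inl (firstEntries_subset.1 (hq i hi) t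
          (ht.trans_le (Nat.pow_le_pow_right two_pos hlL))))
      · intro j hj
        simp only [hA]
        rw [hd (a + j) (by omega), mul_zero, ite_self]
    have hupd := hleft.trans (Computes.iUnion_lt (m + 1) _ fun i hi => hconv i (by omega))
    set K₂ := K ∪ (blockEntries a h f ∪ {x | ∃ i < m + 1,
      x ∈ firstEntries (2 ^ (l + 1)) (convolution (A i) (shiftedCoeff m σ q i))}) with hK₂
    have hres : Computes P K₂ (h * (0 + ((m + 1) * (0 + 1)) + 1)) (firstEntries h fun t =>
        b (a + h + t) + ∑ j ∈ Finset.range (a + h), triCoeff m σ q (a + h + t) j * f j) := by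
      refine .entries _ _ fun t ht => ?_
      rw [sum_triCoeff_block f (by omega), ← add_assoc]
      refine .bind₂ (.of_mem (Or.inl ?_)) ?_ (.add (Or.inl rfl) (Or.inr (Or.inl rfl)))
      · have := hr (h + t) (by omega)
        rwa [← add_assoc] at this
      · have := Computes.sum (P := P) (n := 0) (Finset.range (m + 1))
          (fun i => convolution (A i) (shiftedCoeff m σ q i) (a + h + t - a)) (K := K₂)
          (Or.inl h0) fun i hi => .of_mem (Or.inr (Or.inr ⟨i, Finset.mem_range.1 hi, ?_⟩))
        · rwa [Finset.card_range] at this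
        · exact ⟨a + h + t - a, by omega, rfl⟩
    set K₃ := K₂ ∪ firstEntries h fun t =>
        b (a + h + t) + ∑ j ∈ Finset.range (a + h), triCoeff m σ q (a + h + t) j * f j with hK₃
    have hKK₃ : K ⊆ K₃ := fun x hx => Or.inl (Or.inl hx)
    have hright := ih (a + h) K₃ (by omega) (hKK₃ h0) (hKK₃ h1) (hKK₃ hK2)
      (fun k hk => hKK₃ (hg k hk)) (fun k hk => hKK₃ (hχ k hk))
      (fun i hi j hj => hKK₃ (hdesc i hi j hj)) (fun i hi => (hq i hi).trans hKK₃)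
      fun t ht => Or.inr ⟨t, ht, rfl⟩
    refine ((hupd.trans (hres.trans' hright)).mono_cost ?_).anti ?_
    · rw [hpow]
      have e1 : (m + 1) * (h + h) * (300 * (l + 1 + 1) ^ 3) =
        (m + 1) * h * (600 * (l + 2) ^ 3) := by ring
      have e2 : (m + 1) * h * (300 * (l + 1) ^ 3) +
        (m + 1) * ((h + h) * 1 + 200 * (h + h) * (l + 1 + 1) ^ 2) +
        (h * (0 + (m + 1) * (0 + 1) + 1) + (m + 1) * h * (300 * (l + 1) ^ 3)) =
        (m + 1) * h * (600 * (l + 1) ^ 3 + 2 + 400 * (l + 2) ^ 2 + 1) + h := by ring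
      rw [e1, e2]
      have hM : h ≤ (m + 1) * h := Nat.le_mul_of_pos_left _ (by omega)
      generalize (m + 1) * h = M at hM ⊢
      calc M * (600 * (l + 1) ^ 3 + 2 + 400 * (l + 2) ^ 2 + 1) + h
          ≤ M * (600 * (l + 1) ^ 3 + 2 + 400 * (l + 2) ^ 2 + 1) + M := by omega
        _ = M * (600 * (l + 1) ^ 3 + 400 * (l + 2) ^ 2 + 4) := by ring
        _ ≤ M * (600 * (l + 2) ^ 3) := by
            refine Nat.mul_le_mul_left _ ?_
            ring_nf
            omega
    · rw [blockEntries_subset]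
      intro t ht
      by_cases hth : t < h
      · exact Or.inl (Or.inl ⟨t, hth, rfl⟩)
      · refine Or.inr ⟨t - h, by omega, ?_⟩
        beta_reduce
        congr 1
        omega

/-- The rows of the system, evaluated at `f`. -/
theorem computes_rows {m d N l : ℕ} {q : ℕ → ℕ → ∀ ω, F ω} {f : ℕ → ∀ ω, F ω}
    {K : Set (∀ ω, F ω)} (h2 : 1 < d → ∀ ω, (2 : F ω) ≠ 0) (hN : N ≤ 2 ^ l)
    (h0 : 0 ∈ K) (h1 : 1 ∈ K) (hK2 : 2 ∈ K)
    (hdesc : ∀ i ≤ m, ∀ j ≤ d, (j.descFactorial i : ∀ ω, F ω) ∈ K)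
    (hq : ∀ i ≤ m, ∀ a, q i a ∈ K) (hf : ∀ j ≤ d, f j ∈ K) :
    Computes P K ((m + 1) * 2 ^ l * (300 * (l + 1) ^ 2)) (firstEntries N fun e =>
      ∑ j ∈ Finset.range (d + 1), rowCoeff m q e j * f j) := by
  -- `A i` lists the coefficients of the `i`-th derivative, so each row is a coefficient of `∑ Qᵢ
  -- f⁽ⁱ⁾`.
  set A : ℕ → ℕ → ∀ ω, F ω := fun i t =>
    if t + i ≤ d then ((t + i).descFactorial i : ∀ ω, F ω) * f (t + i) else 0 with hA
  have hrow (e : ℕ) : ∑ j ∈ Finset.range (d + 1), rowCoeff m q e j * f j =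
      ∑ i ∈ Finset.range (m + 1), convolution (A i) (q i) e := by
    simp only [rowCoeff, Finset.sum_mul]
    rw [Finset.sum_comm]
    refine Finset.sum_congr rfl fun i _ => ?_
    -- Reindexing by `j = t + i` adds the indices `j < i`, whose falling factorials vanish.
    have hsplit : convolution (A i) (q i) e = ∑ j ∈ Finset.range (i + (e + 1)),
        if j < d + 1 then (j.descFactorial i : ∀ ω, F ω) * f j * q i (e + i - j) else 0 := by
      rw [Finset.sum_range_add, Finset.sum_eq_zero, zero_add, convolution]
      · refine Finset.sum_congr rfl fun t _ => ?_
        simp only [hA]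
        rw [add_comm i t, ite_mul, zero_mul]
        refine if_congr (by omega) ?_ rfl
        congr 2
        omega
      · intro j hj
        rw [Nat.descFactorial_of_lt (Finset.mem_range.1 hj)]
        simp
    rw [hsplit, ← Finset.sum_filter]
    simp only [ite_mul, zero_mul]
    rw [← Finset.sum_filter]
    refine Finset.sum_congr ?_ fun j _ => by ring
    ext j
    simp only [Finset.mem_filter, Finset.mem_range]
    omega
  have hconv : ∀ i ≤ m, Computes P K (2 ^ l * 1 + 200 * 2 ^ l * (l + 1) ^ 2)
      (firstEntries (2 ^ l) (convolution (A i) (q i))) := by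
    intro i hi
    have hAi : Computes P K (2 ^ l * 1) (firstEntries (2 ^ l) (A i)) := by
      refine .entries _ _ fun t _ => ?_
      by_cases ht : t + i ≤ d
      · simp only [hA, if_pos ht]
        exact .mul (hdesc i hi _ ht) (hf _ ht)
      · simp only [hA, if_neg ht]
        exact .of_mem h0
    refine hAi.trans' (computes_convolution h2 l (Or.inl h0) (Or.inl h1) (Or.inl hK2)
      Set.subset_union_right ?_ ?_)
    · rw [firstEntries_subset]
      exact fun t _ => Or.inl (hq i hi t)
    · intro j hj
      simp only [hA]
      rw [if_neg (by omega)]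
  refine ((Computes.iUnion_lt (m + 1) _ fun i hi => hconv i (by omega)).trans'
    (.entries (n := (m + 1) * (0 + 1)) N _ fun e he => ?_)).mono_cost ?_
  · rw [hrow]
    have := Computes.sum (P := P) (n := 0) (Finset.range (m + 1))
      (fun i => convolution (A i) (q i) e) (K := K ∪ {x | ∃ i < m + 1,
        x ∈ firstEntries (2 ^ l) (convolution (A i) (q i))}) (Or.inl h0)
      fun i hi => .of_mem (Or.inr ⟨i, Finset.mem_range.1 hi, e, by omega, rfl⟩)
    rwa [Finset.card_range] at this
  · calc (m + 1) * (2 ^ l * 1 + 200 * 2 ^ l * (l + 1) ^ 2) + N * ((m + 1) * (0 + 1))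
        ≤ (m + 1) * (2 ^ l * 1 + 200 * 2 ^ l * (l + 1) ^ 2) + 2 ^ l * ((m + 1) * (0 + 1)) := by
          gcongr
      _ = (m + 1) * 2 ^ l * (2 + 200 * (l + 1) ^ 2) := by ring
      _ ≤ (m + 1) * 2 ^ l * (300 * (l + 1) ^ 2) := by
          refine Nat.mul_le_mul_left _ ?_
          ring_nf
          omega

end ForwardSubst

/-! ### The algorithm -/

section Algorithm

/-- The coefficient of `x ^ a` in `Q̃`, from the input vector. -/
def inputFree {R : Type*} [Zero R] (D : ℕ) (x : ℕ → R) (a : ℕ) : R := if a ≤ D then x a else 0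

/-- The coefficient of `x ^ a` in `Qᵢ`, from the input vector. -/
def inputCoeff {R : Type*} [Zero R] (D : ℕ) (x : ℕ → R) (i a : ℕ) : R :=
  if a ≤ D then x ((i + 1) * (D + 1) + a) else 0

variable {Ω : Type*} {F : Ω → Type*} [∀ ω, Field (F ω)] {P : Set Ω} {K : Set (∀ ω, F ω)}

/-- For recurrences: each entry may use the earlier ones. -/
theorem Computes.chain {n : ℕ} (N : ℕ) (c : ℕ → ∀ ω, F ω)
    (h : ∀ i < N, Computes P (K ∪ firstEntries i c) n {c i}) :
    Computes P K (N * n) (firstEntries N c) := by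
  induction N with
  | zero => exact .done (by rw [firstEntries_subset]; intro i hi; omega)
  | succ N ih =>
    rw [Nat.succ_mul]
    refine ((ih fun i hi => h i (by omega)).trans (h N (by omega))).anti ?_
    rw [firstEntries_subset]
    intro i hi
    obtain h' | rfl : i < N ∨ i = N := by omega
    · exact Or.inl ⟨i, h', rfl⟩
    · exact Or.inr rfl

theorem computes_natCast (h0 : 0 ∈ K) (h1 : 1 ∈ K) (N : ℕ) :
    Computes P K (N * 1) (firstEntries N fun j => (j : ∀ ω, F ω)) := by
  refine .chain N _ fun i _ => ?_
  cases i with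
  | zero => exact .of_mem (Or.inl (by simpa using h0))
  | succ i =>
    simp only [Nat.cast_succ]
    exact .add (Or.inr ⟨i, by omega, rfl⟩) (Or.inl h1)

/-- One multiplication per value by the recurrence in `i`. Its factor `j - i` is truncated at zero,
which is harmless since the product vanishes there anyway. -/
theorem computes_descFactorial (h0 : 0 ∈ K) (h1 : 1 ∈ K) (m d : ℕ) :
    Computes P K ((d + 1) * (m + 2))
      {x | ∃ j < d + 1, x ∈ firstEntries (m + 1) fun i => (j.descFactorial i : ∀ ω, F ω)} := by
  refine ((computes_natCast h0 h1 (d + 1)).trans' (.iUnion_lt (n := (m + 1) * 1) (d + 1) _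
    fun j hj => .chain (m + 1) _ fun i _ => ?_)).mono_cost (by ring_nf; omega)
  cases i with
  | zero => exact .of_mem (Or.inl (Or.inl (by simpa using h1)))
  | succ i =>
    simp only [Nat.descFactorial_succ, Nat.cast_mul]
    exact .mul (Or.inl (Or.inr ⟨j - i, by omega, rfl⟩)) (Or.inr ⟨i, by omega, rfl⟩)

theorem rowCoeff_apply {m : ℕ} {q : ℕ → ℕ → ∀ ω, F ω} (ω : Ω) (e j : ℕ) :
    rowCoeff m q e j ω = rowCoeff m (fun i a => q i a ω) e j := by
  simp only [rowCoeff, Finset.sum_apply]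
  refine Finset.sum_congr rfl fun i _ => ?_
  split_ifs <;> simp

theorem triCoeff_apply {m σ : ℕ} {q : ℕ → ℕ → ∀ ω, F ω} (ω : Ω) (k j : ℕ) :
    triCoeff m σ q k j ω = triCoeff m σ (fun i a => q i a ω) k j := by
  simp only [triCoeff, shiftedCoeff, Finset.sum_apply]
  refine Finset.sum_congr rfl fun i _ => ?_
  split_ifs <;> simp

theorem sum_triCoeff_forwardSubst {m σ k : ℕ} {q : ℕ → ℕ → ∀ ω, F ω} {b g : ℕ → ∀ ω, F ω}
    {Z : Set ℕ} (hk : k ∉ Z) {ω : Ω} (hχ : triCoeff m σ q k k ω ≠ 0) :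
    b k ω + ∑ j ∈ Finset.range (k + 1), triCoeff m σ (fun i a => q i a ω) k j *
      forwardSubst (triCoeff m σ q) b g Z j ω = 0 := by
  have := congrFun (forwardSubst_of_notMem (T := triCoeff m σ q) (b := b) (g := g) hk) ω
  simp only [Pi.div_apply, Pi.neg_apply, Pi.add_apply, Finset.sum_apply, Pi.mul_apply] at this
  rw [Finset.sum_range_succ, this, ← triCoeff_apply]
  simp only [← triCoeff_apply]
  field_simp
  ring

/-- The algorithm after the zero pattern of the indicial polynomial has been determined. -/
theorem solves_of_pattern {m σ d D l : ℕ} {q : ℕ → ℕ → ∀ ω, F ω} {p : ℕ → ∀ ω, F ω}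
    {Z : Finset ℕ} (h2 : 1 < d → ∀ ω, (2 : F ω) ≠ 0) (hl : D + d + 1 ≤ 2 ^ l)
    (hσ : ∀ ω ∈ P, ∀ i ≤ m, ∀ a, a + m < σ + i → q i a ω = 0) (hσD : σ ≤ D + m)
    (hZ : ∀ ω ∈ P, ∀ k, k ∈ Z ↔ k ≤ d ∧ triCoeff m σ q k k ω = 0) (hZd : ∀ k ∈ Z, k ≤ d)
    (hZm : Z.card ≤ m) (h0 : 0 ∈ K) (h1 : 1 ∈ K) (hK2 : 2 ∈ K)
    (hdesc : ∀ i ≤ m, ∀ j ≤ d, (j.descFactorial i : ∀ ω, F ω) ∈ K)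
    (hχ : ∀ k ≤ d, triCoeff m σ q k k ∈ K) (hq : ∀ i ≤ m, ∀ a, q i a ∈ K) (hp : ∀ a, p a ∈ K) :
    Solves (fun ω => IsEchelonBasis d (D + d + 1) (fun e => p e ω)
      (rowCoeff m fun i a => q i a ω)) P K (700 * (m + 1) ^ 2 * 2 ^ l * (l + 1) ^ 3) := by
  classical
  -- Prescribing zeros beyond `d` makes the length `d + 1` irrelevant, so the substitution can run
  -- on a block of length `2 ^ l`.
  set Z' : Set ℕ := Z ∪ Set.Ioi d with hZ'
  have hZ'd {k : ℕ} (hk : k ∉ Z') : k ≤ d ∧ k ∉ Z := by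
    simp only [hZ', Set.mem_union, Finset.mem_coe, Set.mem_Ioi, not_or, not_lt] at hk
    exact hk.symm
  set b : ℕ → ∀ ω, F ω := fun k => if m ≤ k + σ then p (k + σ - m) else 0 with hb
  set f₀ := forwardSubst (triCoeff m σ q) b (fun _ => 0) Z' with hf₀
  set f : ℕ → ℕ → ∀ ω, F ω := fun z =>
    forwardSubst (triCoeff m σ q) (fun _ => 0) (fun k => if z = k then 1 else 0) Z' with hf
  have hf₀d : ∀ k, d < k → f₀ k = 0 := fun k hk => forwardSubst_of_mem (Or.inr hk)
  have hfd : ∀ z ∈ Z, ∀ k, d < k → f z k = 0 := by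
    intro z hz k hk
    have := hZd z hz
    rw [hf]
    simp only
    rw [forwardSubst_of_mem (Or.inr hk), if_neg (by omega)]
  have hχ' : ∀ k, k ∉ Z' → ∀ ω ∈ P, triCoeff m σ q k k ω ≠ 0 := by
    intro k hk ω hω h
    obtain ⟨hkd, hkZ⟩ := hZ'd hk
    exact hkZ ((hZ ω hω k).2 ⟨hkd, h⟩)
  have hqs : ∀ i ≤ m, firstEntries (2 ^ l) (shiftedCoeff m σ q i) ⊆ K := by
    intro i hi
    rw [firstEntries_subset]
    intro t _
    rw [shiftedCoeff]
    split_ifs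
    · exact hq i hi _
    · exact h0
  have hc₀ := computes_forwardSubst_block (P := P) (L := l) h2 hχ' hf₀d l 0 K le_rfl h0 h1 hK2
    (fun _ _ => h0) (fun k hk => hχ k (hZ'd hk).1) hdesc hqs (by
      intro t _
      rw [Finset.sum_range_zero, add_zero]
      simp only [hb]
      split_ifs
      · exact hp _
      · exact h0)
  have hc : ∀ z ∈ Z, Computes P K ((m + 1) * 2 ^ l * (300 * (l + 1) ^ 3))
      (blockEntries 0 (2 ^ l) (f z)) := fun z hz =>
    computes_forwardSubst_block (P := P) (L := l) h2 hχ' (hfd z hz) l 0 K le_rfl h0 h1 hK2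
      (by intro k _; split_ifs <;> assumption)
      (fun k hk => hχ k (hZ'd hk).1) hdesc hqs (by simpa using fun _ _ => h0)
  have hcf := hc₀.union (Computes.biUnion Z _ _ hc)
  set K' := K ∪ (blockEntries 0 (2 ^ l) f₀ ∪ ⋃ z ∈ Z, blockEntries 0 (2 ^ l) (f z)) with hK'
  have hf₀K : ∀ j ≤ d, f₀ j ∈ K' := fun j hj => Or.inr (Or.inl ⟨j, by omega, by simp⟩)
  have hfK : ∀ z ∈ Z, ∀ j ≤ d, f z j ∈ K' := fun z hz j hj =>
    Or.inr (Or.inr (Set.mem_biUnion (x := z) hz ⟨j, by omega, by simp⟩))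
  have hrow (v : ℕ → ∀ ω, F ω) (hv : ∀ j ≤ d, v j ∈ K') :=
    computes_rows (P := P) h2 hl (Or.inl h0) (Or.inl h1) (Or.inl hK2)
      (fun i hi j hj => Or.inl (hdesc i hi j hj)) (fun i hi a => Or.inl (hq i hi a)) hv
  have hg₀ := (hrow f₀ hf₀K).trans' (.entries (n := 1) (D + d + 1)
    (fun e => p e + ∑ j ∈ Finset.range (d + 1), rowCoeff m q e j * f₀ j)
    fun e he => .add (Or.inl (Or.inl (hp e))) (Or.inr ⟨e, he, rfl⟩))
  have hg := hg₀.union (Computes.biUnion Z _ _ fun z hz => hrow (f z) (hfK z hz))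
  have hrowω (ω : Ω) : (rowCoeff m fun i a => q i a ω) = fun e j => rowCoeff m q e j ω := by
    funext e j
    rw [rowCoeff_apply]
  have hZω : ∀ ω ∈ P, ∀ k, k ≤ d → k ∉ Z → k ∉ Z' ∧ triCoeff m σ q k k ω ≠ 0 := by
    intro ω hω k hk hkZ
    have : k ∉ Z' := by
      rintro (h | h)
      · exact hkZ h
      · exact absurd (Set.mem_Ioi.1 h) (by omega)
    exact ⟨this, hχ' k this ω hω⟩
  simp only [hrowω]
  refine (Solves.of_computes hcf (Solves.of_computes hg ((solves_of_isParam (by omega) Z.card Z P _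
    f₀ (fun e => p e + ∑ j ∈ Finset.range (d + 1), rowCoeff m q e j * f₀ j) f
    (fun z e => ∑ j ∈ Finset.range (d + 1), rowCoeff m q e j * f z j) rfl
    (c := p) (B := rowCoeff m q) (N := D + d + 1)
    ?_ ?_ ?_ (fun j hj => Or.inl (hf₀K j hj)) (fun e he => Or.inr (Or.inl ⟨e, he, rfl⟩))
    (fun z hz j hj => Or.inl (hfK z hz j hj))
    (fun z hz e he => Or.inr (Or.inr (Set.mem_biUnion (x := z) hz ⟨e, he, rfl⟩))))))).mono_cost ?_
  · intro ω hω
    have := isParam_of_triangular (D := D) (d := d) (p := fun a => p a ω) (f₀ := fun j => f₀ j ω)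
      (f := fun z j => f z j ω) (hσ ω hω) hσD (Z := Z)
      (fun k => by rw [hZ ω hω k, triCoeff_apply])
      (fun k hk => congrFun (forwardSubst_of_mem (Or.inl hk)) ω)
      (fun z _ k hk => by
        simp only [hf]
        rw [forwardSubst_of_mem (Or.inl hk)]
        split_ifs <;> rfl)
      (fun k hk hkZ => by
        have := sum_triCoeff_forwardSubst (b := b) (g := fun _ => 0) (hZω ω hω k hk hkZ).1
          (hZω ω hω k hk hkZ).2
        simp only [hb] at this
        refine Eq.trans ?_ this
        congr 1
        split_ifs <;> rfl)
      (fun z _ k hk hkZ => by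
        have := sum_triCoeff_forwardSubst (b := fun _ => 0) (g := fun k => if z = k then 1 else 0)
          (hZω ω hω k hk hkZ).1 (hZω ω hω k hk hkZ).2
        rwa [Pi.zero_apply, zero_add] at this)
    rwa [hrowω] at this
  · intro ω _ e _
    simp
  · intro ω _ z _ e _
    simp
  · rw [Finset.sum_const, Finset.sum_const, smul_eq_mul, smul_eq_mul]
    -- There are `z + 1 ≤ m + 1` substitutions, as many evaluations of all rows, the addition of the
    -- free term, and the elimination.
    set z := Z.card
    have hB : (m + 1) * 2 ^ l * (300 * (l + 1) ^ 2) ≤ (m + 1) * 2 ^ l * (300 * (l + 1) ^ 3) := by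
      gcongr <;> omega
    have hz : z + 1 ≤ m + 1 := by omega
    have hl1 : 1 ≤ (l + 1) ^ 3 := Nat.one_le_pow _ _ (by omega)
    calc _ = (z + 1) * ((m + 1) * 2 ^ l * (300 * (l + 1) ^ 3)) +
          ((z + 1) * ((m + 1) * 2 ^ l * (300 * (l + 1) ^ 2)) + (D + d + 1) +
            6 * (D + d + 1) * (z + 1) ^ 2) := by ring
      _ ≤ (m + 1) * ((m + 1) * 2 ^ l * (300 * (l + 1) ^ 3)) +
          ((m + 1) * ((m + 1) * 2 ^ l * (300 * (l + 1) ^ 3)) + 2 ^ l + 6 * 2 ^ l * (m + 1) ^ 2) := by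
        gcongr
      _ = 600 * ((m + 1) ^ 2 * 2 ^ l * (l + 1) ^ 3) + (1 * (1 * 2 ^ l * 1) +
          6 * ((m + 1) ^ 2 * 2 ^ l * 1)) := by ring
      _ ≤ 600 * ((m + 1) ^ 2 * 2 ^ l * (l + 1) ^ 3) + (1 * ((m + 1) ^ 2 * 2 ^ l * (l + 1) ^ 3) +
          6 * ((m + 1) ^ 2 * 2 ^ l * (l + 1) ^ 3)) := by
        gcongr
        exact Nat.one_le_pow _ _ (by omega)
      _ ≤ 700 * (m + 1) ^ 2 * 2 ^ l * (l + 1) ^ 3 := by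
        have : 700 * (m + 1) ^ 2 * 2 ^ l * (l + 1) ^ 3 =
          700 * ((m + 1) ^ 2 * 2 ^ l * (l + 1) ^ 3) := by ring
        omega

/-- Zero tests on all coefficients of the `Qᵢ` reveal the shift `σ`; zero tests on the diagonal
entries reveal the free indices, of which there are at most `m`. On each resulting branch the
combinatorial data are constant, so the remaining computation can be arranged uniformly in `ω`. -/
theorem solves_system {m d D l : ℕ} {x : ℕ → ∀ ω, F ω} (hd : ∀ ω, (d.factorial : F ω) ≠ 0)
    (hx : ∀ ω, ∃ i < (m + 2) * (D + 1), x i ω ≠ 0) (hl : D + d + 1 ≤ 2 ^ l) :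
    Solves (fun ω => IsEchelonBasis d (D + d + 1) (inputFree D fun i => x i ω)
      (rowCoeff m (inputCoeff D fun i => x i ω))) Set.univ
      (firstEntries ((m + 2) * (D + 1)) x) (720 * (m + 1) ^ 2 * 2 ^ l * (l + 1) ^ 3) := by
  classical
  have h2 : 1 < d → ∀ ω, (2 : F ω) ≠ 0 := by
    intro h ω h0
    apply hd ω
    obtain ⟨c, hc⟩ := Nat.dvd_factorial two_pos h
    rw [hc, Nat.cast_mul, Nat.cast_ofNat, h0, zero_mul]
  set K₀ := firstEntries ((m + 2) * (D + 1)) x with hK₀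
  set q := inputCoeff D x with hq
  set p := inputFree D x with hp
  have hqω (ω : Ω) : (inputCoeff D fun i => x i ω) = fun i a => q i a ω := by
    funext i a
    simp only [hq, inputCoeff]
    split_ifs <;> rfl
  have hpω (ω : Ω) : (inputFree D fun i => x i ω) = fun a => p a ω := by
    funext a
    simp only [hp, inputFree]
    split_ifs <;> rfl
  simp only [hqω, hpω]
  have hqK {i a : ℕ} (hi : i ≤ m) (ha : a ≤ D) : q i a ∈ K₀ := by
    simp only [hq, inputCoeff, if_pos ha]
    refine ⟨(i + 1) * (D + 1) + a, ?_, rfl⟩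
    nlinarith
  have hpK {a : ℕ} (ha : a ≤ D) : p a ∈ K₀ := by
    simp only [hp, inputFree, if_pos ha]
    refine ⟨a, ?_, rfl⟩
    nlinarith
  set s := Finset.range (m + 1) ×ˢ Finset.range (D + 1) with hs
  have hmem {i a : ℕ} : (i, a) ∈ s ↔ i ≤ m ∧ a ≤ D := by
    simp [hs]
  have hB (a : ℕ) (ha : a ≤ 2 ^ l) : a * (m + 1) ≤ (m + 1) ^ 2 * 2 ^ l * (l + 1) ^ 3 := by
    calc a * (m + 1) = 1 * (m + 1) * a * 1 := by ring
      _ ≤ (m + 1) * (m + 1) * 2 ^ l * (l + 1) ^ 3 := by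
        gcongr
        · omega
        · exact Nat.one_le_pow _ _ (by omega)
      _ = _ := by ring
  refine (Solves.testAll (n := 711 * (m + 1) ^ 2 * 2 ^ l * (l + 1) ^ 3) s (fun ia => q ia.1 ia.2)
    (fun ia h => hqK (hmem.1 h).1 (hmem.1 h).2) fun Z₁ => ?_).mono_cost ?_
  swap
  · have := hB (D + 1) (by omega)
    rw [hs, Finset.card_product, Finset.card_range, Finset.card_range, mul_comm]
    simp only [mul_assoc] at *
    omega
  set P₁ := Set.univ ∩ {ω | ∀ ia ∈ s, q ia.1 ia.2 ω = 0 ↔ ia ∈ Z₁} with hP₁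
  -- If every `Qᵢ` is zero, some coefficient of `Q̃` is not, and the corresponding row is
  -- contradictory.
  by_cases hall : ∀ ia ∈ s, ia ∈ Z₁
  · refine .output [] [] (by simp) fun ω hω => Or.inl ⟨rfl, fun f hf => ?_⟩
    have hq0 : ∀ i ≤ m, ∀ a, q i a ω = 0 := by
      intro i hi a
      by_cases ha : a ≤ D
      · exact (hω.2 _ (hmem.2 ⟨hi, ha⟩)).2 (hall _ (hmem.2 ⟨hi, ha⟩))
      · simp [hq, inputCoeff, ha]
    have hrow0 (e j : ℕ) : rowCoeff m (fun i a => q i a ω) e j = 0 := by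
      refine Finset.sum_eq_zero fun i hi => ?_
      beta_reduce
      rw [hq0 i (Nat.lt_succ_iff.1 (Finset.mem_range.1 hi)), zero_mul, ite_self]
    obtain ⟨i, hi, hne⟩ := hx ω
    have hmod := Nat.mod_add_div i (D + 1)
    have hlt := Nat.mod_lt i (by omega : 0 < D + 1)
    rcases hdiv : i / (D + 1) with - | k
    · rw [hdiv, mul_zero, add_zero] at hmod
      have := hf i (by omega)
      simp only [hrow0, zero_mul, Finset.sum_const_zero, add_zero, hp, inputFree] at this
      rw [if_pos (by omega)] at this
      exact hne this
    · have hk : k ≤ m := by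
        have := Nat.div_lt_of_lt_mul (by rwa [mul_comm] at hi : i < (D + 1) * (m + 2))
        omega
      have := hq0 k hk (i % (D + 1))
      simp only [hq, inputCoeff] at this
      rw [if_pos (by omega)] at this
      apply hne
      rw [← this]
      congr 1
      rw [hdiv] at hmod
      nlinarith
  push Not at hall
  -- `σ` is the minimum of `a + m - i` over the nonzero coefficients; the minimizing pair is what
  -- makes the indicial polynomial nonzero.
  obtain ⟨⟨i₀, a₀⟩, hia, hmin⟩ := (s.filter fun ia => ia ∉ Z₁).exists_min_image
    (fun ia => ia.2 + m - ia.1) (by obtain ⟨ia, h, h'⟩ := hall; exact ⟨ia, by simp [h, h']⟩)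
  simp only [Finset.mem_filter, hmem] at hia
  set σ := a₀ + m - i₀ with hσ
  have hσD : σ ≤ D + m := by omega
  have hσ' : ∀ ω ∈ P₁, ∀ i ≤ m, ∀ a, a + m < σ + i → q i a ω = 0 := by
    intro ω hω i hi a ha
    by_cases haD : a ≤ D
    · rw [hω.2 _ (hmem.2 ⟨hi, haD⟩)]
      by_contra hZ
      have := hmin (i, a) (by simp [hmem, hi, haD, hZ])
      simp only at this
      omega
    · simp [hq, inputCoeff, haD]
  have hne : ∀ ω ∈ P₁, ∃ i ≤ m, shiftedCoeff m σ (fun i a => q i a ω) i 0 ≠ 0 := by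
    intro ω hω
    refine ⟨i₀, hia.1.1, ?_⟩
    rw [shiftedCoeff, if_pos (by omega)]
    have : 0 + i₀ + σ - m = a₀ := by omega
    rw [this]
    exact fun h => hia.2 ((hω.2 _ (hmem.2 hia.1)).1 h)
  have hconst : Computes P₁ K₀ (1 + 1 + 1) ({0} ∪ ({1} ∪ {2})) := by
    have h01 : Computes P₁ K₀ (1 + 1) ({0} ∪ {1}) := Computes.zero.union .one
    refine (h01.trans (Computes.add (x := 1) (y := 1) (by simp) (by simp))).anti ?_
    rw [one_add_one_eq_two, Set.union_assoc]
  have hdesc : Computes P₁ (K₀ ∪ ({0} ∪ ({1} ∪ {2}))) ((d + 1) * (m + 2))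
      {x | ∃ j < d + 1, x ∈ firstEntries (m + 1) fun i => (j.descFactorial i : ∀ ω, F ω)} :=
    computes_descFactorial (by simp) (by simp) m d
  set K₁ := K₀ ∪ ({0} ∪ ({1} ∪ {2})) with hK₁
  set K₂ := K₁ ∪ {x | ∃ j < d + 1,
    x ∈ firstEntries (m + 1) fun i => (j.descFactorial i : ∀ ω, F ω)} with hK₂
  have h0 : 0 ∈ K₂ := by simp [hK₂, hK₁]
  have hq2 : ∀ i ≤ m, ∀ a, q i a ∈ K₂ := by
    intro i hi a
    by_cases ha : a ≤ D
    · exact Or.inl (Or.inl (hqK hi ha))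
    · have : q i a = 0 := by simp [hq, inputCoeff, ha]
      rwa [this]
  have hp2 : ∀ a, p a ∈ K₂ := by
    intro a
    by_cases ha : a ≤ D
    · exact Or.inl (Or.inl (hpK ha))
    · have : p a = 0 := by simp [hp, inputFree, ha]
      rwa [this]
  have hdesc2 : ∀ i ≤ m, ∀ j ≤ d, (j.descFactorial i : ∀ ω, F ω) ∈ K₂ := fun i hi j hj =>
    Or.inr ⟨j, by omega, i, by omega, rfl⟩
  have hχ : Computes P₁ K₂ ((d + 1) * ((m + 1) * (1 + 1)))
      (firstEntries (d + 1) fun k => triCoeff m σ q k k) := by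
    refine .entries _ _ fun k hk => ?_
    have := Computes.sum (P := P₁) (n := 1) (K := K₂) (Finset.range (m + 1))
      (fun i => shiftedCoeff m σ q i (k - k) * (k.descFactorial i : ∀ ω, F ω)) h0 fun i hi => by
        rw [Finset.mem_range] at hi
        refine .mul ?_ (hdesc2 i (by omega) k (by omega))
        rw [shiftedCoeff]
        split_ifs
        · exact hq2 i (by omega) _
        · exact h0
    rwa [Finset.card_range] at this
  refine (Solves.of_computes hconst (.of_computes hdesc (.of_computes hχ
    (.testAll (n := 700 * (m + 1) ^ 2 * 2 ^ l * (l + 1) ^ 3) (Finset.range (d + 1))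
    (fun k => triCoeff m σ q k k)
    (fun k hk => Or.inr ⟨k, Finset.mem_range.1 hk, rfl⟩) fun Z₂ => ?_)))).mono_cost ?_
  · set P₂ := P₁ ∩ {ω | ∀ k ∈ Finset.range (d + 1), triCoeff m σ q k k ω = 0 ↔ k ∈ Z₂} with hP₂
    -- A zero pattern that never occurs needs no work; otherwise one witness `ω₀` bounds the number
    -- of zeros in the pattern.
    rcases P₂.eq_empty_or_nonempty with hempty | ⟨ω₀, hω₀⟩
    · exact .of_empty hempty
    have hZ : ∀ ω ∈ P₂, ∀ k, k ∈ (Finset.range (d + 1)).filter (· ∈ Z₂) ↔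
        k ≤ d ∧ triCoeff m σ q k k ω = 0 := by
      intro ω hω k
      rw [Finset.mem_filter, Finset.mem_range, Nat.lt_succ_iff]
      exact and_congr_right fun hk => (hω.2 k (Finset.mem_range.2 (by omega))).symm
    refine (solves_of_pattern (σ := σ) (q := q) (p := p) (P := P₂)
      (Z := (Finset.range (d + 1)).filter (· ∈ Z₂)) h2 hl
      (fun ω hω => hσ' ω hω.1) hσD hZ (fun k hk => ((hZ ω₀ hω₀ k).1 hk).1) ?_ (Or.inl h0)
      (Or.inl (Or.inl (Or.inr (by simp)))) (Or.inl (Or.inl (Or.inr (by simp))))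
      (fun i hi j hj => Or.inl (hdesc2 i hi j hj)) (fun k hk => Or.inr ⟨k, by omega, rfl⟩)
      (fun i hi a => Or.inl (hq2 i hi a)) fun a => Or.inl (hp2 a))
    refine card_le_of_sum_descFactorial_eq_zero (hd ω₀) (hne ω₀ hω₀.1) fun k hk => ?_
    obtain ⟨hkd, hk⟩ := (hZ ω₀ hω₀ k).1 hk
    rw [triCoeff_apply, triCoeff] at hk
    simp only [Nat.sub_self] at hk
    exact ⟨hkd, hk⟩
  · rw [Finset.card_range]
    have e1 := hB (d + 1) (by omega)
    have e2 := hB 1 (by omega)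
    have : (d + 1) * (m + 2) ≤ 2 * ((d + 1) * (m + 1)) := by nlinarith
    have : (d + 1) * ((m + 1) * (1 + 1)) = 2 * ((d + 1) * (m + 1)) := by ring
    have : d + 1 ≤ (d + 1) * (m + 1) := Nat.le_mul_of_pos_right _ (by omega)
    simp only [mul_assoc] at *
    omega

end Algorithm

/-! ### Certificates for the unsolvability of systems of equations in all fields -/

/-- Variables of equations. -/
abbrev EqVar := ℕ × ℕ

/-- A polynomial with coefficients in `ℕ`, as a list of monomials. -/
abbrev NatPoly := List (List EqVar)

/-- An equation between polynomials with coefficients in `ℕ`. -/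
abbrev PolyEqn := NatPoly × NatPoly

namespace NatPoly

section Eval

variable {R S : Type*} [CommSemiring R] [CommSemiring S]

/-- The value of a polynomial at a point. -/
def eval (v : EqVar → R) (p : NatPoly) : R := (p.map fun l => (l.map v).prod).sum

/-- The product of two polynomials. -/
def mul (p q : NatPoly) : NatPoly := p.flatMap fun a => q.map fun b => a ++ b

/-- The polynomial as a multiset of monomials. -/
def toMultiset (p : NatPoly) : Multiset (Multiset EqVar) := Multiset.ofList (p.map Multiset.ofList)

/-- Two lists of monomials represent the same polynomial. -/
def Same (p q : NatPoly) : Prop := p.toMultiset = q.toMultiset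

@[simp] theorem eval_nil (v : EqVar → R) : eval v [] = 0 := rfl

@[simp] theorem eval_cons (v : EqVar → R) (l : List EqVar) (p : NatPoly) :
    eval v (l :: p) = (l.map v).prod + eval v p := rfl

@[simp] theorem eval_append (v : EqVar → R) (p q : NatPoly) :
    eval v (p ++ q) = eval v p + eval v q := by
  simp [eval]

theorem eval_map_append (v : EqVar → R) (a : List EqVar) (q : NatPoly) :
    eval v (q.map fun b => a ++ b) = (a.map v).prod * eval v q := by
  simp [eval, Function.comp_def, List.sum_map_mul_left]

theorem eval_map_cons (v : EqVar → R) (a : EqVar) (q : NatPoly) :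
    eval v (q.map fun b => a :: b) = v a * eval v q := by
  simpa using eval_map_append v [a] q

@[simp] theorem eval_mul (v : EqVar → R) (p q : NatPoly) :
    eval v (mul p q) = eval v p * eval v q := by
  induction p with
  | nil => simp [mul]
  | cons a p ih =>
    rw [eval_cons, add_mul, ← ih, ← eval_map_append, ← eval_append]
    rfl

theorem eval_flatMap {α : Type*} (v : EqVar → R) (s : List α) (f : α → NatPoly) :
    eval v (s.flatMap f) = (s.map fun a => eval v (f a)).sum := by
  induction s with
  | nil => rfl
  | cons a s ih => simp [ih]

theorem eval_replicate (v : EqVar → R) (n : ℕ) (l : List EqVar) :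
    eval v (List.replicate n l) = n * (l.map v).prod := by
  simp [eval]

theorem map_eval (φ : R →+* S) (v : EqVar → R) (p : NatPoly) :
    φ (eval v p) = eval (fun i => φ (v i)) p := by
  induction p with
  | nil => simp
  | cons l p ih => simp [ih, map_list_prod, Function.comp_def]

theorem Same.eval_eq {p q : NatPoly} (h : Same p q) (v : EqVar → R) : eval v p = eval v q := by
  have key (p : NatPoly) : eval v p = (p.toMultiset.map fun s => (s.map v).prod).sum := by
    simp [eval, toMultiset, Function.comp_def, Multiset.map_coe, Multiset.sum_coe]
  rw [key, key, h]

end Eval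

/-! ### Comparison with polynomials over `ℤ`. -/

section Generic

theorem prod_map_X (l : List EqVar) : (l.map (MvPolynomial.X : EqVar → MvPolynomial EqVar ℤ)).prod =
    MvPolynomial.monomial (Multiset.toFinsupp (l : Multiset EqVar)) 1 := by
  induction l with
  | nil => rfl
  | cons a l ih =>
    rw [List.map_cons, List.prod_cons, ih, ← Multiset.cons_coe, ← Multiset.singleton_add, map_add,
      Multiset.toFinsupp_singleton, MvPolynomial.X, MvPolynomial.monomial_mul, one_mul]

/-- Evaluation at the variables remembers the multiplicity of each monomial, because `ℕ` embeds in
`ℤ`. Hence an identity in the integral polynomial ring can be checked on lists. -/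
theorem coeff_eval_X (p : NatPoly) (s : Multiset EqVar) :
    (eval (MvPolynomial.X : EqVar → MvPolynomial EqVar ℤ) p).coeff (Multiset.toFinsupp s) =
      (p.toMultiset.count s : ℤ) := by
  induction p with
  | nil => simp [toMultiset]
  | cons l p ih =>
    rw [eval_cons, MvPolynomial.coeff_add, ih, prod_map_X, MvPolynomial.coeff_monomial]
    have : toMultiset (l :: p) = (l : Multiset EqVar) ::ₘ toMultiset p := rfl
    rw [this, Multiset.count_cons, Nat.cast_add, add_comm]
    congr 1
    simp only [EmbeddingLike.apply_eq_iff_eq]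
    by_cases h : (l : Multiset EqVar) = s
    · simp [h]
    · simp [h, Ne.symm h]

theorem same_of_eval_X_eq {p q : NatPoly}
    (h : eval (MvPolynomial.X : EqVar → MvPolynomial EqVar ℤ) p = eval MvPolynomial.X q) : Same p q := by
  refine Multiset.ext.2 fun s => ?_
  have := coeff_eval_X p s
  rw [h, coeff_eval_X] at this
  exact_mod_cast this.symm

/-- Integer coefficients are split into positive and negative parts, so that certificates can be
stored with coefficients in `ℕ`. -/
theorem exists_eval_X_sub (P : MvPolynomial EqVar ℤ) :
    ∃ g h : NatPoly, P = eval MvPolynomial.X g - eval MvPolynomial.X h := by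
  induction P using MvPolynomial.induction_on with
  | C a =>
    refine ⟨List.replicate a.toNat [], List.replicate (-a).toNat [], ?_⟩
    rw [eval_replicate, eval_replicate]
    simp only [List.map_nil, List.prod_nil, mul_one]
    have : (((a.toNat : ℤ) - ((-a).toNat : ℤ) : ℤ) : MvPolynomial EqVar ℤ) = MvPolynomial.C a := by
      rw [Int.toNat_sub_toNat_neg]
      simp
    rw [← this]
    push_cast
    rfl
  | add p q hp hq =>
    obtain ⟨g, h, rfl⟩ := hp
    obtain ⟨g', h', rfl⟩ := hq
    exact ⟨g ++ g', h ++ h', by simp; ring⟩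
  | mul_X p n hp =>
    obtain ⟨g, h, rfl⟩ := hp
    exact ⟨mul g [[n]], mul h [[n]], by simp; ring⟩

end Generic

end NatPoly

namespace PolyEqn

/-- An equation holds at a point. -/
def Holds {R : Type*} [CommSemiring R] (v : EqVar → R) (e : PolyEqn) : Prop :=
  NatPoly.eval v e.1 = NatPoly.eval v e.2

end PolyEqn

/-- The coefficients of a representation of `1` by the equations of a system: a triple
`(k, g, h)` stands for the equation with number `k` times `g - h`. -/
abbrev UnitCert := List (ℕ × NatPoly × NatPoly)

namespace UnitCert

open NatPoly

/-- One of the two sides of the linear combination of equations given by a certificate. -/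
def left (s : List PolyEqn) (c : UnitCert) : NatPoly :=
  c.flatMap fun t => mul t.2.1 (s.getD t.1 ([], [])).1 ++ mul t.2.2 (s.getD t.1 ([], [])).2

/-- One of the two sides of the linear combination of equations given by a certificate. -/
def right (s : List PolyEqn) (c : UnitCert) : NatPoly :=
  c.flatMap fun t => mul t.2.1 (s.getD t.1 ([], [])).2 ++ mul t.2.2 (s.getD t.1 ([], [])).1

/-- The certificate shows that `s` has no solution. -/
def Valid (s : List PolyEqn) (c : UnitCert) : Prop := Same (left s c) ([] :: right s c)

variable {s : List PolyEqn} {c : UnitCert}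

/-- At a common solution both sides of the combination agree, while the certificate says that they
differ by `1`. The identity has coefficients in `ℕ`, so it applies in every characteristic. -/
theorem Valid.not_forall_holds {F : Type*} [Field F] (h : Valid s c) (v : EqVar → F) :
    ¬ ∀ e ∈ s, e.Holds v := by
  intro hs
  have h1 := h.eval_eq v
  have h2 : NatPoly.eval v (left s c) = NatPoly.eval v (right s c) := by
    rw [left, right, eval_flatMap, eval_flatMap]
    congr 1
    refine List.map_congr_left fun t _ => ?_
    have : (s.getD t.1 ([], [])).Holds v := by
      by_cases ht : t.1 < s.length
      · rw [List.getD_eq_getElem _ _ ht]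
        exact hs _ (List.getElem_mem ht)
      -- A number outside the list refers to the trivial equation `0 = 0`.
      · rw [List.getD_eq_default _ _ (by omega)]
        rfl
    rw [PolyEqn.Holds] at this
    simp only [eval_append, NatPoly.eval_mul, this]
  rw [h2, eval_cons] at h1
  simp at h1

/-- The linear combination of the equations in `MvPolynomial EqVar ℤ`. -/
noncomputable def combination (s : List PolyEqn) (c : UnitCert) : MvPolynomial EqVar ℤ :=
  NatPoly.eval MvPolynomial.X (left s c) - NatPoly.eval MvPolynomial.X (right s c)

theorem combination_cons (t : ℕ × NatPoly × NatPoly) :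
    combination s (t :: c) =
      (NatPoly.eval MvPolynomial.X t.2.1 - NatPoly.eval MvPolynomial.X t.2.2) *
      (NatPoly.eval MvPolynomial.X (s.getD t.1 ([], [])).1 -
        NatPoly.eval MvPolynomial.X (s.getD t.1 ([], [])).2) + combination s c := by
  simp only [combination, left, right, List.flatMap_cons, eval_append, NatPoly.eval_mul]
  ring

theorem exists_combination_eq {P : MvPolynomial EqVar ℤ}
    (hP : P ∈ Ideal.span {P | ∃ e ∈ s, P = NatPoly.eval MvPolynomial.X e.1 -
      NatPoly.eval MvPolynomial.X e.2}) : ∃ c, combination s c = P := by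
  refine Submodule.span_induction (p := fun P _ => ∃ c, combination s c = P) ?_ ?_ ?_ ?_ hP
  · rintro _ ⟨e, he, rfl⟩
    obtain ⟨k, hk, rfl⟩ := List.getElem_of_mem he
    -- The list `[[]]` is the constant polynomial `1`, consisting of one empty monomial.
    refine ⟨[(k, [[]], [])], ?_⟩
    rw [combination_cons]
    simp [combination, left, right, List.getElem?_eq_getElem hk]
  · exact ⟨[], by simp [combination, left, right]⟩
  · rintro _ _ _ _ ⟨c, rfl⟩ ⟨c', rfl⟩
    refine ⟨c ++ c', ?_⟩
    simp only [combination, left, right, List.flatMap_append, eval_append]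
    ring
  · rintro a _ _ ⟨c, rfl⟩
    obtain ⟨G, H, rfl⟩ := exists_eval_X_sub a
    refine ⟨c.map fun t => (t.1, mul G t.2.1 ++ mul H t.2.2, mul G t.2.2 ++ mul H t.2.1), ?_⟩
    clear * -
    induction c with
    | nil => simp [combination, left, right]
    | cons t c ih =>
      rw [List.map_cons, combination_cons, ih, combination_cons]
      simp only [eval_append, NatPoly.eval_mul, smul_eq_mul]
      ring

/-- A system of equations without solutions in any field has a certificate. -/
theorem exists_valid
    (h : ∀ (F : Type) [Field F] (v : EqVar → F), ¬ ∀ e ∈ s, e.Holds v) : ∃ c, Valid s c := by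
  set I : Ideal (MvPolynomial EqVar ℤ) := Ideal.span {P | ∃ e ∈ s,
    P = NatPoly.eval MvPolynomial.X e.1 - NatPoly.eval MvPolynomial.X e.2} with hI
  have htop : I = ⊤ := by
    -- If the ideal were proper, the variables would solve the system in the residue field of a
    -- maximal ideal containing it.
    by_contra hne
    obtain ⟨M, hM, hIM⟩ := Ideal.exists_le_maximal I hne
    let _ := Ideal.Quotient.field M
    refine h (MvPolynomial EqVar ℤ ⧸ M) (fun i => Ideal.Quotient.mk M (MvPolynomial.X i)) ?_
    intro e he
    rw [PolyEqn.Holds, ← map_eval, ← map_eval, ← sub_eq_zero, ← map_sub,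
      Ideal.Quotient.eq_zero_iff_mem]
    exact hIM (Ideal.subset_span ⟨e, he, rfl⟩)
  obtain ⟨c, hc⟩ := exists_combination_eq (s := s) (P := 1)
    (by rw [← hI, htop]; exact Submodule.mem_top)
  refine ⟨c, same_of_eval_X_eq ?_⟩
  rw [combination, sub_eq_iff_eq_add] at hc
  simpa using hc

end UnitCert

/-! ### Computability of the checks -/

section Primrec

variable {α β : Type*} [Primcodable α] [Primcodable β]

theorem primrec_list_count [DecidableEq α] : Primrec₂ fun (l : List α) (a : α) => l.count a := by
  have h : PrimrecRel fun a b : α => a = b := Primrec.eq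
  refine (Primrec.list_length.comp₂ h.listFilter).of_eq fun l a => ?_
  rw [List.count_eq_countP, List.countP_eq_length_filter]
  rfl

/-- Equality of multiplicities needs to be tested only for the finitely many elements occurring in
one of the lists. -/
theorem primrecRel_list_perm [DecidableEq α] : PrimrecRel fun l l' : List α => l.Perm l' := by
  have h : PrimrecRel fun (a : α) (b : List α × List α) => b.1.count a = b.2.count a :=
    Primrec.eq.comp (primrec_list_count.comp (Primrec.fst.comp Primrec.snd) Primrec.fst)
      (primrec_list_count.comp (Primrec.snd.comp Primrec.snd) Primrec.fst)
  refine (h.forall_mem_list.comp (Primrec.list_append.comp Primrec.fst Primrec.snd)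
    (Primrec.fst.pair Primrec.snd)).of_eq fun b => ?_
  beta_reduce
  rw [List.perm_iff_count]
  refine ⟨fun h a => ?_, fun h a _ => h a⟩
  by_cases ha : a ∈ b.1 ++ b.2
  · exact h a ha
  · rw [List.mem_append, not_or] at ha
    rw [List.count_eq_zero_of_not_mem ha.1, List.count_eq_zero_of_not_mem ha.2]

/-- Monomials are counted up to reordering of their factors; again only monomials occurring in one
of the lists matter. -/
theorem primrecRel_natPoly_same : PrimrecRel NatPoly.Same := by
  classical
  have h : PrimrecRel fun (a b : List EqVar) => a.Perm b := primrecRel_list_perm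
  have hcount : Primrec₂ fun (p : NatPoly) (a : List EqVar) =>
      (p.filter fun b => b.Perm a).length := Primrec.list_length.comp₂ h.listFilter
  have hrel : PrimrecRel fun (a : List EqVar) (b : NatPoly × NatPoly) =>
      (b.1.filter fun b => b.Perm a).length = (b.2.filter fun b => b.Perm a).length :=
    Primrec.eq.comp (hcount.comp (Primrec.fst.comp Primrec.snd) Primrec.fst)
      (hcount.comp (Primrec.snd.comp Primrec.snd) Primrec.fst)
  refine (hrel.forall_mem_list.comp (Primrec.list_append.comp Primrec.fst Primrec.snd)
    (Primrec.fst.pair Primrec.snd)).of_eq fun b => ?_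
  have key (p : NatPoly) (a : List EqVar) :
      (p.filter fun b => b.Perm a).length = p.toMultiset.count (a : Multiset EqVar) := by
    rw [NatPoly.toMultiset, Multiset.coe_count, List.count_eq_countP, List.countP_map,
      List.countP_eq_length_filter]
    congr 1
    refine List.filter_congr fun x _ => ?_
    simp [Bool.beq_eq_decide_eq]
  simp only [key]
  rw [NatPoly.Same, Multiset.ext]
  refine ⟨fun h s => ?_, fun h a _ => h a⟩
  induction s using Quotient.inductionOn with
  | _ a =>
  by_cases ha : (∃ x ∈ b.1 ++ b.2, x.Perm a)
  · obtain ⟨x, hx, hxa⟩ := ha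
    have := h x hx
    rwa [Multiset.coe_eq_coe.2 hxa] at this
  · push Not at ha
    have h0 (p : NatPoly) (hp : p ⊆ b.1 ++ b.2) : p.toMultiset.count (a : Multiset EqVar) = 0 := by
      rw [Multiset.count_eq_zero, NatPoly.toMultiset, Multiset.mem_coe, List.mem_map]
      rintro ⟨x, hx, hxa⟩
      exact ha x (hp hx) (Multiset.coe_eq_coe.1 hxa)
    exact (h0 _ (List.subset_append_left _ _)).trans (h0 _ (List.subset_append_right _ _)).symm

theorem primrec_natPoly_mul : Primrec₂ NatPoly.mul :=
  Primrec.list_flatMap Primrec.fst (Primrec.list_map (Primrec.snd.comp Primrec.fst)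
    (Primrec.list_append.comp (Primrec.snd.comp Primrec.fst) Primrec.snd))

theorem primrec_unitCert_side (f g : PolyEqn → NatPoly) (hf : Primrec f) (hg : Primrec g) :
    Primrec₂ fun (s : List PolyEqn) (c : UnitCert) => c.flatMap fun t =>
      NatPoly.mul t.2.1 (f (s.getD t.1 ([], []))) ++ NatPoly.mul t.2.2 (g (s.getD t.1 ([], []))) := by
  have hget : Primrec fun x : (List PolyEqn × UnitCert) × (ℕ × NatPoly × NatPoly) =>
      x.1.1.getD x.2.1 ([], []) :=
    (Primrec.list_getD (([], []) : PolyEqn)).comp (Primrec.fst.comp Primrec.fst)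
      (Primrec.fst.comp Primrec.snd)
  refine Primrec.list_flatMap Primrec.snd (Primrec.list_append.comp
    (primrec_natPoly_mul.comp ?_ (hf.comp hget)) (primrec_natPoly_mul.comp ?_ (hg.comp hget)))
  · exact Primrec.fst.comp (Primrec.snd.comp Primrec.snd)
  · exact Primrec.snd.comp (Primrec.snd.comp Primrec.snd)

theorem primrecRel_unitCert_valid : PrimrecRel UnitCert.Valid :=
  primrecRel_natPoly_same.comp₂ (primrec_unitCert_side _ _ Primrec.fst Primrec.snd)
    (Primrec.list_cons.comp₂ (Primrec₂.const []) (primrec_unitCert_side _ _ Primrec.snd Primrec.fst))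

end Primrec

/-! ### Implications between equations -/

/-- The implication from a list of equations to an equation. -/
abbrev PolyImpl := List PolyEqn × PolyEqn

namespace PolyEqn

/-- The inequality of the two sides of an equation, expressed by an equation with the help of the
variable `(3, 1)`. -/
def negation (e : PolyEqn) : PolyEqn :=
  (e.1.map fun l => (3, 1) :: l, [] :: e.2.map fun l => (3, 1) :: l)

theorem holds_negation {F : Type*} [Field F] {v : EqVar → F} {e : PolyEqn} :
    e.negation.Holds v ↔ v (3, 1) * (NatPoly.eval v e.1 - NatPoly.eval v e.2) = 1 := by
  rw [Holds, negation, NatPoly.eval_cons, NatPoly.eval_map_cons, NatPoly.eval_map_cons, mul_sub,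
    sub_eq_iff_eq_add]
  simp

end PolyEqn

/-- The values of the variables: memory cells `(0, i)` and their inverses `(4, i)`, auxiliary
values `(1, i)` for the input, unknowns `(2, i)`, the inverse `(3, 0)` of `d!`, and an auxiliary
variable `(3, 1)`. -/
def variableValue {F : Type*} [Field F] (d : ℕ) (w : ℕ → F) (M : List F) (f : ℕ → F) (u : F) :
    EqVar → F
  | (0, i) => M.getD i 0
  | (1, i) => w i
  | (2, i) => f i
  | (3, 0) => (d.factorial : F)⁻¹
  | (3, 1) => u
  | (_, i) => (M.getD i 0)⁻¹

/-! ### Equations for the bases of solution spaces -/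

section EchelonEqns

variable {F : Type*} [Field F]

/-- The left-hand side of the equation with number `e` of the system, for the unknowns `φ`. -/
def rowPoly (m D d e : ℕ) (φ : List EqVar) : NatPoly :=
  (if e ≤ D then [[(0, e)]] else []) ++
    (List.range (d + 1)).flatMap fun j => (List.range (m + 1)).flatMap fun i =>
      if j ≤ e + i ∧ e + i - j ≤ D then
        -- Integer coefficients are expressed by repeating the monomial.
        (List.range (j.descFactorial i)).map fun _ =>
          [(0, (i + 1) * (D + 1) + (e + i - j)), φ.getD j (0, 0)]
      else []

theorem eval_rowPoly (m D d e : ℕ) (φ : List EqVar) (v : EqVar → F) :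
    NatPoly.eval v (rowPoly m D d e φ) = inputFree D (fun i => v (0, i)) e +
      ∑ j ∈ Finset.range (d + 1), rowCoeff m (inputCoeff D fun i => v (0, i)) e j *
        v (φ.getD j (0, 0)) := by
  have hsum (n : ℕ) (g : ℕ → F) : ((List.range n).map g).sum = ∑ j ∈ Finset.range n, g j := by
    rw [← List.sum_toFinset _ List.nodup_range, List.toFinset_range]
  rw [rowPoly, NatPoly.eval_append, NatPoly.eval_flatMap, hsum]
  congr 1
  · rw [inputFree]
    split_ifs <;> simp
  · refine Finset.sum_congr rfl fun j _ => ?_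
    rw [NatPoly.eval_flatMap, hsum, rowCoeff, Finset.sum_mul]
    refine Finset.sum_congr rfl fun i _ => ?_
    by_cases h : j ≤ e + i
    · by_cases h' : e + i - j ≤ D
      · rw [if_pos ⟨h, h'⟩, if_pos h, inputCoeff, if_pos h', List.map_const', NatPoly.eval_replicate]
        simp
        ring
      · rw [if_neg (by tauto), if_pos h, inputCoeff, if_neg h']
        simp
    · rw [if_neg (by tauto), if_neg h]
      simp

/-- The equations for the unknowns `(2, j)`. -/
def systemEqns (m D d : ℕ) : List PolyEqn :=
  (List.range (D + d + 1)).map fun e =>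
    (rowPoly m D d e ((List.range (d + 1)).map fun j => (2, j)), [])

theorem holds_systemEqns (m D d : ℕ) (v : EqVar → F) :
    (∀ e ∈ systemEqns m D d, e.Holds v) ↔
      SolvesSystem d (D + d + 1) (inputFree D fun i => v (0, i))
        (rowCoeff m (inputCoeff D fun i => v (0, i))) fun j => v (2, j) := by
  simp only [systemEqns, List.mem_map, List.mem_range, forall_exists_index, and_imp,
    forall_apply_eq_imp_iff₂, PolyEqn.Holds, eval_rowPoly, NatPoly.eval_nil]
  refine forall₂_congr fun e _ => ?_
  rw [Finset.sum_congr rfl fun j hj => ?_]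
  rw [List.getD_eq_getElem _ _ (by simpa using hj)]
  simp

/-- The vectors stored at the positions `o` solve the system. -/
def memberImpls (m D d : ℕ) (o : List (List ℕ)) : List PolyImpl :=
  o.flatMap fun w => (List.range (D + d + 1)).map fun e =>
    ([], (rowPoly m D d e (w.map fun i => (0, i)), []))

/-- The vectors stored at the positions `o` have the right entries at the pivots. -/
def pivotImpls (o : List (List ℕ)) (piv : List ℕ) : List PolyImpl :=
  (List.range o.length).flatMap fun k => (List.range piv.length).map fun l =>
    ([], ([[(0, (o.getD k []).getD (piv.getD l 0) 0)]], if k = l + 1 then [[]] else []))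

/-- The system has no solution, or every solution is an affine combination of the vectors stored
at the positions `o`. -/
def spanImpls (m D d : ℕ) (o : List (List ℕ)) (piv : List ℕ) : List PolyImpl :=
  if o = [] then [(systemEqns m D d, ([[]], [])) ] else
    (List.range (d + 1)).map fun j => (systemEqns m D d,
      ([(2, j)] :: (List.range piv.length).map fun l =>
          [(2, piv.getD l 0), (0, (o.getD 0 []).getD j 0)],
        [(0, (o.getD 0 []).getD j 0)] :: (List.range piv.length).map fun l =>
          [(2, piv.getD l 0), (0, (o.getD (l + 1) []).getD j 0)]))

/-- The vectors stored at the positions `o` are a basis of the solution space. -/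
def echelonImpls (m D d : ℕ) (o : List (List ℕ)) (piv : List ℕ) : List PolyImpl :=
  memberImpls m D d o ++ (pivotImpls o piv ++ spanImpls m D d o piv)

/-- The lengths of the vectors and the pivots are right. -/
def EchelonShape (d : ℕ) (o : List (List ℕ)) (piv : List ℕ) : Prop :=
  (∀ w ∈ o, w.length = d + 1) ∧ (o = [] ∨ o.length = piv.length + 1 ∧ ∀ a ∈ piv, a ≤ d)

/-- The implication holds at all points obtained by changing the values of the unknowns. -/
def PolyImpl.HoldsForAll (v : EqVar → F) (s : PolyImpl) : Prop :=
  ∀ v' : EqVar → F, (∀ i, i.1 ≠ 2 → v' i = v i) → (∀ e ∈ s.1, e.Holds v') → s.2.Holds v'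

theorem forall_memberImpls {m D d : ℕ} {o : List (List ℕ)} (ho : ∀ w ∈ o, w.length = d + 1)
    (v : EqVar → F) :
    (∀ s ∈ memberImpls m D d o, s.HoldsForAll v) ↔
      ∀ w ∈ o.map (List.map fun i => v (0, i)), SolvesSystem d (D + d + 1)
        (inputFree D fun i => v (0, i)) (rowCoeff m (inputCoeff D fun i => v (0, i)))
        fun j => w.getD j 0 := by
  have key (v' : EqVar → F) (h : ∀ i, v' (0, i) = v (0, i)) (w : List ℕ) (hw : w ∈ o) (e : ℕ) :
      NatPoly.eval v' (rowPoly m D d e (w.map fun i => (0, i))) =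
        inputFree D (fun i => v (0, i)) e + ∑ j ∈ Finset.range (d + 1),
          rowCoeff m (inputCoeff D fun i => v (0, i)) e j *
            (w.map fun i => v (0, i)).getD j 0 := by
    rw [eval_rowPoly]
    simp only [h]
    congr 1
    refine Finset.sum_congr rfl fun j hj => ?_
    have hj : j < w.length := by rw [ho w hw]; simpa using hj
    rw [List.getD_eq_getElem _ _ (by simpa using hj), List.getD_eq_getElem _ _ (by simpa using hj)]
    simp [h]
  simp only [memberImpls, List.mem_flatMap, List.mem_map, List.mem_range, forall_exists_index,
    and_imp, forall_apply_eq_imp_iff₂, PolyImpl.HoldsForAll, PolyEqn.Holds]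
  constructor
  · intro h w hw e he
    rw [← key v (fun _ => rfl) w hw e]
    have := h _ w hw e he rfl v (fun _ _ => rfl)
    simpa using this
  · rintro h _ w hw e he rfl v' hv' -
    simp only
    rw [key v' (fun i => hv' (0, i) (by simp)) w hw e]
    exact h w hw e he

theorem forall_pivotImpls {d : ℕ} {o : List (List ℕ)} {piv : List ℕ}
    (ho : ∀ w ∈ o, w.length = d + 1) (hpiv : ∀ a ∈ piv, a ≤ d) (v : EqVar → F) :
    (∀ s ∈ pivotImpls o piv, s.HoldsForAll v) ↔ ∀ k < o.length, ∀ l < piv.length,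
      ((o.map (List.map fun i => v (0, i))).getD k []).getD (piv.getD l 0) 0 =
        if k = l + 1 then 1 else 0 := by
  have key (k : ℕ) (hk : k < o.length) (l : ℕ) (hl : l < piv.length) :
      ((o.map (List.map fun i => v (0, i))).getD k []).getD (piv.getD l 0) 0 =
        v (0, (o.getD k []).getD (piv.getD l 0) 0) := by
    have h1 : piv[l] < o[k].length := by
      rw [ho _ (List.getElem_mem hk)]
      exact Nat.lt_succ_iff.2 (hpiv _ (List.getElem_mem hl))
    simp [List.getD_eq_getElem?_getD, hk, hl, h1]
  simp only [pivotImpls, List.mem_flatMap, List.mem_map, List.mem_range, forall_exists_index,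
    and_imp, PolyImpl.HoldsForAll, PolyEqn.Holds]
  have key2 (v' : EqVar → F) (k l : ℕ) : NatPoly.eval v' (if k = l + 1 then [[]] else []) =
      if k = l + 1 then 1 else 0 := by split_ifs <;> simp
  constructor
  · intro h k hk l hl
    rw [key k hk l hl, ← key2 v]
    simpa using h _ k hk l hl rfl v (fun _ _ => rfl)
  · rintro h _ k hk l hl rfl v' hv' -
    simp only
    rw [key2, ← h k hk l hl, key k hk l hl]
    simp [hv']

/-- The statement quantifies over all solutions `f`. The unknowns `(2, j)` range over all values in
`HoldsForAll`, so this quantifier becomes an implication between equations; subtraction is avoided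
by moving terms to the other side. -/
theorem forall_spanImpls {m D d : ℕ} {o : List (List ℕ)} {piv : List ℕ}
    (ho : ∀ w ∈ o, w.length = d + 1) (hlen : o.length = piv.length + 1) (v : EqVar → F) :
    (∀ s ∈ spanImpls m D d o piv, s.HoldsForAll v) ↔
      ∀ f, SolvesSystem d (D + d + 1) (inputFree D fun i => v (0, i))
        (rowCoeff m (inputCoeff D fun i => v (0, i))) f → ∀ j ≤ d,
        f j = ((o.map (List.map fun i => v (0, i))).getD 0 []).getD j 0 +
          ∑ l ∈ Finset.range piv.length, f (piv.getD l 0) *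
            (((o.map (List.map fun i => v (0, i))).getD (l + 1) []).getD j 0 -
              ((o.map (List.map fun i => v (0, i))).getD 0 []).getD j 0) := by
  have key (k : ℕ) (hk : k < o.length) (j : ℕ) (hj : j ≤ d) :
      ((o.map (List.map fun i => v (0, i))).getD k []).getD j 0 =
        v (0, (o.getD k []).getD j 0) := by
    have h1 : j < o[k].length := by
      rw [ho _ (List.getElem_mem hk)]
      omega
    simp [List.getD_eq_getElem?_getD, hk, h1]
  have hne : o ≠ [] := by rintro rfl; simp at hlen
  have hsum (n : ℕ) (g : ℕ → F) : ((List.range n).map g).sum = ∑ j ∈ Finset.range n, g j := by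
    rw [← List.sum_toFinset _ List.nodup_range, List.toFinset_range]
  have hev (v' : EqVar → F) (n : ℕ) (a b : ℕ → EqVar) :
      NatPoly.eval v' ((List.range n).map fun l => [a l, b l]) =
        ∑ l ∈ Finset.range n, v' (a l) * v' (b l) := by
    rw [NatPoly.eval, List.map_map, hsum]
    simp
  have main (v' : EqVar → F) (h : ∀ i, v' (0, i) = v (0, i)) (j : ℕ) (hj : j ≤ d) :
      PolyEqn.Holds v' ([(2, j)] :: (List.range piv.length).map fun l =>
          [(2, piv.getD l 0), (0, (o.getD 0 []).getD j 0)],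
        [(0, (o.getD 0 []).getD j 0)] :: (List.range piv.length).map fun l =>
          [(2, piv.getD l 0), (0, (o.getD (l + 1) []).getD j 0)]) ↔
      v' (2, j) = ((o.map (List.map fun i => v (0, i))).getD 0 []).getD j 0 +
          ∑ l ∈ Finset.range piv.length, v' (2, piv.getD l 0) *
            (((o.map (List.map fun i => v (0, i))).getD (l + 1) []).getD j 0 -
              ((o.map (List.map fun i => v (0, i))).getD 0 []).getD j 0) := by
    rw [PolyEqn.Holds, NatPoly.eval_cons, NatPoly.eval_cons, hev, hev, key 0 (by omega) j hj]
    have : ∑ l ∈ Finset.range piv.length, v' (2, piv.getD l 0) *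
        (((o.map (List.map fun i => v (0, i))).getD (l + 1) []).getD j 0 -
          v (0, (o.getD 0 []).getD j 0)) =
        ∑ l ∈ Finset.range piv.length, (v' (2, piv.getD l 0) * v' (0, (o.getD (l + 1) []).getD j 0) -
          v' (2, piv.getD l 0) * v' (0, (o.getD 0 []).getD j 0)) := by
      refine Finset.sum_congr rfl fun l hl => ?_
      rw [key (l + 1) (by simpa [hlen] using hl) j hj, h, h, mul_sub]
    rw [this, Finset.sum_sub_distrib]
    simp only [List.map_cons, List.map_nil, List.prod_cons, List.prod_nil, mul_one, h]
    constructor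
    · intro h
      linear_combination h
    · intro h
      linear_combination h
  rw [spanImpls, if_neg hne]
  simp only [List.mem_map, List.mem_range, forall_exists_index, and_imp,
    forall_apply_eq_imp_iff₂, PolyImpl.HoldsForAll, holds_systemEqns]
  constructor
  · intro h f hf j hj
    have := h j (by omega) (fun i => if i.1 = 2 then f i.2 else v i) (fun i hi => if_neg hi) (by simpa using hf)
    rw [main _ (by simp) j hj] at this
    simpa using this
  · intro h j hj v' hv' hs
    rw [main v' (fun i => hv' (0, i) (by simp)) j (by omega)]
    exact h (fun j => v' (2, j)) (by simpa [hv'] using hs) j (by omega)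

/-- The bridge from linear algebra to certificates: once the lengths are right, being an echelon
basis is a finite list of implications between polynomial equations. -/
theorem forall_echelonImpls {m D d : ℕ} {o : List (List ℕ)} {piv : List ℕ}
    (h : EchelonShape d o piv) (v : EqVar → F) :
    (∀ s ∈ echelonImpls m D d o piv, s.HoldsForAll v) ↔
      IsEchelonBasis d (D + d + 1) (inputFree D fun i => v (0, i))
        (rowCoeff m (inputCoeff D fun i => v (0, i))) (o.map (List.map fun i => v (0, i))) piv := by
  obtain ⟨ho, rfl | ⟨hlen, hpiv⟩⟩ := h
  · simp only [echelonImpls, memberImpls, pivotImpls, spanImpls, IsEchelonBasis,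
      List.flatMap_nil, List.length_nil, List.range_zero, List.nil_append, if_true,
      List.mem_singleton, forall_eq, List.map_nil, true_and, right_eq_add, Nat.add_eq_zero_iff,
      one_ne_zero, and_false, false_and, or_false]
    constructor
    · intro h f hf
      have := h (fun i => if i.1 = 2 then f i.2 else v i) (fun i hi => if_neg hi)
        ((holds_systemEqns m D d _).2 (by simpa using hf))
      simp [PolyEqn.Holds] at this
    · intro h v' hv' hs
      rw [holds_systemEqns] at hs
      exact absurd (by simpa [hv'] using hs) (h fun j => v' (2, j))
  · have hne : o.map (List.map fun i => v (0, i)) ≠ [] := by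
      intro h0
      rw [List.map_eq_nil_iff] at h0
      simp [h0] at hlen
    simp only [echelonImpls, List.forall_mem_append, forall_memberImpls ho,
      forall_pivotImpls ho hpiv, forall_spanImpls ho hlen, IsEchelonBasis]
    rw [or_iff_right (fun h => hne h.1)]
    have hl : ∀ w ∈ o.map (List.map fun i => v (0, i)), w.length = d + 1 := by
      simpa using ho
    rw [List.length_map]
    exact ⟨fun h => ⟨hlen, hl, hpiv, h⟩, fun h => h.2.2.2⟩

end EchelonEqns

/-! ### Freshness of the variable `(3, 1)` used to express inequalities. -/

section Avoid

/-- The variable `(3, 1)` does not occur. -/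
def PolyEqn.Avoids (e : PolyEqn) : Prop := ∀ l ∈ e.1 ++ e.2, (3, 1) ∉ l

theorem NatPoly.eval_congr {R : Type*} [CommSemiring R] {v v' : EqVar → R} {p : NatPoly}
    (h : ∀ l ∈ p, ∀ x ∈ l, v x = v' x) : NatPoly.eval v p = NatPoly.eval v' p := by
  rw [NatPoly.eval, NatPoly.eval]
  congr 1
  refine List.map_congr_left fun l hl => ?_
  rw [List.map_congr_left (h l hl)]

theorem PolyEqn.Avoids.eval_eq {F : Type*} [Field F] {e : PolyEqn} (h : e.Avoids)
    {v v' : EqVar → F} (hv : ∀ x, x ≠ (3, 1) → v x = v' x) :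
    NatPoly.eval v e.1 = NatPoly.eval v' e.1 ∧ NatPoly.eval v e.2 = NatPoly.eval v' e.2 := by
  constructor
  · refine NatPoly.eval_congr fun l hl x hx => hv x ?_
    rintro rfl
    exact h l (by simp [hl]) hx
  · refine NatPoly.eval_congr fun l hl x hx => hv x ?_
    rintro rfl
    exact h l (by simp [hl]) hx

theorem avoids_rowPoly {m D d e : ℕ} {φ : List EqVar} (hφ : (3, 1) ∉ φ) :
    PolyEqn.Avoids (rowPoly m D d e φ, []) := by
  have h (j : ℕ) : φ.getD j (0, 0) ≠ (3, 1) := by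
    intro h0
    by_cases hj : j < φ.length
    · rw [List.getD_eq_getElem _ _ hj] at h0
      exact hφ (h0 ▸ List.getElem_mem hj)
    · rw [List.getD_eq_default _ _ (by omega)] at h0
      simp at h0
  intro l hl
  simp only [rowPoly, List.append_nil, List.mem_append, List.mem_flatMap] at hl
  obtain hl | ⟨j, -, i, -, hl⟩ := hl
  · split_ifs at hl <;> simp_all
  · split_ifs at hl
    · obtain ⟨-, -, rfl⟩ := List.mem_map.1 hl
      simpa using (h j).symm
    · simp at hl

theorem avoids_systemEqns {m D d : ℕ} : ∀ e ∈ systemEqns m D d, e.Avoids := by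
  intro e he
  obtain ⟨e, -, rfl⟩ := List.mem_map.1 he
  exact avoids_rowPoly (by simp)

theorem avoids_echelonImpls {m D d : ℕ} {o : List (List ℕ)} {piv : List ℕ} :
    ∀ s ∈ echelonImpls m D d o piv, (∀ e ∈ s.1, e.Avoids) ∧ s.2.Avoids := by
  intro s hs
  simp only [echelonImpls, List.mem_append] at hs
  obtain hs | hs | hs := hs
  · simp only [memberImpls, List.mem_flatMap, List.mem_map] at hs
    obtain ⟨w, -, e, -, rfl⟩ := hs
    exact ⟨by simp, avoids_rowPoly (by simp)⟩
  · simp only [pivotImpls, List.mem_flatMap, List.mem_map] at hs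
    obtain ⟨k, -, l, -, rfl⟩ := hs
    refine ⟨by simp, ?_⟩
    rw [PolyEqn.Avoids]
    split_ifs <;> simp
  · rw [spanImpls] at hs
    split_ifs at hs
    · rw [List.mem_singleton] at hs
      subst hs
      exact ⟨avoids_systemEqns, by simp [PolyEqn.Avoids]⟩
    · obtain ⟨j, -, rfl⟩ := List.mem_map.1 hs
      refine ⟨avoids_systemEqns, ?_⟩
      simp only [PolyEqn.Avoids, List.mem_append, List.mem_cons, List.mem_map]
      rintro l ((rfl | ⟨_, -, rfl⟩) | (rfl | ⟨_, -, rfl⟩)) <;> simp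

end Avoid

/-! ### Certified programs -/

/-- A stage of a computation: the size of the memory, equations that are known to hold, and the
number of operations that are still allowed. -/
abbrev ProgKey := ℕ × List PolyEqn × ℕ

/-- A stage with the instruction to be performed, the pivots of the output, and certificates. -/
abbrev ProgNode := ProgKey × FieldInstr × List ℕ × List UnitCert

/-- A program for the machine, with certificates for its correctness. -/
abbrev CertProgram := List ProgNode

namespace FieldInstr

/-- The positions in the memory used by an instruction. -/
def positions : FieldInstr → List ℕ
  | .const _ => []
  | .arith _ i j => [i, j]
  | .isZero i => [i]
  | .output o => o.flatten

/-- The positions of the output vectors. -/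
def outputs : FieldInstr → List (List ℕ)
  | .output o => o
  | _ => []

/-- The equation which holds for the result of an arithmetic operation. -/
def arithEqn (op : FieldOp) (ℓ i j : ℕ) : PolyEqn :=
  match op with
  | .add => ([[(0, ℓ)]], [[(0, i)], [(0, j)]])
  | .sub => ([[(0, ℓ)], [(0, j)]], [[(0, i)]])
  | .mul => ([[(0, ℓ)]], [[(0, i), (0, j)]])
  | .div => ([[(0, ℓ), (0, j)]], [[(0, i)]])

/-- The stage after an instruction, where `b` is the outcome of the zero test. -/
def nextKey (k : ProgKey) (c : FieldInstr) (b : Bool) : ProgKey :=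
  match c with
  | .const b => (k.1 + 1, k.2.1 ++ [([[(0, k.1)]], if b then [[]] else [])], k.2.2 - 1)
  | .arith op i j => (k.1 + 1, k.2.1 ++ [arithEqn op k.1 i j], k.2.2 - 1)
  | .isZero i =>
    (k.1, k.2.1 ++ [if b then ([[(0, i)]], []) else ([[(0, i), (4, i)]], [[]])], k.2.2 - 1)
  | .output _ => k

/-- All possible stages after an instruction. -/
def children (k : ProgKey) : FieldInstr → List ProgKey
  | .output _ => []
  | c => [nextKey k c false, nextKey k c true]

/-- What has to be verified before an instruction may be performed. -/
def obligations (m D d : ℕ) (piv : List ℕ) : FieldInstr → List PolyImpl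
  | .arith .div _ j => [([([[(0, j)]], [])], ([[]], []))]
  | .output o => echelonImpls m D d o piv
  | _ => []

theorem avoids_obligations {m D d : ℕ} {piv : List ℕ} {c : FieldInstr} :
    ∀ s ∈ c.obligations m D d piv, (∀ e ∈ s.1, e.Avoids) ∧ s.2.Avoids := by
  cases c with
  | const b => simp [obligations]
  | isZero i => simp [obligations]
  | output o => exact avoids_echelonImpls
  | arith op i j => cases op <;> simp [obligations, PolyEqn.Avoids]

end FieldInstr

namespace CertProgram

/-- The equations that hold initially: the input is not zero and `d!` is invertible. -/
def inputEqns (m D d : ℕ) : List PolyEqn :=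
  [((List.range ((m + 2) * (D + 1))).map fun i => [(1, i), (0, i)], [[]]),
    ((List.range d.factorial).map fun _ => [(3, 0)], [[]])]

/-- The program is correct at a stage. -/
def Correct (m D d : ℕ) (T : CertProgram) (x : ProgNode) : Prop :=
  (∀ i ∈ x.2.1.positions, i < x.1.1) ∧ EchelonShape d x.2.1.outputs x.2.2.1 ∧
    (∀ k ∈ x.2.1.children x.1, x.1.2.2 ≠ 0 ∧ k ∈ T.map Prod.fst) ∧
    ∀ s ∈ x.2.1.obligations m D d x.2.2.1, ∃ c ∈ x.2.2.2,
      UnitCert.Valid (x.1.2.1 ++ (s.1 ++ [s.2.negation])) c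

/-- The instruction at a stage. -/
def instrAt (T : CertProgram) (k : ProgKey) : FieldInstr :=
  ((T.lookup k).getD (.output [], [], [])).1

theorem exists_mem_instrAt {T : CertProgram} {k : ProgKey} (h : k ∈ T.map Prod.fst) :
    ∃ y, (k, instrAt T k, y) ∈ T := by
  cases hy : T.lookup k with
  | none =>
    rw [List.lookup_eq_none_iff] at hy
    obtain ⟨x, hx, rfl⟩ := List.mem_map.1 h
    simpa using hy x hx
  | some y =>
    refine ⟨y.2, ?_⟩
    rw [instrAt, hy]
    obtain ⟨l₁, l₂, rfl, -⟩ := List.lookup_eq_some_iff.1 hy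
    simp

/-! ### Certified programs are correct in every field. -/

section Soundness

variable {F : Type*} [Field F] {m D d : ℕ}

theorem variableValue_cell {w : ℕ → F} {M M' : List F} (h : M <+: M') {i : ℕ} (hi : i < M.length)
    (f : ℕ → F) (u : F) : variableValue d w M' f u (0, i) = M[i] := by
  obtain ⟨t, rfl⟩ := h
  simp [variableValue, List.getElem?_append_left hi, hi]

theorem variableValue_inv {w : ℕ → F} {M M' : List F} (h : M <+: M') {i : ℕ} (hi : i < M.length)
    (f : ℕ → F) (u : F) : variableValue d w M' f u (4, i) = M[i]⁻¹ := by
  obtain ⟨t, rfl⟩ := h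
  simp [variableValue, List.getElem?_append_left hi, hi]

/-- The equations hold as long as the memory starts with `M`. -/
def HoldAfter (d : ℕ) (w : ℕ → F) (M : List F) (eqs : List PolyEqn) : Prop :=
  ∀ M', M <+: M' → ∀ f u, ∀ e ∈ eqs, e.Holds (variableValue d w M' f u)

theorem HoldAfter.concat {w : ℕ → F} {M : List F} {eqs : List PolyEqn} (h : HoldAfter d w M eqs)
    {M₁ : List F} (hM : M <+: M₁) {e : PolyEqn}
    (he : ∀ M', M₁ <+: M' → ∀ f u, e.Holds (variableValue d w M' f u)) :
    HoldAfter d w M₁ (eqs ++ [e]) := by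
  intro M' hM' f u e' he'
  rw [List.mem_append, List.mem_singleton] at he'
  obtain he' | rfl := he'
  · exact h M' (hM.trans hM') f u e' he'
  · exact he M' hM' f u

/-- Rabinowitsch trick: if the implication failed, giving the fresh variable the inverse of the
difference of the two sides would satisfy all equations which the certificate declares unsolvable.
-/
theorem HoldAfter.holdsForAll {w : ℕ → F} {M : List F} {eqs : List PolyEqn}
    (hM : HoldAfter d w M eqs) {s : PolyImpl} (hs : (∀ e ∈ s.1, e.Avoids) ∧ s.2.Avoids)
    {c : UnitCert} (hc : UnitCert.Valid (eqs ++ (s.1 ++ [s.2.negation])) c) :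
    s.HoldsForAll (variableValue d w M 0 0) := by
  intro v' hv' h1
  by_contra h2
  have h3 : NatPoly.eval v' s.2.1 - NatPoly.eval v' s.2.2 ≠ 0 := sub_ne_zero.2 h2
  set v := variableValue d w M (fun j => v' (2, j))
    (NatPoly.eval v' s.2.1 - NatPoly.eval v' s.2.2)⁻¹ with hv
  have hvv (x : EqVar) (hx : x ≠ (3, 1)) : v' x = v x := by
    by_cases h : x.1 = 2
    · obtain ⟨i, j⟩ := x
      subst h
      rfl
    · rw [hv' x h, hv]
      unfold variableValue
      split <;> simp_all
  have h31 : v (3, 1) = (NatPoly.eval v' s.2.1 - NatPoly.eval v' s.2.2)⁻¹ := rfl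
  refine hc.not_forall_holds v fun e he => ?_
  simp only [List.mem_append, List.mem_singleton] at he
  obtain he | he | rfl := he
  · exact hM M List.prefix_rfl _ _ e he
  · have := h1 e he
    rwa [PolyEqn.Holds, ((hs.1 e he).eval_eq hvv).1, ((hs.1 e he).eval_eq hvv).2] at this
  · rw [PolyEqn.holds_negation, ← (hs.2.eval_eq hvv).1, ← (hs.2.eval_eq hvv).2, h31,
      inv_mul_cancel₀ h3]

theorem holds_arithEqn {w : ℕ → F} {M M' : List F} {i j : ℕ} {op : FieldOp} (hi : i < M.length)
    (hj : j < M.length) (hdiv : op = .div → M[j] ≠ 0) (h : M ++ [op.eval M[i] M[j]] <+: M')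
    (f : ℕ → F) (u : F) :
    (FieldInstr.arithEqn op M.length i j).Holds (variableValue d w M' f u) := by
  have hM := (List.prefix_append M [op.eval M[i] M[j]]).trans h
  have h0 := variableValue_cell (d := d) (w := w) h (i := M.length) (by simp) f u
  have h1 := variableValue_cell (d := d) (w := w) hM hi f u
  have h2 := variableValue_cell (d := d) (w := w) hM hj f u
  simp only [List.getElem_concat_length] at h0
  cases op <;> simp [PolyEqn.Holds, FieldInstr.arithEqn, h0, h1, h2, FieldOp.eval]
  exact div_mul_cancel₀ _ (hdiv rfl)

/-- A correct program runs correctly in all fields. -/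
theorem exists_runs {T : CertProgram} (hT : ∀ x ∈ T, Correct m D d T x) {A : FieldAlgorithm}
    {st : ProgKey → A.State} (hi : ∀ k, A.instr (st k) = instrAt T k)
    (hn : ∀ k b, A.next (st k) b = st ((instrAt T k).nextKey k b)) {w : ℕ → F} (n : ℕ) :
    ∀ (eqs : List PolyEqn) (M : List F), (M.length, eqs, n) ∈ T.map Prod.fst →
      HoldAfter d w M eqs → ∃ n' ≤ n, ∃ out piv M', M <+: M' ∧
        A.Runs (st (M.length, eqs, n)) M n' out ∧
        IsEchelonBasis d (D + d + 1) (inputFree D fun i => M'.getD i 0)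
          (rowCoeff m (inputCoeff D fun i => M'.getD i 0)) out piv := by
  induction n using Nat.strong_induction_on with
  | _ n ih =>
  intro eqs M hk hM
  obtain ⟨⟨piv, certs⟩, hy⟩ := exists_mem_instrAt hk
  obtain ⟨hpos, hshape, hch, hobl⟩ := hT _ hy
  have hs := hi (M.length, eqs, n)
  have hnext := hn (M.length, eqs, n)
  simp only at hpos hshape hch hobl
  cases hc : instrAt T (M.length, eqs, n) with
  | output o =>
    rw [hc] at hpos hshape hobl hs
    refine ⟨0, Nat.zero_le _, o.map (List.map fun i => M.getD i 0), piv, M, List.prefix_rfl,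
      .output hs ?_, ?_⟩
    · rw [List.forall₂_map_right_iff, List.forall₂_same]
      intro v hv
      rw [List.forall₂_map_right_iff, List.forall₂_same]
      intro i hi
      have : i < M.length := hpos i (List.mem_flatten.2 ⟨v, hv, hi⟩)
      simp [this]
    · refine (forall_echelonImpls hshape (variableValue d w M 0 0)).1 fun s hs => ?_
      obtain ⟨c, -, hc⟩ := hobl s hs
      exact hM.holdsForAll (avoids_echelonImpls s hs) hc
  | const b =>
    rw [hc] at hch hs hnext
    obtain ⟨hn0, hkey⟩ := hch _ (List.mem_cons_self ..)
    -- A stage with a successor must have a positive number of allowed operations, and this number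
    -- drops by one; so it bounds the length of the run.
    obtain ⟨n, rfl⟩ := Nat.exists_eq_succ_of_ne_zero hn0
    have hlen : (M ++ [if b then (1 : F) else 0]).length = M.length + 1 := by simp
    have hkey' : FieldInstr.nextKey (M.length, eqs, n + 1) (.const b) false =
      ((M ++ [if b then (1 : F) else 0]).length, eqs ++ [([[(0, M.length)]], if b then [[]] else [])],
        n) := by rw [hlen]; rfl
    rw [hkey'] at hkey
    obtain ⟨n', hn', out, piv, M', hMM, hrun, hout⟩ := ih n (by omega) _ _ hkey
      (hM.concat (List.prefix_append _ _) fun M' hM' f u => by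
        have h0 := variableValue_cell (d := d) (w := w) hM' (i := M.length) (by simp) f u
        simp only [List.getElem_concat_length] at h0
        cases b <;> simpa [PolyEqn.Holds] using h0)
    refine ⟨n' + 1, by omega, out, piv, M', (List.prefix_append _ _).trans hMM, .const hs ?_, hout⟩
    rwa [hnext, hkey']
  | arith op i j =>
    rw [hc] at hpos hch hs hnext hobl
    obtain ⟨hn0, hkey⟩ := hch _ (List.mem_cons_self ..)
    obtain ⟨n, rfl⟩ := Nat.exists_eq_succ_of_ne_zero hn0
    have hiM : i < M.length := hpos i (by simp [FieldInstr.positions])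
    have hjM : j < M.length := hpos j (by simp [FieldInstr.positions])
    -- The obligation for a division is the implication from `M[j] = 0` to `1 = 0`.
    have hdiv : op = .div → M[j] ≠ 0 := by
      rintro rfl h0
      obtain ⟨c, -, hc⟩ := hobl _ (List.mem_cons_self ..)
      have h1 := hM.holdsForAll (FieldInstr.avoids_obligations (m := m) (D := D) (d := d) (piv := piv)
        (c := .arith .div i j) _ (List.mem_cons_self ..)) hc (variableValue d w M 0 0)
        (fun _ _ => rfl) (by
          have := variableValue_cell (d := d) (w := w) (List.prefix_rfl (l := M)) hjM 0 0
          simpa [PolyEqn.Holds, this] using h0)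
      simp [PolyEqn.Holds] at h1
    have hlen : (M ++ [op.eval M[i] M[j]]).length = M.length + 1 := by simp
    have hkey' : FieldInstr.nextKey (M.length, eqs, n + 1) (.arith op i j) false =
      ((M ++ [op.eval M[i] M[j]]).length, eqs ++ [FieldInstr.arithEqn op M.length i j], n) := by
      rw [hlen]; rfl
    rw [hkey'] at hkey
    obtain ⟨n', hn', out, piv, M', hMM, hrun, hout⟩ := ih n (by omega) _ _ hkey
      (hM.concat (List.prefix_append _ _) fun M' hM' f u => holds_arithEqn hiM hjM hdiv hM' f u)
    refine ⟨n' + 1, by omega, out, piv, M', (List.prefix_append _ _).trans hMM,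
      .arith hs (List.getElem?_eq_getElem hiM) (List.getElem?_eq_getElem hjM) hdiv ?_, hout⟩
    rwa [hnext, hkey']
  | isZero i =>
    rw [hc] at hpos hch hs hnext
    have hiM : i < M.length := hpos i (by simp [FieldInstr.positions])
    have hn0 := (hch _ (List.mem_cons_self ..)).1
    obtain ⟨n, rfl⟩ := Nat.exists_eq_succ_of_ne_zero hn0
    by_cases h0 : M[i] = 0
    · obtain ⟨n', hn', out, piv, M', hMM, hrun, hout⟩ := ih n (by omega) _ _
        (hch _ (List.mem_cons_of_mem _ (List.mem_cons_self ..))).2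
        (hM.concat List.prefix_rfl fun M' hM' f u => by
          have := variableValue_cell (d := d) (w := w) hM' hiM f u
          simpa [PolyEqn.Holds, this] using h0)
      refine ⟨n' + 1, by omega, out, piv, M', hMM,
        .zero hs (by rw [List.getElem?_eq_getElem hiM, h0]) ?_, hout⟩
      rwa [hnext]
    · obtain ⟨n', hn', out, piv, M', hMM, hrun, hout⟩ := ih n (by omega) _ _
        (hch _ (List.mem_cons_self ..)).2
        (hM.concat List.prefix_rfl fun M' hM' f u => by
          have h1 := variableValue_cell (d := d) (w := w) hM' hiM f u
          have h2 := variableValue_inv (d := d) (w := w) hM' hiM f u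
          simpa [PolyEqn.Holds, h1, h2] using mul_inv_cancel₀ h0)
      refine ⟨n' + 1, by omega, out, piv, M', hMM,
        .nonzero hs (List.getElem?_eq_getElem hiM) h0 ?_, hout⟩
      rwa [hnext]

end Soundness

/-! ### Decision trees give certified programs. -/

section Completeness

/-- A field with values of all variables for which the initial equations hold. -/
structure Point (m D d : ℕ) where
  carrier : Type
  [field : Field carrier]
  value : EqVar → carrier
  holds : ∀ e ∈ inputEqns m D d, e.Holds value

attribute [instance] Point.field

variable {m D d : ℕ}

theorem Correct.mono {T T' : CertProgram} (h : T ⊆ T') {x : ProgNode} (hx : Correct m D d T x) :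
    Correct m D d T' x :=
  ⟨hx.1, hx.2.1, fun k hk => ⟨(hx.2.2.1 k hk).1, List.map_subset _ h (hx.2.2.1 k hk).2⟩, hx.2.2.2⟩

/-- An implication valid at all points means that its hypotheses together with the negated
conclusion have no solution in any field, hence a certificate exists. -/
theorem exists_certs {eqs : List PolyEqn} (heqs : inputEqns m D d ⊆ eqs) (S : List PolyImpl)
    (hS : ∀ s ∈ S, ∀ ω : Point m D d, (∀ e ∈ eqs, e.Holds ω.value) →
      (∀ e ∈ s.1, e.Holds ω.value) → s.2.Holds ω.value) :
    ∃ certs : List UnitCert, ∀ s ∈ S, ∃ c ∈ certs,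
      UnitCert.Valid (eqs ++ (s.1 ++ [s.2.negation])) c := by
  have h (s : PolyImpl) (hs : s ∈ S) :
      ∃ c, UnitCert.Valid (eqs ++ (s.1 ++ [s.2.negation])) c := by
    refine UnitCert.exists_valid fun F _ v hv => ?_
    have h1 : ∀ e ∈ eqs, e.Holds v := fun e he => hv e (by simp [he])
    have h2 : ∀ e ∈ s.1, e.Holds v := fun e he => hv e (by simp [he])
    have h3 := hS s hs ⟨F, v, fun e he => h1 e (heqs he)⟩ h1 h2
    have h4 := PolyEqn.holds_negation.1 (hv s.2.negation (by simp))
    rw [PolyEqn.Holds] at h3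
    simp [h3] at h4
  choose! c hc using h
  exact ⟨S.map c, fun s hs => ⟨c s, List.mem_map_of_mem hs, hc s hs⟩⟩

/-- Induction on the tree. The invariant is that the recorded equations force the point into the set
`P` of the current node and determine the memory cells as the known elements of the product of
fields. Every correctness claim is then true at all points satisfying the equations, and so has a
certificate. -/
theorem exists_correct {P : Set (Point m D d)} {K : Set (∀ ω : Point m D d, ω.carrier)} {n : ℕ}
    (h : Solves (fun ω : Point m D d => IsEchelonBasis d (D + d + 1)
      (inputFree D fun i => ω.value (0, i)) (rowCoeff m (inputCoeff D fun i => ω.value (0, i)))) P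
      K n) :
    ∀ (eqs : List PolyEqn) (M : List (∀ ω : Point m D d, ω.carrier)), (∀ x ∈ K, x ∈ M) →
      inputEqns m D d ⊆ eqs → (∀ ω : Point m D d, (∀ e ∈ eqs, e.Holds ω.value) →
        ω ∈ P ∧ ∀ (i : ℕ) (hi : i < M.length), ω.value (0, i) = M[i] ω) →
      ∃ T : CertProgram, (M.length, eqs, n) ∈ T.map Prod.fst ∧ ∀ x ∈ T, Correct m D d T x := by
  classical
  induction h with
  | @output P K n o piv hK hpost =>
    intro eqs M hKM heqs hM
    -- A witness is needed to read off the shape of the output, which does not depend on the point.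
    -- If the recorded equations are contradictory, every implication is certifiable and the empty
    -- output will do.
    by_cases hω : ∃ ω : Point m D d, ∀ e ∈ eqs, e.Holds ω.value
    · obtain ⟨ω₀, hω₀⟩ := hω
      have hmem : ∀ v ∈ o, ∀ x ∈ v, M.idxOf x < M.length := fun v hv x hx =>
        List.idxOf_lt_length_of_mem (hKM x (hK v hv x hx))
      have hmap (ω : Point m D d) (hω : ∀ e ∈ eqs, e.Holds ω.value) :
          (o.map (List.map fun x => M.idxOf x)).map (List.map fun i => ω.value (0, i)) =
            o.map (List.map fun x => x ω) := by
        rw [List.map_map]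
        refine List.map_congr_left fun v hv => ?_
        rw [Function.comp_apply, List.map_map]
        refine List.map_congr_left fun x hx => ?_
        rw [Function.comp_apply, (hM ω hω).2 _ (hmem v hv x hx), List.getElem_idxOf]
      have hshape : EchelonShape d (o.map (List.map fun x => M.idxOf x)) piv := by
        obtain ⟨h0, -⟩ | ⟨h1, h2, h3, -⟩ := hpost ω₀ (hM ω₀ hω₀).1
        · rw [List.map_eq_nil_iff] at h0
          simp [EchelonShape, h0]
        · refine ⟨fun w hw => ?_, Or.inr ⟨by simpa using h1, h3⟩⟩
          obtain ⟨v, hv, rfl⟩ := List.mem_map.1 hw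
          simpa using h2 _ (List.mem_map_of_mem hv)
      obtain ⟨certs, hcerts⟩ := exists_certs heqs
        (echelonImpls m D d (o.map (List.map fun x => M.idxOf x)) piv) (fun s hs ω hω h => by
          have := hpost ω (hM ω hω).1
          rw [← hmap ω hω] at this
          exact (forall_echelonImpls hshape ω.value).2 this s hs ω.value (fun _ _ => rfl) h)
      refine ⟨[((M.length, eqs, n), .output (o.map (List.map fun x => M.idxOf x)), piv, certs)],
        by simp, ?_⟩
      rw [List.forall_mem_singleton]
      refine ⟨fun i hi => ?_, hshape, by simp [FieldInstr.children], hcerts⟩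
      obtain ⟨w, hw, hi⟩ := List.mem_flatten.1 hi
      obtain ⟨v, hv, rfl⟩ := List.mem_map.1 hw
      obtain ⟨x, hx, rfl⟩ := List.mem_map.1 hi
      exact hmem v hv x hx
    · push Not at hω
      obtain ⟨certs, hcerts⟩ := exists_certs heqs (echelonImpls m D d [] piv)
        (fun s hs ω h => by
          obtain ⟨e, he, he'⟩ := hω ω
          exact absurd (h e he) he')
      refine ⟨[((M.length, eqs, n), .output [], piv, certs)], by simp, ?_⟩
      rw [List.forall_mem_singleton]
      exact ⟨by simp [FieldInstr.positions], by simp [EchelonShape, FieldInstr.outputs],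
        by simp [FieldInstr.children], hcerts⟩
  | @op P K n z hz h ih =>
    intro eqs M hKM heqs hM
    -- Constants and arithmetic operations alike append one cell and one equation determining it, so
    -- they share this argument.
    have step (c : FieldInstr) (e : PolyEqn)
        (hkey : ∀ b, c.nextKey (M.length, eqs, n + 1) b = (M.length + 1, eqs ++ [e], n))
        (hpos : ∀ i ∈ c.positions, i < M.length) (hout : c.outputs = [])
        (hch : ∀ k ∈ c.children (M.length, eqs, n + 1), k = (M.length + 1, eqs ++ [e], n))
        (he : ∀ ω : Point m D d, (∀ e ∈ eqs, e.Holds ω.value) → e.Holds ω.value →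
          ω.value (0, M.length) = z ω)
        (hobl : ∀ s ∈ c.obligations m D d [], ∀ ω : Point m D d,
          (∀ e ∈ eqs, e.Holds ω.value) → (∀ e ∈ s.1, e.Holds ω.value) → s.2.Holds ω.value) :
        ∃ T : CertProgram, (M.length, eqs, n + 1) ∈ T.map Prod.fst ∧
          ∀ x ∈ T, Correct m D d T x := by
      obtain ⟨T, hT, hT'⟩ := ih (eqs ++ [e]) (M ++ [z])
        (by
          intro x hx
          obtain rfl | hx := hx
          · simp
          · simp [hKM x hx])
        (List.Subset.trans heqs (List.subset_append_left _ _))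
        (by
          intro ω hω
          have h1 : ∀ e ∈ eqs, e.Holds ω.value := fun e he => hω e (by simp [he])
          refine ⟨(hM ω h1).1, fun i hi => ?_⟩
          obtain hi | rfl : i < M.length ∨ i = M.length := by
            simp at hi
            omega
          · rw [List.getElem_append_left hi]
            exact (hM ω h1).2 i hi
          · rw [List.getElem_concat_length rfl]
            exact he ω h1 (hω e (by simp)))
      obtain ⟨certs, hcerts⟩ := exists_certs heqs _ hobl
      refine ⟨((M.length, eqs, n + 1), c, [], certs) :: T, by simp, ?_⟩
      rw [List.forall_mem_cons]
      refine ⟨⟨hpos, ?_, fun k hk => ?_, hcerts⟩, fun x hx =>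
        (hT' x hx).mono (List.subset_cons_self _ _)⟩
      · simp [EchelonShape, hout]
      · rw [hch k hk]
        refine ⟨by simp, ?_⟩
        rw [List.map_cons]
        rw [List.length_append, List.length_singleton] at hT
        exact List.mem_cons_of_mem _ hT
    cases hz with
    | const b =>
      refine step (.const b) ([[(0, M.length)]], if b then [[]] else []) (fun _ => rfl)
        (by simp [FieldInstr.positions]) rfl
        (by simp [FieldInstr.children, FieldInstr.nextKey]) ?_ (by simp [FieldInstr.obligations])
      intro ω _ h
      cases b <;> simpa [PolyEqn.Holds] using h
    | @arith op x y hx hy hdiv =>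
      obtain ⟨i, hi, rfl⟩ := List.getElem_of_mem (hKM x hx)
      obtain ⟨j, hj, rfl⟩ := List.getElem_of_mem (hKM y hy)
      refine step (.arith op i j) (FieldInstr.arithEqn op M.length i j) (fun _ => rfl)
        (by simp [FieldInstr.positions, hi, hj]) rfl
        (by simp [FieldInstr.children, FieldInstr.nextKey]) ?_ ?_
      · intro ω h1 h
        have h2 := (hM ω h1).2 i hi
        have h3 := (hM ω h1).2 j hj
        cases op <;> simp [PolyEqn.Holds, FieldInstr.arithEqn, h2, h3] at h <;>
          simp only [FieldOp.eval]
        · exact h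
        · exact eq_sub_of_add_eq h
        · exact h
        · exact eq_div_of_mul_eq (hdiv rfl ω (hM ω h1).1) h
      · cases op <;> simp only [FieldInstr.obligations, List.mem_singleton, forall_eq,
          List.not_mem_nil, false_imp_iff, implies_true]
        intro ω h1 h
        exfalso
        refine hdiv rfl ω (hM ω h1).1 ?_
        simpa [PolyEqn.Holds, (hM ω h1).2 j hj] using h
  | @test P K n x hx h₀ h₁ ih₀ ih₁ =>
    intro eqs M hKM heqs hM
    obtain ⟨i, hi, rfl⟩ := List.getElem_of_mem (hKM x hx)
    obtain ⟨T₀, hT₀, hT₀'⟩ := ih₀ (eqs ++ [([[(0, i)]], [])]) M hKM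
      (List.Subset.trans heqs (List.subset_append_left _ _)) (by
        intro ω hω
        have h1 : ∀ e ∈ eqs, e.Holds ω.value := fun e he => hω e (by simp [he])
        have h2 := hω ([[(0, i)]], []) (by simp)
        refine ⟨⟨(hM ω h1).1, ?_⟩, (hM ω h1).2⟩
        simpa [PolyEqn.Holds, (hM ω h1).2 i hi] using h2)
    -- That the tested cell is nonzero is recorded by the equation saying that `(4, i)` is its
    -- inverse.
    obtain ⟨T₁, hT₁, hT₁'⟩ := ih₁ (eqs ++ [([[(0, i), (4, i)]], [[]])]) M hKM
      (List.Subset.trans heqs (List.subset_append_left _ _)) (by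
        intro ω hω
        have h1 : ∀ e ∈ eqs, e.Holds ω.value := fun e he => hω e (by simp [he])
        have h2 := hω ([[(0, i), (4, i)]], [[]]) (by simp)
        refine ⟨⟨(hM ω h1).1, fun h0 => ?_⟩, (hM ω h1).2⟩
        simp [PolyEqn.Holds, (hM ω h1).2 i hi] at h2
        rw [h0, zero_mul] at h2
        exact zero_ne_one h2)
    refine ⟨((M.length, eqs, n + 1), .isZero i, [], []) :: (T₀ ++ T₁), by simp, ?_⟩
    simp only [List.forall_mem_cons, List.forall_mem_append]
    refine ⟨⟨by simp [FieldInstr.positions, hi], by simp [EchelonShape, FieldInstr.outputs], ?_,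
      by simp [FieldInstr.obligations]⟩, fun x hx => (hT₀' x hx).mono (by simp),
      fun x hx => (hT₁' x hx).mono (by simp)⟩
    intro k hk
    simp only [FieldInstr.children, FieldInstr.nextKey, List.mem_cons, List.not_mem_nil,
      or_false] at hk
    obtain rfl | rfl := hk
    · exact ⟨by simp, by simpa using Or.inr (by simpa using hT₁)⟩
    · exact ⟨by simp, by simpa using Or.inl (by simpa using hT₀)⟩

end Completeness

end CertProgram

/-! ### Computability of the correctness of programs -/

section Primrec

variable {α σ : Type*} [Primcodable α] [Primcodable σ]

theorem primrec_descFactorial : Primrec₂ Nat.descFactorial := by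
  refine (Primrec.nat_rec' (f := fun a : ℕ × ℕ => a.2) (g := fun _ => 1)
    (h := fun a x => (a.1 - x.1) * x.2) Primrec.snd (Primrec.const 1)
    (Primrec.nat_mul.comp (Primrec.nat_sub.comp (Primrec.fst.comp Primrec.fst)
      (Primrec.fst.comp Primrec.snd)) (Primrec.snd.comp Primrec.snd))).of_eq fun a => ?_
  obtain ⟨n, k⟩ := a
  induction k with
  | zero => rfl
  | succ k ih => exact congrArg ((n - k) * ·) ih

theorem primrec_factorial : Primrec Nat.factorial :=
  (primrec_descFactorial.comp Primrec.id Primrec.id).of_eq Nat.descFactorial_self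

theorem primrec_nat_pow : Primrec₂ fun a b : ℕ => a ^ b := by
  refine (Primrec.nat_rec' (f := fun a : ℕ × ℕ => a.2) (g := fun _ => 1)
    (h := fun a x => x.2 * a.1) Primrec.snd (Primrec.const 1)
    (Primrec.nat_mul.comp (Primrec.snd.comp Primrec.snd)
      (Primrec.fst.comp Primrec.fst))).of_eq fun a => ?_
  obtain ⟨n, k⟩ := a
  induction k with
  | zero => rfl
  | succ k ih => exact congrArg (· * n) ih

theorem primrec_natLog_two : Primrec (Nat.log 2) := by
  have h : PrimrecRel fun n k : ℕ => 2 ^ k ≤ n :=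
    Primrec.nat_le.comp (primrec_nat_pow.comp (Primrec.const 2) Primrec.snd) Primrec.fst
  refine (Primrec.nat_findGreatest Primrec.id h).of_eq fun n => ?_
  rcases Nat.eq_zero_or_pos n with rfl | hn
  · simp
  rw [Nat.findGreatest_eq_iff]
  exact ⟨Nat.log_le_self 2 n, fun _ => Nat.pow_log_le_self 2 hn.ne', fun k hk _ h =>
    absurd (Nat.le_log_of_pow_le one_lt_two h) (by omega)⟩

theorem primrec_rowPoly {m D d e : α → ℕ} {φ : α → List EqVar} (hm : Primrec m) (hD : Primrec D)
    (hd : Primrec d) (he : Primrec e) (hφ : Primrec φ) :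
    Primrec fun a => rowPoly (m a) (D a) (d a) (e a) (φ a) := by
  unfold rowPoly
  refine Primrec.list_append.comp (Primrec.ite (Primrec.nat_le.comp he hD) ?_ (Primrec.const [])) ?_
  · exact Primrec.list_cons.comp (Primrec.list_cons.comp ((Primrec.const 0).pair he)
      (Primrec.const [])) (Primrec.const [])
  refine Primrec.list_flatMap (Primrec.list_range.comp (Primrec.succ.comp hd)) ?_
  refine Primrec.list_flatMap (Primrec.list_range.comp (Primrec.succ.comp (hm.comp Primrec.fst))) ?_
  have hei : Primrec fun p : (α × ℕ) × ℕ => e p.1.1 + p.2 :=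
    Primrec.nat_add.comp (he.comp (Primrec.fst.comp Primrec.fst)) Primrec.snd
  have hj : Primrec fun p : (α × ℕ) × ℕ => p.1.2 := Primrec.snd.comp Primrec.fst
  have hD' : Primrec fun p : (α × ℕ) × ℕ => D p.1.1 := hD.comp (Primrec.fst.comp Primrec.fst)
  refine Primrec.ite ((Primrec.nat_le.comp hj hei).and
    (Primrec.nat_le.comp (Primrec.nat_sub.comp hei hj) hD')) ?_ (Primrec.const [])
  refine Primrec.list_map (Primrec.list_range.comp (primrec_descFactorial.comp hj Primrec.snd)) ?_
  refine Primrec.comp (f := fun p : (α × ℕ) × ℕ => ([(0, (p.2 + 1) * (D p.1.1 + 1) +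
    (e p.1.1 + p.2 - p.1.2)), (φ p.1.1).getD p.1.2 (0, 0)] : List EqVar)) ?_ Primrec.fst
  refine Primrec.list_cons.comp ((Primrec.const 0).pair (Primrec.nat_add.comp
    (Primrec.nat_mul.comp (Primrec.succ.comp Primrec.snd) (Primrec.succ.comp hD'))
    (Primrec.nat_sub.comp hei hj))) (Primrec.list_cons.comp ?_ (Primrec.const []))
  exact (Primrec.list_getD ((0, 0) : EqVar)).comp (hφ.comp (Primrec.fst.comp Primrec.fst)) hj

theorem primrec_variables (k : ℕ) {w : α → List ℕ} (hw : Primrec w) :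
    Primrec fun a => (w a).map fun i => ((k, i) : EqVar) :=
  Primrec.list_map hw ((Primrec.const k).pair Primrec.snd)

theorem primrec_singleton {f : α → σ} (hf : Primrec f) : Primrec fun a => [f a] :=
  Primrec.list_cons.comp hf (Primrec.const [])

theorem primrec_systemEqns {m D d : α → ℕ} (hm : Primrec m) (hD : Primrec D) (hd : Primrec d) :
    Primrec fun a => systemEqns (m a) (D a) (d a) := by
  refine Primrec.list_map (Primrec.list_range.comp (Primrec.succ.comp (Primrec.nat_add.comp hD hd)))
    (Primrec.pair ?_ (Primrec.const []))
  exact primrec_rowPoly (hm.comp Primrec.fst) (hD.comp Primrec.fst) (hd.comp Primrec.fst)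
    Primrec.snd (primrec_variables 2 (Primrec.list_range.comp (Primrec.succ.comp
      (hd.comp Primrec.fst))))

theorem primrec_memberImpls {m D d : α → ℕ} {o : α → List (List ℕ)} (hm : Primrec m)
    (hD : Primrec D) (hd : Primrec d) (ho : Primrec o) :
    Primrec fun a => memberImpls (m a) (D a) (d a) (o a) := by
  refine Primrec.list_flatMap ho (Primrec.list_map (Primrec.list_range.comp (Primrec.succ.comp
    (Primrec.nat_add.comp (hD.comp Primrec.fst) (hd.comp Primrec.fst)))) ?_)
  have h : Primrec fun p : (α × List ℕ) × ℕ => p.1.1 := Primrec.fst.comp Primrec.fst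
  exact (Primrec.const []).pair ((primrec_rowPoly (hm.comp h) (hD.comp h) (hd.comp h) Primrec.snd
    (primrec_variables 0 (Primrec.snd.comp Primrec.fst))).pair (Primrec.const []))

theorem primrec_getD_getD {o : α → List (List ℕ)} {k j : α → ℕ} (ho : Primrec o)
    (hk : Primrec k) (hj : Primrec j) : Primrec fun a => ((o a).getD (k a) []).getD (j a) 0 :=
  (Primrec.list_getD 0).comp ((Primrec.list_getD []).comp ho hk) hj

theorem primrec_pivotImpls {o : α → List (List ℕ)} {piv : α → List ℕ} (ho : Primrec o)
    (hpiv : Primrec piv) : Primrec fun a => pivotImpls (o a) (piv a) := by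
  refine Primrec.list_flatMap (Primrec.list_range.comp (Primrec.list_length.comp ho))
    (Primrec.list_map (Primrec.list_range.comp (Primrec.list_length.comp (hpiv.comp Primrec.fst)))
      ((Primrec.const []).pair (Primrec.pair (primrec_singleton (primrec_singleton
        ((Primrec.const 0).pair ?_))) ?_)))
  · exact primrec_getD_getD (ho.comp (Primrec.fst.comp Primrec.fst)) (Primrec.snd.comp Primrec.fst)
      ((Primrec.list_getD 0).comp (hpiv.comp (Primrec.fst.comp Primrec.fst)) Primrec.snd)
  · exact Primrec.ite (Primrec.eq.comp (Primrec.snd.comp Primrec.fst)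
      (Primrec.succ.comp Primrec.snd)) (Primrec.const _) (Primrec.const _)

theorem primrec_spanImpls {m D d : α → ℕ} {o : α → List (List ℕ)} {piv : α → List ℕ}
    (hm : Primrec m) (hD : Primrec D) (hd : Primrec d) (ho : Primrec o) (hpiv : Primrec piv) :
    Primrec fun a => spanImpls (m a) (D a) (d a) (o a) (piv a) := by
  have hs := primrec_systemEqns hm hD hd
  refine Primrec.ite (Primrec.eq.comp ho (Primrec.const []))
    (primrec_singleton (hs.pair (Primrec.const _))) ?_
  refine Primrec.list_map (Primrec.list_range.comp (Primrec.succ.comp hd))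
    ((hs.comp Primrec.fst).pair (Primrec.pair ?_ ?_))
  · refine Primrec.list_cons.comp (primrec_singleton ((Primrec.const 2).pair Primrec.snd))
      (Primrec.list_map (Primrec.list_range.comp (Primrec.list_length.comp (hpiv.comp Primrec.fst)))
        (Primrec.list_cons.comp ((Primrec.const 2).pair ?_)
          (primrec_singleton ((Primrec.const 0).pair ?_))))
    · exact (Primrec.list_getD 0).comp (hpiv.comp (Primrec.fst.comp Primrec.fst)) Primrec.snd
    · exact primrec_getD_getD (ho.comp (Primrec.fst.comp Primrec.fst)) (Primrec.const 0)
        (Primrec.snd.comp Primrec.fst)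
  · refine Primrec.list_cons.comp (primrec_singleton ((Primrec.const 0).pair ?_))
      (Primrec.list_map (Primrec.list_range.comp (Primrec.list_length.comp (hpiv.comp Primrec.fst)))
        (Primrec.list_cons.comp ((Primrec.const 2).pair ?_)
          (primrec_singleton ((Primrec.const 0).pair ?_))))
    · exact primrec_getD_getD (ho.comp Primrec.fst) (Primrec.const 0) Primrec.snd
    · exact (Primrec.list_getD 0).comp (hpiv.comp (Primrec.fst.comp Primrec.fst)) Primrec.snd
    · exact primrec_getD_getD (ho.comp (Primrec.fst.comp Primrec.fst))
        (Primrec.succ.comp Primrec.snd) (Primrec.snd.comp Primrec.fst)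

theorem primrec_echelonImpls {m D d : α → ℕ} {o : α → List (List ℕ)} {piv : α → List ℕ}
    (hm : Primrec m) (hD : Primrec D) (hd : Primrec d) (ho : Primrec o) (hpiv : Primrec piv) :
    Primrec fun a => echelonImpls (m a) (D a) (d a) (o a) (piv a) :=
  Primrec.list_append.comp (primrec_memberImpls hm hD hd ho) (Primrec.list_append.comp
    (primrec_pivotImpls ho hpiv) (primrec_spanImpls hm hD hd ho hpiv))

theorem primrec_negation : Primrec PolyEqn.negation := by
  have h (f : PolyEqn → NatPoly) (hf : Primrec f) :
      Primrec fun e : PolyEqn => (f e).map fun l => ((3, 1) : EqVar) :: l :=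
    Primrec.list_map hf (Primrec.list_cons.comp (Primrec.const _) Primrec.snd)
  exact (h _ Primrec.fst).pair (Primrec.list_cons.comp (Primrec.const []) (h _ Primrec.snd))

theorem primrecPred_echelonShape {d : α → ℕ} {o : α → List (List ℕ)} {piv : α → List ℕ}
    (hd : Primrec d) (ho : Primrec o) (hpiv : Primrec piv) :
    PrimrecPred fun a => EchelonShape (d a) (o a) (piv a) := by
  have h1 : PrimrecRel fun (w : List ℕ) (d : ℕ) => w.length = d + 1 :=
    Primrec.eq.comp (Primrec.list_length.comp Primrec.fst) (Primrec.succ.comp Primrec.snd)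
  refine (h1.forall_mem_list.comp ho hd).and ((Primrec.eq.comp ho (Primrec.const [])).or
    ((Primrec.eq.comp (Primrec.list_length.comp ho) (Primrec.succ.comp
      (Primrec.list_length.comp hpiv))).and (Primrec.nat_le.forall_mem_list.comp hpiv hd)))

/-- There are only four arithmetic operations, so it suffices that `f₂` is primitive recursive for
each of them separately. -/
theorem primrec_fieldInstr_casesOn {c : α → FieldInstr} {f₁ : α → Bool → σ}
    {f₂ : FieldOp → α → ℕ × ℕ → σ} {f₃ : α → ℕ → σ} {f₄ : α → List (List ℕ) → σ}
    (hc : Primrec c) (h₁ : Primrec₂ f₁) (h₂ : ∀ op, Primrec₂ (f₂ op)) (h₃ : Primrec₂ f₃)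
    (h₄ : Primrec₂ f₄) :
    Primrec fun a => match c a with
      | .const b => f₁ a b
      | .arith op i j => f₂ op a (i, j)
      | .isZero i => f₃ a i
      | .output o => f₄ a o := by
  have he : Primrec FieldInstr.equivSum := Primrec.of_equiv
  have h₂' : Primrec₂ fun (a : α) (x : Fin 4 × ℕ × ℕ) =>
      if x.1 = 0 then f₂ .add a x.2 else if x.1 = 1 then f₂ .sub a x.2 else
        if x.1 = 2 then f₂ .mul a x.2 else f₂ .div a x.2 := by
    have h (k : Fin 4) : PrimrecPred fun x : α × Fin 4 × ℕ × ℕ => x.2.1 = k :=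
      Primrec.eq.comp (Primrec.fst.comp Primrec.snd) (Primrec.const k)
    have h' (op : FieldOp) : Primrec fun x : α × Fin 4 × ℕ × ℕ => f₂ op x.1 x.2.2 :=
      (h₂ op).comp Primrec.fst (Primrec.snd.comp Primrec.snd)
    exact Primrec.ite (h 0) (h' _) (Primrec.ite (h 1) (h' _) (Primrec.ite (h 2) (h' _) (h' _)))
  have h₃₄ : Primrec₂ fun (a : α) (x : ℕ ⊕ List (List ℕ)) =>
      (Sum.casesOn x (f₃ a) (f₄ a) : σ) :=
    Primrec.sumCasesOn Primrec.snd (h₃.comp (Primrec.fst.comp Primrec.fst) Primrec.snd)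
      (h₄.comp (Primrec.fst.comp Primrec.fst) Primrec.snd)
  have h₂₃₄ : Primrec₂ fun (a : α) (x : (Fin 4 × ℕ × ℕ) ⊕ ℕ ⊕ List (List ℕ)) =>
      (Sum.casesOn x (fun x : Fin 4 × ℕ × ℕ =>
        if x.1 = 0 then f₂ .add a x.2 else if x.1 = 1 then f₂ .sub a x.2 else
        if x.1 = 2 then f₂ .mul a x.2 else f₂ .div a x.2) (fun x : ℕ ⊕ List (List ℕ) =>
          (Sum.casesOn x (f₃ a) (f₄ a) : σ)) : σ) :=
    Primrec.sumCasesOn Primrec.snd (h₂'.comp (Primrec.fst.comp Primrec.fst) Primrec.snd)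
      (h₃₄.comp (Primrec.fst.comp Primrec.fst) Primrec.snd)
  refine (Primrec.sumCasesOn (he.comp hc) h₁ h₂₃₄).of_eq fun a => ?_
  cases c a with
  | arith op i j => cases op <;> rfl
  | _ => rfl

open FieldInstr

theorem primrec_positions : Primrec positions := by
  refine (primrec_fieldInstr_casesOn (f₁ := fun _ _ => []) (f₂ := fun _ _ x => [x.1, x.2])
    (f₃ := fun _ i => [i]) (f₄ := fun _ o => o.flatten) Primrec.id (Primrec.const [])
    (fun _ => ?_) ?_ ?_).of_eq fun c => ?_
  · exact Primrec.list_cons.comp (Primrec.fst.comp Primrec.snd)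
      (primrec_singleton (Primrec.snd.comp Primrec.snd))
  · exact primrec_singleton Primrec.snd
  · exact Primrec.list_flatten.comp Primrec.snd
  · cases c <;> rfl

theorem primrec_outputs : Primrec outputs := by
  refine (primrec_fieldInstr_casesOn (f₁ := fun _ _ => []) (f₂ := fun _ _ _ => [])
    (f₃ := fun _ _ => []) (f₄ := fun _ o => o) Primrec.id (Primrec.const [])
    (fun _ => Primrec.const []) (Primrec.const []) Primrec.snd).of_eq fun c => ?_
  cases c <;> rfl

theorem primrec_arithEqn (op : FieldOp) {ℓ i j : α → ℕ} (hℓ : Primrec ℓ) (hi : Primrec i)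
    (hj : Primrec j) : Primrec fun a => arithEqn op (ℓ a) (i a) (j a) := by
  have h {i : α → ℕ} (hi : Primrec i) : Primrec fun a => ((0, i a) : EqVar) :=
    (Primrec.const 0).pair hi
  cases op with
  | add => exact (primrec_singleton (primrec_singleton (h hℓ))).pair (Primrec.list_cons.comp
      (primrec_singleton (h hi)) (primrec_singleton (primrec_singleton (h hj))))
  | sub => exact (Primrec.list_cons.comp (primrec_singleton (h hℓ)) (primrec_singleton
      (primrec_singleton (h hj)))).pair (primrec_singleton (primrec_singleton (h hi)))
  | mul => exact (primrec_singleton (primrec_singleton (h hℓ))).pair (primrec_singleton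
      (Primrec.list_cons.comp (h hi) (primrec_singleton (h hj))))
  | div =>
    exact (primrec_singleton (Primrec.list_cons.comp (h hℓ) (primrec_singleton (h hj)))).pair
      (primrec_singleton (primrec_singleton (h hi)))

theorem primrec_nextKey {k : α → ProgKey} {c : α → FieldInstr} {b : α → Bool} (hk : Primrec k)
    (hc : Primrec c) (hb : Primrec b) : Primrec fun a => nextKey (k a) (c a) (b a) := by
  have h1 {β : Type} [Primcodable β] : Primrec fun x : α × β => (k x.1).1 :=
    Primrec.fst.comp (hk.comp Primrec.fst)
  have h2 {β : Type} [Primcodable β] : Primrec fun x : α × β => (k x.1).2.1 :=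
    Primrec.fst.comp (Primrec.snd.comp (hk.comp Primrec.fst))
  have h3 {β : Type} [Primcodable β] : Primrec fun x : α × β => (k x.1).2.2 - 1 :=
    Primrec.pred.comp (Primrec.snd.comp (Primrec.snd.comp (hk.comp Primrec.fst)))
  refine (primrec_fieldInstr_casesOn
    (f₁ := fun a b => ((k a).1 + 1,
      (k a).2.1 ++ [([[(0, (k a).1)]], if b then [[]] else [])], (k a).2.2 - 1))
    (f₂ := fun op a x => ((k a).1 + 1, (k a).2.1 ++ [arithEqn op (k a).1 x.1 x.2], (k a).2.2 - 1))
    (f₃ := fun a i => ((k a).1, (k a).2.1 ++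
      [if b a then ([[(0, i)]], []) else ([[(0, i), (4, i)]], [[]])], (k a).2.2 - 1))
    (f₄ := fun a _ => k a) hc ?_ (fun op => ?_) ?_ (hk.comp Primrec.fst)).of_eq fun a => ?_
  · refine (Primrec.succ.comp h1).pair ((Primrec.list_append.comp h2 (primrec_singleton
      (Primrec.pair (primrec_singleton (primrec_singleton ((Primrec.const 0).pair h1))) ?_))).pair h3)
    exact Primrec.ite (Primrec.eq.comp Primrec.snd (Primrec.const true)) (Primrec.const _)
      (Primrec.const _)
  · exact (Primrec.succ.comp h1).pair ((Primrec.list_append.comp h2 (primrec_singleton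
      (primrec_arithEqn op h1 (Primrec.fst.comp Primrec.snd) (Primrec.snd.comp Primrec.snd)))).pair h3)
  · refine h1.pair ((Primrec.list_append.comp h2 (primrec_singleton (Primrec.ite
      (Primrec.eq.comp (hb.comp Primrec.fst) (Primrec.const true)) ?_ ?_))).pair h3)
    · exact (primrec_singleton (primrec_singleton ((Primrec.const 0).pair Primrec.snd))).pair
        (Primrec.const [])
    · exact (primrec_singleton (Primrec.list_cons.comp ((Primrec.const 0).pair Primrec.snd)
        (primrec_singleton ((Primrec.const 4).pair Primrec.snd)))).pair (Primrec.const _)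
  · cases c a <;> rfl

theorem primrec_children {k : α → ProgKey} {c : α → FieldInstr} (hk : Primrec k)
    (hc : Primrec c) : Primrec fun a => children (k a) (c a) := by
  have h : Primrec fun a => [nextKey (k a) (c a) false, nextKey (k a) (c a) true] :=
    Primrec.list_cons.comp (primrec_nextKey hk hc (Primrec.const _))
      (primrec_singleton (primrec_nextKey hk hc (Primrec.const _)))
  refine (primrec_fieldInstr_casesOn
    (f₁ := fun a _ => [nextKey (k a) (c a) false, nextKey (k a) (c a) true])
    (f₂ := fun _ a _ => [nextKey (k a) (c a) false, nextKey (k a) (c a) true])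
    (f₃ := fun a _ => [nextKey (k a) (c a) false, nextKey (k a) (c a) true])
    (f₄ := fun _ _ => []) hc (h.comp Primrec.fst) (fun _ => h.comp Primrec.fst)
    (h.comp Primrec.fst) (Primrec.const [])).of_eq fun a => ?_
  cases c a <;> rfl

theorem primrec_obligations {m D d : α → ℕ} {piv : α → List ℕ} {c : α → FieldInstr}
    (hm : Primrec m) (hD : Primrec D) (hd : Primrec d) (hpiv : Primrec piv) (hc : Primrec c) :
    Primrec fun a => obligations (m a) (D a) (d a) (piv a) (c a) := by
  refine (primrec_fieldInstr_casesOn (f₁ := fun _ _ => [])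
    -- The obligations of an arithmetic operation do not depend on the parameters, so arbitrary ones
    -- can be inserted.
    (f₂ := fun op _ x => obligations 0 0 0 [] (.arith op x.1 x.2))
    (f₃ := fun _ _ => []) (f₄ := fun a o => echelonImpls (m a) (D a) (d a) o (piv a)) hc
    (Primrec.const []) (fun op => ?_) (Primrec.const [])
    (primrec_echelonImpls (hm.comp Primrec.fst) (hD.comp Primrec.fst) (hd.comp Primrec.fst)
      Primrec.snd (hpiv.comp Primrec.fst))).of_eq fun a => ?_
  · cases op with
    | div => exact primrec_singleton ((primrec_singleton ((primrec_singleton (primrec_singleton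
        ((Primrec.const 0).pair (Primrec.snd.comp Primrec.snd)))).pair (Primrec.const _))).pair
        (Primrec.const _))
    | _ => exact Primrec.const []
  · cases c a with
    | arith op i j => cases op <;> rfl
    | _ => rfl

namespace CertProgram

theorem primrec_inputEqns {m D d : α → ℕ} (hm : Primrec m) (hD : Primrec D) (hd : Primrec d) :
    Primrec fun a => inputEqns (m a) (D a) (d a) := by
  have hN : Primrec fun a => (m a + 2) * (D a + 1) :=
    Primrec.nat_mul.comp (Primrec.nat_add.comp hm (Primrec.const 2)) (Primrec.succ.comp hD)
  refine Primrec.list_cons.comp (Primrec.pair (Primrec.list_map (Primrec.list_range.comp hN) ?_)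
    (Primrec.const _)) (primrec_singleton (Primrec.pair (Primrec.list_map
      (Primrec.list_range.comp (primrec_factorial.comp hd)) (Primrec.const _)) (Primrec.const _)))
  exact Primrec.list_cons.comp ((Primrec.const 1).pair Primrec.snd)
    (primrec_singleton ((Primrec.const 0).pair Primrec.snd))

theorem primrecPred_keys {T : α → CertProgram} {n : α → ℕ} {ks : α → List ProgKey}
    (hT : Primrec T) (hn : Primrec n) (hks : Primrec ks) :
    PrimrecPred fun a => ∀ k ∈ ks a, n a ≠ 0 ∧ k ∈ (T a).map Prod.fst := by
  have hmem : PrimrecRel fun (k : ProgKey) (y : ℕ × CertProgram) =>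
      y.1 ≠ 0 ∧ k ∈ y.2.map Prod.fst := by
    have heq : PrimrecRel fun (x : ProgNode) (k : ProgKey) => x.1 = k :=
      (Primrec.eq (α := ProgKey)).comp (Primrec.fst.comp Primrec.fst) Primrec.snd
    refine PrimrecPred.and (Primrec.eq.comp (Primrec.fst.comp Primrec.snd) (Primrec.const 0)).not ?_
    refine (heq.exists_mem_list.comp (Primrec.snd.comp Primrec.snd) Primrec.fst).of_eq fun a => ?_
    simp
  exact hmem.forall_mem_list.comp hks (hn.pair hT)

theorem primrecPred_forall_exists {β γ δ : Type*} [Primcodable β] [Primcodable γ]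
    [Primcodable δ] {S : α → List β} {C : α → List γ} {e : α → δ} {R : γ → β × δ → Prop}
    (hR : PrimrecRel R) (hS : Primrec S) (hC : Primrec C) (he : Primrec e) :
    PrimrecPred fun a => ∀ s ∈ S a, ∃ c ∈ C a, R c (s, e a) := by
  have h : PrimrecRel fun (s : β) (y : List γ × δ) => ∃ c ∈ y.1, R c (s, y.2) :=
    hR.exists_mem_list.comp (Primrec.fst.comp Primrec.snd)
      (Primrec.fst.pair (Primrec.snd.comp Primrec.snd))
  exact h.forall_mem_list.comp hS (hC.pair he)

theorem primrec_obligationEqns : Primrec fun y : PolyImpl × List PolyEqn =>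
    y.2 ++ (y.1.1 ++ [y.1.2.negation]) :=
  Primrec.list_append.comp Primrec.snd (Primrec.list_append.comp (Primrec.fst.comp Primrec.fst)
    (primrec_singleton (primrec_negation.comp (Primrec.snd.comp Primrec.fst))))

theorem primrecPred_certs {eqs : α → List PolyEqn} {S : α → List PolyImpl}
    {certs : α → List UnitCert} (heqs : Primrec eqs) (hS : Primrec S) (hcerts : Primrec certs) :
    PrimrecPred fun a => ∀ s ∈ S a, ∃ c ∈ certs a,
      UnitCert.Valid (eqs a ++ (s.1 ++ [s.2.negation])) c := by
  have hcert : PrimrecRel fun (c : UnitCert) (y : PolyImpl × List PolyEqn) =>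
      UnitCert.Valid (y.2 ++ (y.1.1 ++ [y.1.2.negation])) c :=
    primrecRel_unitCert_valid.comp (primrec_obligationEqns.comp Primrec.snd) Primrec.fst
  exact primrecPred_forall_exists hcert hS hcerts heqs

theorem primrecPred_correct {m D d : α → ℕ} {T : α → CertProgram} {x : α → ProgNode}
    (hm : Primrec m) (hD : Primrec D) (hd : Primrec d) (hT : Primrec T) (hx : Primrec x) :
    PrimrecPred fun a => Correct (m a) (D a) (d a) (T a) (x a) := by
  have hk : Primrec fun a => (x a).1 := Primrec.fst.comp hx
  have hy : Primrec fun a => (x a).2 := Primrec.snd.comp hx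
  have hc : Primrec fun a => (x a).2.1 := Primrec.fst.comp hy
  have hpiv : Primrec fun a => (x a).2.2.1 := Primrec.fst.comp (Primrec.snd.comp hy)
  have hcerts : Primrec fun a => (x a).2.2.2 := Primrec.snd.comp (Primrec.snd.comp hy)
  have h1 : PrimrecPred fun a => ∀ i ∈ (x a).2.1.positions, i < (x a).1.1 :=
    Primrec.nat_lt.forall_mem_list.comp (primrec_positions.comp hc) (Primrec.fst.comp hk)
  have h2 := primrecPred_echelonShape hd (primrec_outputs.comp hc) hpiv
  have h3 := primrecPred_keys hT (Primrec.snd.comp (Primrec.snd.comp hk)) (primrec_children hk hc)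
  have h4 := primrecPred_certs (Primrec.fst.comp (Primrec.snd.comp hk))
    (primrec_obligations hm hD hd hpiv hc) hcerts
  exact h1.and (h2.and (h3.and h4))

set_option synthInstance.maxSize 1000 in
theorem primrec_instrAt : Primrec₂ instrAt := by
  have h : Primrec fun a : CertProgram × ProgKey => a.1.lookup a.2 := by
    refine (Primrec.listLookup.comp Primrec.snd Primrec.fst).of_eq fun a => ?_
    congr 1
    exact lawful_beq_subsingleton _ _
  exact Primrec.fst.comp (Primrec.option_getD.comp h (Primrec.const _))

end CertProgram

end Primrec

/-! ### The algorithm: search for a correct program and run it -/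

namespace CertProgram

/-- The number of operations of the algorithm. -/
def opBound (m D d : ℕ) : ℕ :=
  720 * (m + 1) ^ 2 * 2 ^ (Nat.log 2 (D + d + 1) + 1) * (Nat.log 2 (D + d + 1) + 1 + 1) ^ 3

/-- The stage at which the algorithm starts. -/
def inputKey (m D d : ℕ) : ProgKey := ((m + 2) * (D + 1), inputEqns m D d, opBound m D d)

/-- The program solves the problem with the parameters `p`. -/
def IsSolution (p : ℕ × ℕ × ℕ) (T : CertProgram) : Prop :=
  inputKey p.1 p.2.1 p.2.2 ∈ T.map Prod.fst ∧ ∀ x ∈ T, Correct p.1 p.2.1 p.2.2 T x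

theorem eval_inputEqns {F : Type*} [Field F] {m D d : ℕ} {v : EqVar → F} :
    (∀ e ∈ inputEqns m D d, e.Holds v) ↔
      ∑ i ∈ Finset.range ((m + 2) * (D + 1)), v (1, i) * v (0, i) = 1 ∧
        (d.factorial : F) * v (3, 0) = 1 := by
  have hsum (n : ℕ) (g : ℕ → F) : ((List.range n).map g).sum = ∑ j ∈ Finset.range n, g j := by
    rw [← List.sum_toFinset _ List.nodup_range, List.toFinset_range]
  simp only [inputEqns, List.forall_mem_cons, List.not_mem_nil, false_imp_iff, implies_true,
    and_true, PolyEqn.Holds, List.map_const', NatPoly.eval_replicate]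
  simp [NatPoly.eval, hsum, Function.comp_def]

/-- `solves_system` is applied with `Ω` the type of all points, that is, all admissible inputs over
all fields. The initial equations supply both of its hypotheses: a combination of the input entries
equals `1`, and `d!` has an inverse. -/
theorem exists_isSolution (p : ℕ × ℕ × ℕ) : ∃ T, IsSolution p T := by
  obtain ⟨m, D, d⟩ := p
  set N := (m + 2) * (D + 1) with hN
  have hω (ω : Point m D d) := eval_inputEqns.1 ω.holds
  have h := solves_system (m := m) (d := d) (D := D) (l := Nat.log 2 (D + d + 1) + 1)
    (F := fun ω : Point m D d => ω.carrier) (x := fun i ω => ω.value (0, i))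
    (fun ω h0 => by simpa [h0] using (hω ω).2)
    (fun ω => by
      by_contra! h0
      have h1 := (hω ω).1
      rw [Finset.sum_eq_zero fun i hi => by rw [h0 i (Finset.mem_range.1 hi), mul_zero]] at h1
      exact zero_ne_one h1)
    (Nat.lt_pow_succ_log_self one_lt_two _).le
  obtain ⟨T, hT, hT'⟩ := exists_correct h (inputEqns m D d)
    ((List.range N).map fun i ω => ω.value (0, i))
    (by
      rintro _ ⟨i, hi, rfl⟩
      exact List.mem_map_of_mem (List.mem_range.2 hi))
    (List.Subset.refl _) (fun ω _ => ⟨trivial, by simp⟩)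
  refine ⟨T, ?_, hT'⟩
  rwa [List.length_map, List.length_range] at hT

variable {α : Type*} [Primcodable α]

theorem primrec_inputKey {m D d : α → ℕ} (hm : Primrec m) (hD : Primrec D) (hd : Primrec d) :
    Primrec fun a => inputKey (m a) (D a) (d a) := by
  have hl : Primrec fun a => Nat.log 2 (D a + d a + 1) + 1 :=
    Primrec.succ.comp (primrec_natLog_two.comp (Primrec.succ.comp (Primrec.nat_add.comp hD hd)))
  have hN : Primrec fun a => (m a + 2) * (D a + 1) :=
    Primrec.nat_mul.comp (Primrec.nat_add.comp hm (Primrec.const 2)) (Primrec.succ.comp hD)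
  have hbound : Primrec fun a => opBound (m a) (D a) (d a) :=
    Primrec.nat_mul.comp (Primrec.nat_mul.comp (Primrec.nat_mul.comp (Primrec.const 720)
      (primrec_nat_pow.comp (Primrec.succ.comp hm) (Primrec.const 2)))
        (primrec_nat_pow.comp (Primrec.const 2) hl))
      (primrec_nat_pow.comp (Primrec.succ.comp hl) (Primrec.const 3))
  exact hN.pair ((primrec_inputEqns hm hD hd).pair hbound)

theorem primrecRel_isSolution : PrimrecRel IsSolution := by
  have hp : Primrec fun a : (ℕ × ℕ × ℕ) × CertProgram => a.1 := Primrec.fst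
  have hm := Primrec.fst.comp hp
  have hD := Primrec.fst.comp (Primrec.snd.comp hp)
  have hd := Primrec.snd.comp (Primrec.snd.comp hp)
  -- A one-element list and the true condition `1 ≠ 0` bring membership of the initial stage into
  -- the form of `primrecPred_keys`.
  have h1 : PrimrecPred fun a : (ℕ × ℕ × ℕ) × CertProgram =>
      ∀ k ∈ [inputKey a.1.1 a.1.2.1 a.1.2.2], 1 ≠ 0 ∧ k ∈ a.2.map Prod.fst :=
    primrecPred_keys Primrec.snd (Primrec.const 1) (primrec_singleton (primrec_inputKey hm hD hd))
  have h2 : PrimrecRel fun (x : ProgNode) (a : (ℕ × ℕ × ℕ) × CertProgram) =>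
      Correct a.1.1 a.1.2.1 a.1.2.2 a.2 x :=
    primrecPred_correct (hm.comp Primrec.snd) (hD.comp Primrec.snd) (hd.comp Primrec.snd)
      (Primrec.snd.comp Primrec.snd) Primrec.fst
  refine (h1.and (h2.forall_mem_list.comp Primrec.snd Primrec.id)).of_eq fun a => ?_
  simp [IsSolution]

/-- Unbounded search through all codes of programs. The test is primitive recursive, and the search
halts because a solution exists for all parameters. -/
theorem exists_computable_isSolution :
    ∃ s : ℕ × ℕ × ℕ → CertProgram, Computable s ∧ ∀ p, IsSolution p (s p) := by
  classical
  set f : ℕ × ℕ × ℕ → ℕ → Option CertProgram := fun p n =>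
    (Encodable.decode n).bind fun T : CertProgram => if IsSolution p T then some T else none with hf
  have hfc : Primrec₂ f := by
    refine Primrec.option_bind (Primrec.decode.comp Primrec.snd) ?_
    exact Primrec.ite (primrecRel_isSolution.comp (Primrec.fst.comp Primrec.fst) Primrec.snd)
      (Primrec.option_some.comp Primrec.snd) (Primrec.const none)
  have hspec (p : ℕ × ℕ × ℕ) (T : CertProgram) (h : T ∈ Nat.rfindOpt (f p)) : IsSolution p T := by
    obtain ⟨n, hn⟩ := Nat.rfindOpt_spec h
    simp only [hf, Option.mem_def, Option.bind_eq_some_iff] at hn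
    obtain ⟨T', -, hT'⟩ := hn
    split_ifs at hT' with h'
    · cases hT'
      exact h'
  have hdom (p : ℕ × ℕ × ℕ) : (Nat.rfindOpt (f p)).Dom := by
    obtain ⟨T, hT⟩ := exists_isSolution p
    refine Nat.rfindOpt_dom.2 ⟨Encodable.encode T, T, ?_⟩
    simp [hf, hT]
  exact ⟨fun p => (Nat.rfindOpt (f p)).get (hdom p),
    (Partrec.rfindOpt hfc.to_comp).of_eq_tot fun p => Part.get_mem _,
    fun p => hspec p _ (Part.get_mem _)⟩

/-- The algorithm which searches for a correct program and runs it. -/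
noncomputable def searchAlgorithm : FieldAlgorithm where
  State := CertProgram × ProgKey
  init p := (exists_computable_isSolution.choose p, inputKey p.1 p.2.1 p.2.2)
  instr s := instrAt s.1 s.2
  next s b := (s.1, (instrAt s.1 s.2).nextKey s.2 b)
  computable_init := exists_computable_isSolution.choose_spec.1.pair
    (primrec_inputKey Primrec.fst (Primrec.fst.comp Primrec.snd)
      (Primrec.snd.comp Primrec.snd)).to_comp
  computable_instr := primrec_instrAt.to_comp
  computable_next := by
    have h : Primrec fun a : (CertProgram × ProgKey) × Bool => instrAt a.1.1 a.1.2 :=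
      primrec_instrAt.comp (Primrec.fst.comp Primrec.fst) (Primrec.snd.comp Primrec.fst)
    exact ((Primrec.fst.comp Primrec.fst).pair (primrec_nextKey (Primrec.snd.comp Primrec.fst) h
      Primrec.snd)).to_comp

/-- The certificates were obtained from fields in one universe, but they are identities over `ℕ`, so
the run is correct in a field of any universe. -/
theorem searchAlgorithm_runs {F : Type*} [Field F] {m D d : ℕ} (hd : (d.factorial : F) ≠ 0)
    {M : List F} (hM : M.length = (m + 2) * (D + 1)) (hM0 : ∃ x ∈ M, x ≠ 0) :
    ∃ n ≤ opBound m D d, ∃ out piv,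
      searchAlgorithm.Runs (searchAlgorithm.init (m, D, d)) M n out ∧
      IsEchelonBasis d (D + d + 1) (inputFree D fun i => M.getD i 0)
        (rowCoeff m (inputCoeff D fun i => M.getD i 0)) out piv := by
  obtain ⟨hkey, hT⟩ := exists_computable_isSolution.choose_spec.2 (m, D, d)
  set T := exists_computable_isSolution.choose (m, D, d) with hTdef
  obtain ⟨x, hx, hx0⟩ := hM0
  obtain ⟨i₀, hi₀, rfl⟩ := List.getElem_of_mem hx
  -- Values of the auxiliary variables witnessing that the input is nonzero: only one nonzero entry
  -- is used, multiplied by its inverse.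
  set w : ℕ → F := fun i => if i = i₀ then M[i₀]⁻¹ else 0 with hw
  have hinit : searchAlgorithm.init (m, D, d) = (T, (M.length, inputEqns m D d, opBound m D d)) := by
    rw [hM]
    rfl
  rw [inputKey, ← hM] at hkey
  obtain ⟨n, hn, out, piv, M', hMM, hrun, hout⟩ := exists_runs (w := w) hT
    (A := searchAlgorithm) (st := fun k => (T, k)) (fun _ => rfl) (fun _ _ => rfl) _ _ M hkey
    (fun M' hM' f u => by
      refine eval_inputEqns.2 ⟨?_, mul_inv_cancel₀ hd⟩
      rw [Finset.sum_eq_single i₀]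
      · rw [variableValue_cell hM' hi₀]
        simp [variableValue, hw, hx0]
      · intro i _ hi
        simp [variableValue, hw, hi]
      · intro hi
        exact absurd (Finset.mem_range.2 (hi₀.trans_eq hM)) hi)
  refine ⟨n, hn, out, piv, ?_, ?_⟩
  · rw [hinit]
    exact hrun
  -- The system refers to the final memory, but only to input positions, which never change.
  · have hget (i : ℕ) (hi : i < (m + 2) * (D + 1)) : M'.getD i 0 = M.getD i 0 := by
      obtain ⟨t, rfl⟩ := hMM
      have hi' : i < M.length := by omega
      simp [List.getElem?_append_left hi']
    have h1 : (inputFree D fun i => M'.getD i 0) = inputFree D fun i => M.getD i 0 := by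
      funext a
      simp only [inputFree]
      split_ifs with h
      · exact hget a (by nlinarith)
      · rfl
    have h2 : rowCoeff m (inputCoeff D fun i => M'.getD i 0) =
        rowCoeff m (inputCoeff D fun i => M.getD i 0) := by
      funext e j
      refine Finset.sum_congr rfl fun i hi => ?_
      have hi := Finset.mem_range.1 hi
      simp only [inputCoeff]
      split_ifs with h h'
      · rw [hget _ (by nlinarith)]
      · rfl
      · rfl
    rwa [h1, h2] at hout

end CertProgram

/-! ### Linear differential equations and systems for the coefficients -/

namespace LinDiffPoly

variable {F : Type*} [Field F] {m : ℕ}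

/-- The coefficient of `x ^ a` in `Qᵢ`. -/
noncomputable def coeffAt (Q : LinDiffPoly F m) (i a : ℕ) : F :=
  ((List.ofFn Q.coeff).getD i 0).coeff a

theorem coeffAt_fin (Q : LinDiffPoly F m) (i : Fin (m + 1)) (a : ℕ) :
    Q.coeffAt i a = (Q.coeff i).coeff a := by
  rw [coeffAt, List.getD_eq_getElem _ _ (by rw [List.length_ofFn]; exact i.2), List.getElem_ofFn]

/-- The linear part `f ↦ ∑ i, Qᵢ f⁽ⁱ⁾` of `Q`. -/
noncomputable def linearPart (Q : LinDiffPoly F m) : F[X] →ₗ[F] F[X] :=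
  ∑ i : Fin (m + 1), LinearMap.mulLeft F (Q.coeff i) ∘ₗ derivative ^ (i : ℕ)

theorem linearPart_apply (Q : LinDiffPoly F m) (f : F[X]) :
    Q.linearPart f = ∑ i : Fin (m + 1), Q.coeff i * derivative^[(i : ℕ)] f := by
  simp [linearPart, Module.End.pow_apply]

theorem subst_eq (Q : LinDiffPoly F m) (f : F[X]) : Q.subst f = Q.free + Q.linearPart f := by
  simp [subst, toMvPolynomial, linearPart_apply]

theorem _root_.Polynomial.iterate_derivative_monomial (i j : ℕ) (c : F) :
    derivative^[i] (monomial j c) = monomial (j - i) (j.descFactorial i * c) := by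
  induction i with
  | zero => simp
  | succ i ih =>
    rw [Function.iterate_succ_apply', ih, derivative_monomial, Nat.descFactorial_succ, Nat.cast_mul]
    congr 1
    ring

theorem coeff_linearPart_monomial (Q : LinDiffPoly F m) (e j : ℕ) (c : F) :
    (Q.linearPart (monomial j c)).coeff e = rowCoeff m Q.coeffAt e j * c := by
  rw [linearPart_apply, finsetSum_coeff, rowCoeff, Finset.sum_range, Finset.sum_mul]
  refine Finset.sum_congr rfl fun i _ => ?_
  rw [coeffAt_fin, iterate_derivative_monomial, ← C_mul_X_pow_eq_monomial, ← mul_assoc,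
    coeff_mul_X_pow', coeff_mul_C]
  rcases lt_or_ge j i with hji | hji
  · rw [Nat.descFactorial_of_lt hji]
    simp
  · by_cases h : j ≤ e + i
    · rw [if_pos h, if_pos (by omega)]
      have : e - (j - i) = e + i - j := by omega
      rw [this]
      simp [mul_assoc]
    · rw [if_neg h, if_neg (by omega), zero_mul]

theorem coeff_linearPart (Q : LinDiffPoly F m) {d : ℕ} {f : F[X]} (hf : f.natDegree ≤ d) (e : ℕ) :
    (Q.linearPart f).coeff e =
      ∑ j ∈ Finset.range (d + 1), rowCoeff m Q.coeffAt e j * f.coeff j := by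
  conv_lhs => rw [f.as_sum_range' (d + 1) (by omega)]
  rw [map_sum, finsetSum_coeff]
  exact Finset.sum_congr rfl fun j _ => Q.coeff_linearPart_monomial e j _

/-- Coefficients of `x ^ e` with `e > D + d` vanish for degree reasons, so finitely many rows
suffice. -/
theorem mem_solutions_iff (Q : LinDiffPoly F m) {D d : ℕ} (hQ : Q.XDegreeLE D) {f : F[X]} :
    f ∈ Q.solutions d ↔ f.natDegree ≤ d ∧
      SolvesSystem d (D + d + 1) Q.free.coeff (rowCoeff m Q.coeffAt) f.coeff := by
  refine and_congr_right fun hf => ?_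
  have hcoeff (e : ℕ) : (Q.subst f).coeff e = Q.free.coeff e +
      ∑ j ∈ Finset.range (d + 1), rowCoeff m Q.coeffAt e j * f.coeff j := by
    rw [subst_eq, coeff_add, Q.coeff_linearPart hf]
  constructor
  · intro h e _
    rw [← hcoeff, h, coeff_zero]
  · intro h
    ext e
    by_cases he : e < D + d + 1
    · rw [hcoeff, h e he, coeff_zero]
    · refine coeff_eq_zero_of_natDegree_lt (lt_of_le_of_lt ?_ (not_lt.1 he))
      rw [subst_eq, linearPart_apply]
      refine (natDegree_add_le _ _).trans (max_le (hQ.1.trans (Nat.le_add_right _ _)) ?_)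
      refine natDegree_sum_le_of_forall_le _ _ fun i _ => natDegree_mul_le.trans ?_
      exact Nat.add_le_add (hQ.2 i)
        ((natDegree_iterate_derivative f i).trans ((Nat.sub_le _ _).trans hf))

/-- The solutions of degree at most `d` of the homogeneous equation. -/
noncomputable def homogeneousSolutions (Q : LinDiffPoly F m) (d : ℕ) : Submodule F F[X] :=
  degreeLE F d ⊓ Q.linearPart.ker

theorem mem_homogeneousSolutions (Q : LinDiffPoly F m) {d : ℕ} {f : F[X]} :
    f ∈ Q.homogeneousSolutions d ↔ f.natDegree ≤ d ∧ Q.linearPart f = 0 := by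
  rw [homogeneousSolutions, Submodule.mem_inf, mem_degreeLE, LinearMap.mem_ker,
    natDegree_le_iff_degree_le]

theorem exists_coeff_ne_zero_of_solution (Q : LinDiffPoly F m) (hQ : Q.toMvPolynomial ≠ 0) {d : ℕ}
    {f : F[X]} (hf : f ∈ Q.solutions d) : ∃ i, Q.coeff i ≠ 0 := by
  by_contra! h
  have h0 : Q.free = 0 := by
    have := hf.2
    rw [subst_eq, linearPart_apply] at this
    simpa [h] using this
  exact hQ (by simp [toMvPolynomial, h, h0])

/-- Reading off the coefficients at the zeros of the indicial polynomial is an injective linear map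
on the homogeneous solutions. -/
theorem rank_homogeneousSolutions_le (Q : LinDiffPoly F m) {d : ℕ} (hd : (d.factorial : F) ≠ 0)
    (hQ : ∃ i, Q.coeff i ≠ 0) : Module.rank F (Q.homogeneousSolutions d) ≤ (m : Cardinal) := by
  classical
  -- The possible values of `a + m - i`, written additively; the least one is `σ`.
  have hex : ∃ n, ∃ i ≤ m, ∃ a, Q.coeffAt i a ≠ 0 ∧ n + i = a + m := by
    obtain ⟨i, hi⟩ := hQ
    obtain ⟨a, ha⟩ : ∃ a, (Q.coeff i).coeff a ≠ 0 := by
      by_contra! h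
      exact hi (Polynomial.ext h)
    exact ⟨a + m - i, i, Nat.lt_succ_iff.1 i.2, a, by rwa [coeffAt_fin], by omega⟩
  set σ := Nat.find hex with hσdef
  have hσ : ∀ i ≤ m, ∀ a, a + m < σ + i → Q.coeffAt i a = 0 := by
    intro i hi a ha
    by_contra h
    have := Nat.find_min' hex (m := a + m - i) ⟨i, hi, a, h, by omega⟩
    omega
  set Z : Finset ℕ := (Finset.range (d + 1)).filter fun k => triCoeff m σ Q.coeffAt k k = 0 with hZ
  have hcard : Z.card ≤ m := by
    refine card_le_of_sum_descFactorial_eq_zero hd (s := fun i => shiftedCoeff m σ Q.coeffAt i 0)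
      ?_ fun k hk => ?_
    · obtain ⟨i, hi, a, ha, h⟩ := Nat.find_spec hex
      refine ⟨i, hi, ?_⟩
      rw [shiftedCoeff, if_pos (by omega)]
      have : 0 + i + σ - m = a := by omega
      rwa [this]
    · rw [hZ, Finset.mem_filter, Finset.mem_range] at hk
      refine ⟨by omega, ?_⟩
      simpa [triCoeff] using hk.2
  let φ : Q.homogeneousSolutions d →ₗ[F] (Z → F) :=
    LinearMap.pi fun z => lcoeff F z ∘ₗ (Q.homogeneousSolutions d).subtype
  have hφ : Function.Injective φ := by
    rw [← LinearMap.ker_eq_bot, LinearMap.ker_eq_bot']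
    rintro ⟨f, hf⟩ h0
    rw [mem_homogeneousSolutions] at hf
    have hz : ∀ k ≤ d, f.coeff k = 0 := by
      refine eq_zero_of_triangular (T := triCoeff m σ Q.coeffAt) (Z := Z) ?_ ?_ ?_
      · intro k hk hkZ h
        exact hkZ (by simp [hZ, h]; omega)
      · intro k hk
        exact congrFun h0 ⟨k, hk⟩
      · intro k hk hkZ
        have hmk : m ≤ k + σ := by
          by_contra h
          exact hkZ (by simp [hZ, triCoeff_self_eq_zero (not_le.1 h)]; omega)
        rw [← sum_rowCoeff hσ hmk hk, ← Q.coeff_linearPart hf.1, hf.2, coeff_zero]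
    refine Subtype.ext (Polynomial.ext fun k => ?_)
    by_cases hk : k ≤ d
    · exact hz k hk
    · exact coeff_eq_zero_of_natDegree_lt (hf.1.trans_lt (not_le.1 hk))
  calc Module.rank F (Q.homogeneousSolutions d) ≤ Module.rank F (Z → F) :=
      LinearMap.rank_le_of_injective φ hφ
    _ = (Z.card : Cardinal) := by rw [rank_fun']; simp
    _ ≤ m := by exact_mod_cast hcard

/-- The solutions form an affine space. -/
theorem exists_affineSubspace (Q : LinDiffPoly F m) {d : ℕ} (hd : (d.factorial : F) ≠ 0)
    (hQ : Q.toMvPolynomial ≠ 0) : ∃ A : AffineSubspace F F[X],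
      (A : Set F[X]) = Q.solutions d ∧ Module.rank F A.direction ≤ (m : Cardinal) := by
  rcases (Q.solutions d).eq_empty_or_nonempty with h | ⟨f₀, hf₀⟩
  · refine ⟨⊥, by rw [h]; rfl, ?_⟩
    rw [AffineSubspace.direction_bot, rank_bot]
    exact zero_le
  · refine ⟨AffineSubspace.mk' f₀ (Q.homogeneousSolutions d), ?_, ?_⟩
    · ext f
      have h0 := hf₀.2
      rw [subst_eq] at h0
      rw [SetLike.mem_coe, AffineSubspace.mem_mk', mem_homogeneousSolutions, vsub_eq_sub, map_sub]
      constructor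
      · rintro ⟨h1, h2⟩
        refine ⟨?_, ?_⟩
        · rw [← sub_add_cancel f f₀]
          exact (natDegree_add_le _ _).trans (max_le h1 hf₀.1)
        · rw [subst_eq, sub_eq_zero.1 h2, h0]
      · rintro ⟨h1, h2⟩
        refine ⟨(natDegree_sub_le _ _).trans (max_le h1 hf₀.1), ?_⟩
        rw [subst_eq] at h2
        rw [sub_eq_zero]
        exact add_left_cancel (h2.trans h0.symm)
    · rw [AffineSubspace.direction_mk']
      exact Q.rank_homogeneousSolutions_le hd (Q.exists_coeff_ne_zero_of_solution hQ hf₀)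

section CoeffVector

theorem getD_flatMap_coeffVector (D : ℕ) (L : List F[X]) (i : ℕ) {a : ℕ} (ha : a ≤ D) :
    (L.flatMap (_root_.coeffVector D)).getD (i * (D + 1) + a) 0 = (L.getD i 0).coeff a := by
  have hlen (p : F[X]) : (_root_.coeffVector D p).length = D + 1 := by simp [_root_.coeffVector]
  induction L generalizing i with
  | nil => simp
  | cons p L ih =>
    rw [List.flatMap_cons]
    cases i with
    | zero =>
      rw [List.getD_append _ _ _ _ (by rw [hlen]; omega), List.getD_eq_getElem _ _ (by rw [hlen]; omega)]
      simp [_root_.coeffVector]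
    | succ i =>
      rw [List.getD_append_right _ _ _ _ (by rw [hlen]; nlinarith), hlen, List.getD_cons_succ, ← ih]
      congr 1
      rw [Nat.succ_mul]
      omega

variable (Q : LinDiffPoly F m) {D : ℕ}

theorem coeffVector_eq_flatMap :
    Q.coeffVector D = (Q.free :: List.ofFn Q.coeff).flatMap (_root_.coeffVector D) := rfl

theorem length_coeffVector : (Q.coeffVector D).length = (m + 2) * (D + 1) := by
  have h (p : F[X]) : (_root_.coeffVector D p).length = D + 1 := by simp [_root_.coeffVector]
  rw [coeffVector_eq_flatMap, List.length_flatMap]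
  simp only [h, List.map_const', List.sum_replicate, List.length_cons, List.length_ofFn,
    smul_eq_mul]

theorem inputFree_coeffVector (hQ : Q.XDegreeLE D) :
    (inputFree D fun i => (Q.coeffVector D).getD i 0) = Q.free.coeff := by
  funext a
  rw [inputFree]
  split_ifs with h
  · have := getD_flatMap_coeffVector D (Q.free :: List.ofFn Q.coeff) 0 h
    rwa [zero_mul, zero_add, ← coeffVector_eq_flatMap] at this
  · exact (coeff_eq_zero_of_natDegree_lt (by have := hQ.1; omega)).symm

theorem inputCoeff_coeffVector (hQ : Q.XDegreeLE D) :
    (inputCoeff D fun i => (Q.coeffVector D).getD i 0) = Q.coeffAt := by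
  funext i a
  rw [inputCoeff]
  split_ifs with h
  · exact getD_flatMap_coeffVector D (Q.free :: List.ofFn Q.coeff) (i + 1) h
  · symm
    by_cases hi : i < m + 1
    · rw [Q.coeffAt_fin ⟨i, hi⟩]
      exact coeff_eq_zero_of_natDegree_lt (by have := hQ.2 ⟨i, hi⟩; omega)
    · rw [coeffAt, List.getD_eq_default _ _ (by simp; omega), coeff_zero]

theorem exists_mem_coeffVector_ne_zero (hQ : Q.XDegreeLE D) (hQ0 : Q.toMvPolynomial ≠ 0) :
    ∃ x ∈ Q.coeffVector D, x ≠ 0 := by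
  by_contra! h
  have h0 (i : ℕ) : (Q.coeffVector D).getD i 0 = 0 := by
    by_cases hi : i < (Q.coeffVector D).length
    · rw [List.getD_eq_getElem _ _ hi]
      exact h _ (List.getElem_mem hi)
    · rw [List.getD_eq_default _ _ (not_lt.1 hi)]
  have h1 : Q.free = 0 := by
    ext a
    rw [← Q.inputFree_coeffVector hQ]
    simp only [inputFree, h0, ite_self, coeff_zero]
  have h2 (i : Fin (m + 1)) : Q.coeff i = 0 := by
    ext a
    rw [← coeffAt_fin, ← Q.inputCoeff_coeffVector hQ]
    simp only [inputCoeff, h0, ite_self, coeff_zero]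
  exact hQ0 (by simp [toMvPolynomial, h1, h2])

end CoeffVector

/-- The polynomial with given coefficients of `x ^ 0, …, x ^ d`. -/
noncomputable def ofCoeffs (d : ℕ) (f : ℕ → F) : F[X] := ∑ j ∈ Finset.range (d + 1), monomial j (f j)

theorem coeff_ofCoeffs {d j : ℕ} (f : ℕ → F) (hj : j ≤ d) : (ofCoeffs d f).coeff j = f j := by
  simp [ofCoeffs, coeff_monomial, hj]

theorem natDegree_ofCoeffs_le (d : ℕ) (f : ℕ → F) : (ofCoeffs d f).natDegree ≤ d :=
  natDegree_sum_le_of_forall_le _ _ fun _ hj => (natDegree_monomial_le _).trans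
    (Nat.lt_succ_iff.1 (Finset.mem_range.1 hj))

theorem _root_.SolvesSystem.congr {d N : ℕ} {c : ℕ → F} {B : ℕ → ℕ → F} {f g : ℕ → F}
    (h : SolvesSystem d N c B f) (hfg : ∀ j ≤ d, f j = g j) : SolvesSystem d N c B g := by
  intro e he
  rw [← h e he]
  congr 1
  refine Finset.sum_congr rfl fun j hj => ?_
  rw [hfg j (Nat.lt_succ_iff.1 (Finset.mem_range.1 hj))]

theorem ofCoeffs_mem_solutions (Q : LinDiffPoly F m) {D d : ℕ} (hQ : Q.XDegreeLE D) {f : ℕ → F}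
    (hf : SolvesSystem d (D + d + 1) Q.free.coeff (rowCoeff m Q.coeffAt) f) :
    ofCoeffs d f ∈ Q.solutions d :=
  (Q.mem_solutions_iff hQ).2 ⟨natDegree_ofCoeffs_le d f, hf.congr fun _ hj =>
    (coeff_ofCoeffs f hj).symm⟩

/-- An echelon basis gives an affine basis of the space of solutions. -/
theorem exists_isAffineBasisOf (Q : LinDiffPoly F m) {D d : ℕ} (hQ : Q.XDegreeLE D)
    {A : AffineSubspace F F[X]} (hA : (A : Set F[X]) = Q.solutions d) {o : List (List F)}
    {piv : List ℕ}
    (ho : IsEchelonBasis d (D + d + 1) Q.free.coeff (rowCoeff m Q.coeffAt) o piv) :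
    ∃ (r : ℕ) (v : Fin r → F[X]), o = (List.ofFn fun k => _root_.coeffVector d (v k)) ∧
      IsAffineBasisOf (F := F) v (Q.solutions d) := by
  obtain ⟨rfl, hno⟩ | ⟨hlen, hvlen, hpiv, hsol, hech, hspan⟩ := ho
  · have hempty : Q.solutions d = ∅ := by
      rw [Set.eq_empty_iff_forall_notMem]
      exact fun f hf => hno _ ((Q.mem_solutions_iff hQ).1 hf).2
    refine ⟨0, Fin.elim0, by simp, affineIndependent_of_subsingleton F _, ?_⟩
    rw [hempty]
    simp
  · have hvk (k : Fin o.length) : o.getD k [] = o[k] := by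
      rw [List.getD_eq_getElem _ _ k.2]
      rfl
    set v : Fin o.length → F[X] := fun k => ofCoeffs d fun j => o[k].getD j 0 with hv
    have hvA (k : Fin o.length) : v k ∈ A := by
      rw [← SetLike.mem_coe, hA]
      exact Q.ofCoeffs_mem_solutions hQ (hsol _ (List.getElem_mem k.2))
    have hpivlt (l : ℕ) (hl : l < piv.length) : piv.getD l 0 ≤ d := by
      rw [List.getD_eq_getElem _ _ hl]
      exact hpiv _ (List.getElem_mem hl)
    have hcoeff (k : Fin o.length) (l : ℕ) (hl : l < piv.length) :
        (v k).coeff (piv.getD l 0) = if (k : ℕ) = l + 1 then 1 else 0 := by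
      rw [hv, coeff_ofCoeffs _ (hpivlt l hl), ← hech k k.2 l hl, hvk]
    refine ⟨o.length, v, ?_, ?_, ?_⟩
    · refine List.ext_getElem (by simp) fun k hk _ => ?_
      rw [List.getElem_ofFn, _root_.coeffVector]
      refine List.ext_getElem (by simp [hvlen]) fun j hj _ => ?_
      have hjd : j ≤ d := by
        rw [hvlen _ (List.getElem_mem hk)] at hj
        omega
      rw [List.getElem_map, List.getElem_range]
      exact ((coeff_ofCoeffs _ hjd).trans (List.getD_eq_getElem _ _ hj)).symm
    -- In a vanishing combination, the coefficient at pivot `l` isolates the weight of vector `l +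
    -- 1`; the remaining weight, of vector `0`, vanishes because the weights sum to zero.
    · rw [affineIndependent_iff]
      intro s w hw hws k hk
      have hsucc : ∀ k ∈ s, (k : ℕ) ≠ 0 → w k = 0 := by
        intro k hk hk0
        have hl : (k : ℕ) - 1 < piv.length := by omega
        have := congrArg (fun p : F[X] => p.coeff (piv.getD (k - 1) 0)) hws
        simp only [finsetSum_coeff, coeff_smul, hcoeff _ _ hl, coeff_zero, smul_eq_mul] at this
        rw [Finset.sum_eq_single k] at this
        · rwa [if_pos (by omega), mul_one] at this
        · intro k' _ hk'
          rw [if_neg (fun h => hk' (Fin.ext (by omega))), mul_zero]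
        · exact fun h => absurd hk h
      by_cases hk0 : (k : ℕ) = 0
      · rw [Finset.sum_eq_single k] at hw
        · exact hw
        · exact fun k' hk' hne => hsucc k' hk' fun h => hne (Fin.ext (by omega))
        · exact fun h => absurd hk h
      · exact hsucc k hk hk0
    · refine Set.Subset.antisymm ?_ fun f hf => ?_
      · rw [← hA]
        exact affineSpan_le.2 (Set.range_subset_iff.2 hvA)
      · have hmem (k : Fin o.length) : v k ∈ affineSpan F (Set.range v) :=
          subset_affineSpan F _ (Set.mem_range_self k)
        have h0 : 0 < o.length := by omega
        obtain ⟨hfd, hfs⟩ := (Q.mem_solutions_iff hQ).1 hf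
        -- A solution is the base point plus the directions weighted by its own coefficients at the
        -- pivots.
        have hf' : f = (∑ l : Fin piv.length, f.coeff (piv.getD l 0) •
            (v ⟨l + 1, by omega⟩ -ᵥ v ⟨0, h0⟩)) +ᵥ v ⟨0, h0⟩ := by
          ext j
          rw [vadd_eq_add, coeff_add, finsetSum_coeff]
          by_cases hj : j ≤ d
          · rw [hspan _ hfs j hj, Finset.sum_range, add_comm]
            simp only [hv, vsub_eq_sub, coeff_smul, coeff_sub, coeff_ofCoeffs _ hj, smul_eq_mul]
            congr 1
            · refine Finset.sum_congr rfl fun l _ => ?_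
              rw [hvk ⟨l + 1, by omega⟩, hvk ⟨0, h0⟩]
            · rw [hvk ⟨0, h0⟩]
          · have hz (p : F[X]) (hp : p.natDegree ≤ d) : p.coeff j = 0 :=
              coeff_eq_zero_of_natDegree_lt (by omega)
            simp [hz f hfd, hv, hz _ (natDegree_ofCoeffs_le d _)]
        rw [SetLike.mem_coe, hf']
        exact AffineSubspace.vadd_mem_of_mem_direction (Submodule.sum_mem _ fun l _ =>
          Submodule.smul_mem _ _ (AffineSubspace.vsub_mem_direction (hmem _) (hmem _))) (hmem _)

end LinDiffPoly

/-- A prime `p` divides `d!` only if `p ≤ d`; this is the only way in which the characteristic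
enters. -/
theorem factorial_cast_ne_zero {F : Type*} [Field F] {d : ℕ}
    (h : ringChar F = 0 ∨ d < ringChar F) : (d.factorial : F) ≠ 0 := by
  obtain h | h := h
  · have : CharP F 0 := h ▸ ringChar.charP F
    have := CharP.charP_to_charZero F
    exact_mod_cast d.factorial_ne_zero
  · have hp : (ringChar F).Prime := (CharP.char_is_prime_or_zero F (ringChar F)).resolve_right
      (by omega)
    rw [Ne, ringChar.spec, hp.dvd_factorial]
    omega

/-- The constant is `38880 = 720 * 2 * 3 ^ 3`: rounding up to a power of two costs a factor `2`, and
`log (D + d + 1) + 2` is at most three times the logarithm in the statement, which is at least `1`.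
-/
theorem CertProgram.opBound_le (m D d : ℕ) : opBound m D d ≤
    38880 * (D + d + 1) * (m + 1) ^ 2 * Nat.log 2 (D + d + 2) ^ 3 := by
  have h1 : 2 ^ Nat.log 2 (D + d + 1) ≤ D + d + 1 := Nat.pow_log_le_self 2 (by omega)
  have h2 : Nat.log 2 (D + d + 1) ≤ Nat.log 2 (D + d + 2) := Nat.log_mono_right (by omega)
  have h3 : 1 ≤ Nat.log 2 (D + d + 2) := Nat.log_pos one_lt_two (by omega)
  calc opBound m D d
      = 720 * (m + 1) ^ 2 * (2 ^ Nat.log 2 (D + d + 1) * 2) *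
        (Nat.log 2 (D + d + 1) + 1 + 1) ^ 3 := by rw [opBound, pow_succ 2]
    _ ≤ 720 * (m + 1) ^ 2 * ((D + d + 1) * 2) * (3 * Nat.log 2 (D + d + 2)) ^ 3 := by
      gcongr
      omega
    _ = 38880 * (D + d + 1) * (m + 1) ^ 2 * Nat.log 2 (D + d + 2) ^ 3 := by ring

theorem mainTheorem4 :
    (∀ (F : Type*) [Field F] (m d : ℕ) (Q : LinDiffPoly F m),
      (ringChar F = 0 ∨ d < ringChar F) → Q.toMvPolynomial ≠ 0 →
        ∃ A : AffineSubspace F F[X],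
          (A : Set F[X]) = Q.solutions d ∧ Module.rank F A.direction ≤ (m : Cardinal)) ∧
    ∃ (A : FieldAlgorithm) (c : ℕ),
      ∀ (F : Type*) [Field F] (m D d : ℕ) (Q : LinDiffPoly F m),
        (ringChar F = 0 ∨ d < ringChar F) → Q.toMvPolynomial ≠ 0 → Q.XDegreeLE D →
          ∃ (n r : ℕ) (v : Fin r → F[X]),
            A.Runs (A.init (m, D, d)) (Q.coeffVector D) n
              (List.ofFn fun k => coeffVector d (v k)) ∧
            IsAffineBasisOf (F := F) v (Q.solutions d) ∧
            n ≤ c * (D + d + 1) * (m + 1) ^ c * Nat.log 2 (D + d + 2) ^ c := by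

  -- One constant serves as factor and as both exponents; only its lower bound matters, since the
  -- bases of the powers are at least `1`.
  obtain ⟨c, hc⟩ : ∃ c, 38880 ≤ c := ⟨38880, le_rfl⟩
  refine ⟨fun F _ m d Q hF hQ => Q.exists_affineSubspace (factorial_cast_ne_zero hF) hQ,
    CertProgram.searchAlgorithm, c, fun F _ m D d Q hF hQ hD => ?_⟩
  have hd := factorial_cast_ne_zero hF
  obtain ⟨A, hA, -⟩ := Q.exists_affineSubspace hd hQ
  obtain ⟨n, hn, out, piv, hrun, hout⟩ := CertProgram.searchAlgorithm_runs hd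
    Q.length_coeffVector (Q.exists_mem_coeffVector_ne_zero hD hQ)
  rw [Q.inputFree_coeffVector hD, Q.inputCoeff_coeffVector hD] at hout
  obtain ⟨r, v, rfl, hv⟩ := Q.exists_isAffineBasisOf hD hA hout
  have h3 : 0 < Nat.log 2 (D + d + 2) := Nat.log_pos one_lt_two (by omega)
  refine ⟨n, r, v, hrun, hv, (hn.trans (CertProgram.opBound_le m D d)).trans ?_⟩
  gcongr
  · exact m.succ_pos
  · omega
  · omega
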